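/- **Setting.** Let $X$ be an infinite, totally disconnected, compact metrizable space, $T\colon X\to X$ a homeomorphism, and $\mu$ an ergodic $T$-invariant Borel probability measure on $X$ that is full (every nonempty open set has positive measure). Let $K$ be a field with a positive definite involution (for all $m$ and $\lambda_1,\dots,\lambda_m\in K$, $\sum_i\lambda_i^*\lambda_i=0$ implies $\lambda_1=\dots=\lambda_m=0$). Let $C_K(X)$ be the algebra of locally constant functions $X\to K$ and $\mathcal A=C_K(X)\rtimes_T\mathbb Z$ the crossed product $*$-algebra, whose elements are the finite sums $\sum_n f_nt^n$, with $t f t^{-1}=f\circ T^{-1}$, $t^*=t^{-1}$, $f^*(x)=f(x)^*$. Let $(E_n,\mathcal P_n)_{n\ge 0}$ be a sequence in which each $E_n$ is a nonempty clopen set, each $\mathcal P_n$ is a finite partition of $X\setminus E_n$ into nonempty clopen sets, and (a) $E_{n+1}\subseteq E_n$ and $\bigcap_nE_n=\{y\}$ for a point $y\in X$; (b) the partition $\mathcal P_{n+1}\cup\{E_{n+1}\}$ refines $\mathcal P_n\cup\{E_n\}$; (c) $\bigcup_n(\mathcal P_n\cup\{E_n\})$ generates the topology of $X$. * $\mathcal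 A_n\subseteq\mathcal A$ is the unital $*$-subalgebra generated by $\{\chi_Zt: Z\in\mathcal P_n\}$. * $\mathcal V_n$ is the set of nonempty sets $W=E_n\cap T^{-1}(Z_1)\cap\dots\cap T^{-k+1}(Z_{k-1})\cap T^{-k}(E_n)$ with $k\ge1$ and $Z_i\in\mathcal P_n$; write $|W|=k$. * $\mathfrak R_n=\prod_{W\in\mathcal V_n}M_{|W|}(K)$, with componentwise conjugate transposition, and $\pi_n\colon\mathcal A_n\to\mathfrak R_n$ is the $*$-homomorphism $\pi_n(a)=(h_W a)_W$, where $h_W=\sum_{0\le i<|W|}\chi_{T^i(W)}$ and where $M_{|W|}(K)$ is identified with the span of the matrix units $e_{ij}(W)=\chi_{T^i(W)}t^{i-j}$, $0\le i,j<|W|$. * $j_n\colon\mathfrak R_n\to\mathfrak R_{n+1}$ is the block-diagonal $*$-homomorphism whose component at $W'\in\mathcal V_{n+1}$ has one diagonal block $M_W$, on the indices $s,\dots,s+|W|-1$, for each pair $(s,W)$ with $0\le s<|W'|$, $W\in\mathcal V_n$ and $T^s(W')\subseteq W$. * $\mathcal A_\infty=\bigcup_n\mathcal A_n$, $\mathfrak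 R_\infty=\varinjlim(\mathfrak R_n,j_n)$, and $\pi_\infty\colon\mathcal A_\infty\to\mathfrak R_\infty$ is induced by the $\pi_n$. * $\mathrm{rk}_n(M)=\sum_{W\in\mathcal V_n}\mu(W)\,\mathrm{Rk}(M_W)$ on $\mathfrak R_n$, with $\mathrm{Rk}$ the usual rank of matrices. These functions are compatible with the $j_n$ and define $\mathrm{rk}_\infty$ on $\mathfrak R_\infty$; $\mathfrak R_{\mathrm{rk}}$ is the completion of $\mathfrak R_\infty$ in the metric $d(x,y)=\mathrm{rk}_\infty(x-y)$. * A $*$-homomorphism $\varphi\colon\mathcal A\to\mathfrak R_{\mathrm{rk}}$ of $K$-algebras is *canonical* if it extends $\mathcal A_\infty\xrightarrow{\pi_\infty}\mathfrak R_\infty\to\mathfrak R_{\mathrm{rk}}$ and $\varphi(t)=\lim_n\pi_n(\chi_{X\setminus E_n}t)$ in $\mathfrak R_{\mathrm{rk}}$. A $*$-regular ring is a von Neumann regular $*$-ring in which $x^*x=0$ implies $x=0$. The $*$-regular closure of a subset $S$ of a $*$-regular ring $R$ is the smallest $*$-subring of $R$ that contains $S$ and is $*$-regular. **Proposition.** The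 $*$-rings $\mathfrak R_n$, $\mathfrak R_\infty$ and $\mathfrak R_{\mathrm{rk}}$ are $*$-regular, and there is exactly one canonical $*$-homomorphism $\varphi\colon\mathcal A\to\mathfrak R_{\mathrm{rk}}$; it is injective. Let $\mathcal R_n$ be the $*$-regular closure of $\pi_n(\mathcal A_n)$ in $\mathfrak R_n$, $\mathcal R_\infty$ that of $\pi_\infty(\mathcal A_\infty)$ in $\mathfrak R_\infty$, and $\mathcal R_{\mathcal A}$ that of $\varphi(\mathcal A)$ in $\mathfrak R_{\mathrm{rk}}$. Then $\mathcal A_n\subseteq\mathcal A_{n+1}$, $j_n(\mathcal R_n)\subseteq\mathcal R_{n+1}$ for all $n$, the image of $\mathcal R_\infty$ in $\mathfrak R_{\mathrm{rk}}$ lies in $\mathcal R_{\mathcal A}$, and, identifying each $\mathcal R_n$ with its image in $\mathfrak R_\infty$, $$\mathcal R_\infty=\bigcup_n\mathcal R_n .$$ In other words, there is a commutative diagram, all of whose arrows are injective, $$\begin{array}{ccccccccccc} \cdots&\to&\mathcal A_n&\subseteq&\mathcal A_{n+1}&\subseteq&\cdots&\subseteq&\mathcal A_\infty&\subseteq&\mathcal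 A\\ &&\downarrow&&\downarrow&&&&\downarrow&&\downarrow\\ \cdots&\to&\mathcal R_n&\to&\mathcal R_{n+1}&\to&\cdots&\to&\mathcal R_\infty&\to&\mathcal R_{\mathcal A}\\ &&\downarrow&&\downarrow&&&&\downarrow&&\downarrow\\ \cdots&\to&\mathfrak R_n&\xrightarrow{j_n}&\mathfrak R_{n+1}&\to&\cdots&\to&\mathfrak R_\infty&\to&\mathfrak R_{\mathrm{rk}} \end{array}$$ in which the vertical maps from the first row are corestrictions of the $\pi_n$, $\pi_\infty$ and $\varphi$, the vertical maps to the last row are inclusions, and the horizontal maps of the second row are restrictions of those of the third row. -/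

import Mathlib

open scoped ENNReal Topology
open MeasureTheory Filter

noncomputable section

set_option linter.unusedSectionVars false

namespace RegClosure

/-! ### `*`-regular rings and `*`-regular closures -/

/-- A `*`-regular ring: a von Neumann regular ring with a proper involution. -/
def IsStarRegularRing (R : Type*) [Ring R] [StarRing R] : Prop :=
  (∀ x : R, ∃ y : R, x * y * x = x) ∧ ∀ x : R, star x * x = 0 → x = 0

/-- A unital subring `B` of `R` that is closed under the involution of `R` and that is a
`*`-regular ring with the restricted involution. -/
def IsStarRegularSubring {R : Type*} [Ring R] [StarRing R] (B : Subring R) : Prop :=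
  (∀ x ∈ B, star x ∈ B) ∧ (∀ x ∈ B, ∃ y ∈ B, x * y * x = x) ∧
    ∀ x ∈ B, star x * x = 0 → x = 0

/-- The `*`-regular closure of the subset `S` in `R`: the smallest unital `*`-regular subring of `R`
that contains `S` (see `isLeast_starRegularClosure`). -/
def starRegularClosure {R : Type*} [Ring R] [StarRing R] (S : Set R) : Subring R :=
  sInf {B : Subring R | S ⊆ B ∧ IsStarRegularSubring B}

/-- In a subring that is `*`-regular every element has a relative inverse. -/
theorem IsStarRegularSubring.exists_relInverse {R : Type*} [Ring R] [StarRing R] {B : Subring R}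
    (hB : IsStarRegularSubring B) {x : R} (hx : x ∈ B) :
    ∃ y ∈ B, x * y * x = x ∧ y * x * y = y ∧ star (x * y) = x * y ∧ star (y * x) = y * x := by
  obtain ⟨hs, hr, hp⟩ := hB
  have key : ∀ x ∈ B, ∃ z ∈ B, x * z * star x * x = x := by
    intro x hx
    obtain ⟨z, hz, h⟩ := hr (star x * x) (B.mul_mem (hs x hx) hx)
    refine ⟨z, hz, ?_⟩
    have hu : x * z * star x * x - x ∈ B :=
      B.sub_mem (B.mul_mem (B.mul_mem (B.mul_mem hx hz) (hs x hx)) hx) hx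
    refine sub_eq_zero.1 (hp _ hu ?_)
    have h0 : star x * (x * z * star x * x - x) = 0 := by
      rw [mul_sub, sub_eq_zero, ← h]; noncomm_ring
    have h1 : x * z * star x * x - x = x * (z * star x * x - 1) := by noncomm_ring
    have h2 : star (x * z * star x * x - x) = star (z * star x * x - 1) * star x := by
      rw [h1, star_mul]
    rw [h2, mul_assoc, h0, mul_zero]
  have proj : ∀ x z : R, x * z * star x * x = x → star (x * z * star x) = x * z * star x := by
    intro x z h
    have h1 : star (x * z * star x) = x * star z * star x := by
      simp [star_mul, mul_assoc]
    have h2 : star x = star x * x * star z * star x := by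
      conv_lhs => rw [← h]
      simp [star_mul, mul_assoc]
    have h3 : x * z * star x = (x * z * star x) * star (x * z * star x) := by
      rw [h1]
      calc x * z * star x = x * z * (star x * x * star z * star x) := by rw [← h2]
        _ = _ := by noncomm_ring
    rw [h3, star_mul, star_star]
  obtain ⟨z, hz, h⟩ := key x hx
  obtain ⟨w, hw, h'⟩ := key (star x) (hs x hx)
  rw [star_star] at h'
  have hpz := proj x z h
  have hqw := proj (star x) w (by rw [star_star]; exact h')
  rw [star_star] at hqw
  set p := x * z * star x with hpdef
  set q := star x * w * x with hqdef
  have hxq : x * q = x := by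
    have := congrArg star h'
    rw [star_mul, star_star, hqw] at this
    exact this
  have hpB : p ∈ B := B.mul_mem (B.mul_mem hx hz) (hs x hx)
  have hqB : q ∈ B := B.mul_mem (B.mul_mem (hs x hx) hw) hx
  have e1 : x * (q * (z * star x)) = p := by
    rw [← mul_assoc, hxq, hpdef, mul_assoc]
  have e2 : q * (z * star x) * x = q := by
    have hqq : q * q = q := by
      rw [hqdef]
      calc star x * w * x * (star x * w * x) = star x * w * (x * (star x * w * x)) := by
            noncomm_ring
        _ = _ := by rw [hxq]
    have h3 : x * (q * (z * star x) * x - q) = 0 := by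
      rw [mul_sub, hxq, ← mul_assoc, e1, h, sub_self]
    have h4 : q * (q * (z * star x) * x - q) = 0 := by
      calc q * (q * (z * star x) * x - q) = star x * w * (x * (q * (z * star x) * x - q)) := by
            rw [hqdef]; noncomm_ring
        _ = 0 := by rw [h3, mul_zero]
    have h5 : q * (q * (z * star x) * x - q) = q * (z * star x) * x - q := by
      rw [mul_sub, hqq, ← mul_assoc, ← mul_assoc, hqq]
    rw [h5] at h4
    exact sub_eq_zero.1 h4
  refine ⟨q * (z * star x), B.mul_mem hqB (B.mul_mem hz (hs x hx)), ?_, ?_, ?_, ?_⟩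
  · rw [e1, h]
  · have hqq : q * q = q := by
      calc star x * w * x * (star x * w * x) = star x * w * (x * (star x * w * x)) := by
            noncomm_ring
        _ = _ := by rw [hxq]
    rw [e2, ← mul_assoc, hqq]
  · rw [e1]; exact hpz
  · rw [e2]; exact hqw

/-- Relative inverses are unique. -/
theorem relInverse_unique {R : Type*} [Ring R] [StarRing R] {x y z : R}
    (hy : x * y * x = x ∧ y * x * y = y ∧ star (x * y) = x * y ∧ star (y * x) = y * x)
    (hz : x * z * x = x ∧ z * x * z = z ∧ star (x * z) = x * z ∧ star (z * x) = z * x) : y = z := by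
  obtain ⟨y1, y2, y3, y4⟩ := hy
  obtain ⟨z1, z2, z3, z4⟩ := hz
  have hxy : x * y = x * z := by
    calc x * y = x * z * (x * y) := by rw [← mul_assoc, z1]
      _ = star (x * z) * star (x * y) := by rw [z3, y3]
      _ = star (x * y * (x * z)) := (star_mul _ _).symm
      _ = star (x * z) := by rw [← mul_assoc, y1]
      _ = x * z := z3
  have hyx : y * x = z * x := by
    calc y * x = y * x * (z * x) := by rw [mul_assoc, ← mul_assoc x, z1]
      _ = star (y * x) * star (z * x) := by rw [z4, y4]
      _ = star (z * x * (y * x)) := (star_mul _ _).symm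
      _ = star (z * x) := by rw [mul_assoc, ← mul_assoc x, y1]
      _ = z * x := z4
  calc y = y * x * y := y2.symm
    _ = z * x * y := by rw [hyx]
    _ = z * (x * z) := by rw [mul_assoc, hxy]
    _ = z := by rw [← mul_assoc, z2]

/-- In a `*`-regular ring the `*`-regular closure of `S` is the smallest `*`-regular subring
containing `S`. -/
theorem isLeast_starRegularClosure {R : Type*} [Ring R] [StarRing R] (hR : IsStarRegularRing R)
    (S : Set R) :
    IsLeast {B : Subring R | S ⊆ B ∧ IsStarRegularSubring B} (starRegularClosure S) := by
  have htop : IsStarRegularSubring (⊤ : Subring R) :=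
    ⟨fun _ _ => trivial, fun x _ => (hR.1 x).imp fun y hy => ⟨trivial, hy⟩, fun x _ => hR.2 x⟩
  refine ⟨⟨?_, ?_, ?_, fun x _ => hR.2 x⟩, fun B hB => sInf_le hB⟩
  · intro x hx
    exact Subring.mem_sInf.2 fun B hB => hB.1 hx
  · intro x hx
    exact Subring.mem_sInf.2 fun B hB => hB.2.1 x (Subring.mem_sInf.1 hx B hB)
  · intro x hx
    obtain ⟨y, -, hy⟩ := htop.exists_relInverse (Subring.mem_top x)
    refine ⟨y, Subring.mem_sInf.2 fun B hB => ?_, hy.1⟩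
    obtain ⟨z, hzB, hz⟩ := hB.2.exists_relInverse (Subring.mem_sInf.1 hx B hB)
    rw [relInverse_unique hy hz]
    exact hzB

/-- The involution of `K` is positive definite: `∑ x̄ᵢ xᵢ = 0` only if all `xᵢ` vanish. -/
def IsPositiveDefiniteInvolution (K : Type*) [Ring K] [StarRing K] : Prop :=
  ∀ (n : ℕ) (x : Fin n → K), ∑ i, star (x i) * x i = 0 → ∀ i, x i = 0

/-! ### Auxiliary inequalities -/

theorem rank_add_le_aux {K : Type*} [Field K] {n : ℕ} (M N : Matrix (Fin n) (Fin n) K) :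
    (M + N).rank ≤ M.rank + N.rank := by
  unfold Matrix.rank
  refine le_trans (Submodule.finrank_mono (t := LinearMap.range M.mulVecLin ⊔
    LinearMap.range N.mulVecLin) ?_) (Submodule.finrank_add_le_finrank_add_finrank _ _)
  rintro _ ⟨v, rfl⟩
  rw [Matrix.mulVecLin_add]
  exact Submodule.add_mem_sup ⟨v, rfl⟩ ⟨v, rfl⟩

theorem rank_star_le_aux {K : Type*} [Field K] [StarRing K] {n : ℕ}
    (M : Matrix (Fin n) (Fin n) K) : (star M).rank ≤ M.rank := by
  obtain ⟨V, U, e, hV, hU, h⟩ := Matrix.exists_rank_normal_form M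
  obtain ⟨V', hV'⟩ := hV.exists_left_inv
  obtain ⟨U', hU'⟩ := hU.exists_right_inv
  have hNs : star (V * M * U) = V * M * U := by
    rw [h, Matrix.star_eq_conjTranspose, Matrix.conjTranspose_submatrix,
      Matrix.fromBlocks_conjTranspose, Matrix.conjTranspose_one, Matrix.conjTranspose_zero,
      Matrix.conjTranspose_zero, Matrix.conjTranspose_zero]
  have hM : M = V' * (V * M * U) * U' := by
    calc M = (V' * V) * M * (U * U') := by rw [hV', hU', one_mul, mul_one]
      _ = V' * (V * M * U) * U' := by simp only [mul_assoc]
  have hM' : star M = star U' * ((V * M * U) * star V') := by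
    calc star M = star (V' * (V * M * U) * U') := by rw [← hM]
      _ = _ := by rw [star_mul, star_mul, hNs]
  calc (star M).rank ≤ ((V * M * U) * star V').rank := by
        rw [hM']; exact Matrix.rank_mul_le_right _ _
    _ ≤ (V * M * U).rank := Matrix.rank_mul_le_left _ _
    _ ≤ (V * M).rank := Matrix.rank_mul_le_left _ _
    _ ≤ M.rank := Matrix.rank_mul_le_right _ _

theorem limsup_add_le_aux (u v : ℕ → ℝ≥0∞) :
    limsup (fun n => u n + v n) atTop ≤ limsup u atTop + limsup v atTop := by
  refine ENNReal.le_of_forall_pos_le_add fun ε hε hlt => ?_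
  have h1 : limsup u atTop ≠ ⊤ := (lt_of_le_of_lt le_self_add hlt).ne
  have h2 : limsup v atTop ≠ ⊤ := (lt_of_le_of_lt le_add_self hlt).ne
  have hε' : (ε / 2 : ℝ≥0∞) ≠ 0 := by simp [hε.ne']
  have e1 := eventually_lt_of_limsup_lt (ENNReal.lt_add_right h1 hε')
  have e2 := eventually_lt_of_limsup_lt (ENNReal.lt_add_right h2 hε')
  refine limsup_le_of_le (h := ?_)
  filter_upwards [e1, e2] with n hn1 hn2
  calc u n + v n ≤ (limsup u atTop + ε / 2) + (limsup v atTop + ε / 2) := add_le_add hn1.le hn2.le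
    _ = limsup u atTop + limsup v atTop + (ε / 2 + ε / 2) := by ring
    _ = _ := by rw [ENNReal.add_halves]

/-! ### The crossed product `C_K(X) ⋊_T ℤ` -/

section CrossedProduct

variable {X : Type*} [TopologicalSpace X]

/-- The ring `C_K(X)` of locally constant functions `X → K`; the homeomorphism `T` is recorded in
the type because `ℤ` acts through it. -/
def Coeff (_T : X ≃ₜ X) (K : Type*) : Type _ := LocallyConstant X K

variable {T : X ≃ₜ X} {K : Type*} [Field K]

instance : CommRing (Coeff T K) := inferInstanceAs (CommRing (LocallyConstant X K))

instance : Algebra K (Coeff T K) := inferInstanceAs (Algebra K (LocallyConstant X K))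

instance {X : Type*} [TopologicalSpace X] {T : X ≃ₜ X} {K : Type*} : FunLike (Coeff T K) X K :=
  inferInstanceAs (FunLike (LocallyConstant X K) X K)

@[ext] theorem Coeff.ext {X : Type*} [TopologicalSpace X] {T : X ≃ₜ X} {K : Type*}
    {f g : Coeff T K} (h : ∀ x, f x = g x) : f = g := DFunLike.ext f g h

@[simp] theorem Coeff.add_apply (f g : Coeff T K) (x : X) : (f + g) x = f x + g x := rfl
@[simp] theorem Coeff.mul_apply (f g : Coeff T K) (x : X) : (f * g) x = f x * g x := rfl
@[simp] theorem Coeff.zero_apply (x : X) : (0 : Coeff T K) x = 0 := rfl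
@[simp] theorem Coeff.one_apply (x : X) : (1 : Coeff T K) x = 1 := rfl
@[simp] theorem Coeff.smul_apply (c : K) (f : Coeff T K) (x : X) : (c • f) x = c * f x := rfl
@[simp] theorem Coeff.algebraMap_apply (c : K) (x : X) : algebraMap K (Coeff T K) c x = c := rfl

/-- The action of `ℤ` on `C_K(X)`: the integer `n` maps `f` to `f ∘ T⁻ⁿ`. -/
instance : MulSemiringAction (Multiplicative ℤ) (Coeff T K) where
  smul n f := LocallyConstant.comap (T ^ (-n.toAdd) : X ≃ₜ X) f
  one_smul f := by
    ext x; change f ((T ^ (-(0 : ℤ)) : X ≃ₜ X) x) = f x; simp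
  mul_smul m n f := by
    ext x
    change f ((T ^ (-(m.toAdd + n.toAdd)) : X ≃ₜ X) x) = f ((T ^ (-n.toAdd) * T ^ (-m.toAdd)) x)
    rw [← zpow_add, neg_add_rev]
  smul_zero _ := rfl
  smul_add _ _ _ := rfl
  smul_one _ := rfl
  smul_mul _ _ _ := rfl

theorem Coeff.zsmul_apply (n : Multiplicative ℤ) (f : Coeff T K) (x : X) :
    (n • f) x = f ((T ^ (-n.toAdd) : X ≃ₜ X) x) := rfl

instance : SMulCommClass (Multiplicative ℤ) K (Coeff T K) := ⟨fun _ _ _ => rfl⟩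

/-- The characteristic function `χ_Z` of a clopen set `Z`. -/
def chi (T : X ≃ₜ X) (K : Type*) [Field K] (Z : Set X) (hZ : IsClopen Z) : Coeff T K :=
  LocallyConstant.charFn K hZ

open Classical in
theorem chi_apply {Z : Set X} (hZ : IsClopen Z) (x : X) :
    chi T K Z hZ x = if x ∈ Z then 1 else 0 := by
  change LocallyConstant.charFn K hZ x = _
  rw [LocallyConstant.coe_charFn, Set.indicator_apply]
  rfl

variable (T K) in
/-- The algebraic crossed product `C_K(X) ⋊_T ℤ`: finite sums `∑ fₙ tⁿ` with `fₙ ∈ C_K(X)` and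
`t f t⁻¹ = f ∘ T⁻¹`. The element `f tⁿ` is `SkewMonoidAlgebra.single (Multiplicative.ofAdd n) f`. -/
abbrev CrossedProduct := SkewMonoidAlgebra (Coeff T K) (Multiplicative ℤ)

/-- The element `f tⁿ` of the crossed product. -/
def monom (f : Coeff T K) (n : ℤ) : CrossedProduct T K :=
  SkewMonoidAlgebra.single (Multiplicative.ofAdd n) f

/-- The coefficient of `tⁿ` in `a`, evaluated at the point `x`. -/
def coef (a : CrossedProduct T K) (n : ℤ) (x : X) : K := a.coeff (Multiplicative.ofAdd n) x

theorem ext_coef {a b : CrossedProduct T K} (h : ∀ n x, coef a n x = coef b n x) : a = b :=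
  SkewMonoidAlgebra.ext fun n => Coeff.ext fun x => h n.toAdd x

theorem coef_add (a b : CrossedProduct T K) (n : ℤ) (x : X) :
    coef (a + b) n x = coef a n x + coef b n x := by
  simp [coef, SkewMonoidAlgebra.coeff_add]

theorem coef_monom (f : Coeff T K) (m n : ℤ) (x : X) :
    coef (monom f m) n x = if m = n then f x else 0 := by
  unfold coef monom
  rw [SkewMonoidAlgebra.coeff_single_apply]
  simp only [EmbeddingLike.apply_eq_iff_eq]
  split_ifs <;> rfl

theorem coef_smul (c : K) (a : CrossedProduct T K) (n : ℤ) (x : X) :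
    coef (c • a) n x = c * coef a n x := by
  simp [coef, SkewMonoidAlgebra.coeff_smul]

theorem coef_algebraMap (c : K) (n : ℤ) (x : X) :
    coef (algebraMap K (CrossedProduct T K) c) n x = if n = 0 then c else 0 := by
  have : algebraMap K (CrossedProduct T K) c = monom (algebraMap K _ c) 0 := rfl
  rw [this, coef_monom]
  simp [eq_comm]

theorem coef_finite (a : CrossedProduct T K) (x : X) :
    (Function.support fun n => coef a n x).Finite := by
  refine Set.Finite.subset ((a.support.image Multiplicative.toAdd).finite_toSet) ?_
  intro n hn
  simp only [Finset.coe_image, Set.mem_image, Finset.mem_coe]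
  refine ⟨Multiplicative.ofAdd n, SkewMonoidAlgebra.mem_support_iff.2 fun h => hn ?_, rfl⟩
  simp [coef, h]

theorem coef_mul (a b : CrossedProduct T K) (n : ℤ) (x : X) :
    coef (a * b) n x = ∑ᶠ k : ℤ, coef a k x * coef b (n - k) ((T ^ (-k) : X ≃ₜ X) x) := by
  have h : (Function.support fun k => coef a k x * coef b (n - k) ((T ^ (-k) : X ≃ₜ X) x)) ⊆
      (a.support.image Multiplicative.toAdd : Finset ℤ) := by
    intro k hk
    simp only [Finset.coe_image, Set.mem_image, Finset.mem_coe]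
    refine ⟨Multiplicative.ofAdd k, SkewMonoidAlgebra.mem_support_iff.2 fun h => hk ?_, rfl⟩
    simp [coef, h]
  rw [finsum_eq_sum_of_support_subset _ h, Finset.sum_image (by intro _ _ _ _ h; exact h)]
  unfold coef
  rw [SkewMonoidAlgebra.coeff_mul_left, SkewMonoidAlgebra.sum_def']
  have happ : ∀ (s : Finset (Multiplicative ℤ)) (F : Multiplicative ℤ → Coeff T K),
      (∑ i ∈ s, F i) x = ∑ i ∈ s, F i x := by
    intro s F
    induction s using Finset.cons_induction with
    | empty => rfl
    | cons i s hi ih => rw [Finset.sum_cons, Finset.sum_cons, Coeff.add_apply, ih]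
  rw [happ]
  refine Finset.sum_congr rfl fun k _ => ?_
  rw [Coeff.mul_apply, Coeff.zsmul_apply, ofAdd_sub, ofAdd_toAdd, div_eq_inv_mul]

variable [StarRing K]

/-- The involution of `C_K(X)`: pointwise application of the involution of `K`. -/
instance : StarRing (Coeff T K) where
  star f := LocallyConstant.map star f
  star_involutive f := by ext x; exact star_star (f x)
  star_mul f g := by ext x; exact star_mul (f x) (g x)
  star_add f g := by ext x; exact star_add (f x) (g x)

@[simp] theorem Coeff.star_apply (f : Coeff T K) (x : X) : (star f) x = star (f x) := rfl

/-- The involution of the crossed product: `(∑ fₙ tⁿ)^* = ∑ t⁻ⁿ fₙ^* = ∑ (fₙ^* ∘ Tⁿ) t⁻ⁿ`. -/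
instance : Star (CrossedProduct T K) where
  star a := a.sum fun n f => SkewMonoidAlgebra.single n⁻¹ (n⁻¹ • star f)

theorem coef_star (a : CrossedProduct T K) (n : ℤ) (x : X) :
    coef (star a) n x = star (coef a (-n) ((T ^ (-n) : X ≃ₜ X) x)) := by
  have key : ∀ m : Multiplicative ℤ, (star a).coeff m = m • star (a.coeff m⁻¹) := by
    intro m
    change (a.sum fun n f => SkewMonoidAlgebra.single n⁻¹ (n⁻¹ • star f)).coeff m = _
    induction a using SkewMonoidAlgebra.induction_on with
    | zero => simp
    | single g f =>
      rw [SkewMonoidAlgebra.sum_single_index (by simp), SkewMonoidAlgebra.coeff_single_apply,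
        SkewMonoidAlgebra.coeff_single_apply]
      by_cases h : g⁻¹ = m
      · subst h; simp
      · rw [if_neg h, if_neg (fun h' => h (by rw [h', inv_inv]))]; simp
    | add f g hf hg =>
      rw [SkewMonoidAlgebra.sum_add_index' (by simp) (by simp), SkewMonoidAlgebra.coeff_add,
        Finsupp.add_apply, hf, hg, SkewMonoidAlgebra.coeff_add, Finsupp.add_apply, star_add,
        smul_add]
  unfold coef
  rw [key]
  rfl

instance : StarRing (CrossedProduct T K) where
  star_involutive a := ext_coef fun n x => by
    rw [coef_star, coef_star, star_star, neg_neg, ← Homeomorph.mul_apply, ← zpow_add]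
    simp
  star_add a b := ext_coef fun n x => by
    rw [coef_star, coef_add, coef_add, coef_star, coef_star, star_add]
  star_mul a b := ext_coef fun n x => by
    rw [coef_star, coef_mul, coef_mul]
    have hfin : (Function.support fun k : ℤ => coef a k ((T ^ (-n) : X ≃ₜ X) x) *
        coef b (-n - k) ((T ^ (-k) : X ≃ₜ X) ((T ^ (-n) : X ≃ₜ X) x))).Finite :=
      (coef_finite a _).subset fun k hk => left_ne_zero_of_mul hk
    rw [show star (∑ᶠ k : ℤ, coef a k ((T ^ (-n) : X ≃ₜ X) x) *
        coef b (-n - k) ((T ^ (-k) : X ≃ₜ X) ((T ^ (-n) : X ≃ₜ X) x))) =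
        ∑ᶠ k : ℤ, star (coef a k ((T ^ (-n) : X ≃ₜ X) x) *
        coef b (-n - k) ((T ^ (-k) : X ≃ₜ X) ((T ^ (-n) : X ≃ₜ X) x))) from
      (starAddEquiv : K ≃+ K).toAddMonoidHom.map_finsum hfin]
    refine finsum_eq_of_bijective (fun k => n + k)
      (Equiv.addLeft n).bijective fun k => ?_
    rw [star_mul, coef_star, coef_star]
    simp only [← Homeomorph.mul_apply, ← zpow_add]
    congr 4 <;> ring_nf

instance : StarModule K (CrossedProduct T K) where
  star_smul c a := ext_coef fun n x => by
    rw [coef_star, coef_smul, coef_smul, coef_star, star_mul']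

end CrossedProduct

/-! ### Pairs `(E, 𝒫)` and their towers -/

section Approximation

variable {X : Type*} [TopologicalSpace X]

/-- A pair `(E, 𝒫)`: a non-empty clopen set `E` and a finite partition `𝒫` of `X \ E` into
(non-empty) clopen sets. The last two conditions say that `𝒫` is a partition of `X \ E`. -/
structure ClopenPair (X : Type*) [TopologicalSpace X] where
  E : Set X
  P : Set (Set X)
  isClopen_E : IsClopen E
  isClopen_P : ∀ Z ∈ P, IsClopen Z
  finite_P : P.Finite
  notMem_P : E ∉ P
  isPartition : Setoid.IsPartition (insert E P)

namespace ClopenPair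

theorem nonempty_E (C : ClopenPair X) : C.E.Nonempty :=
  Setoid.nonempty_of_mem_partition C.isPartition (Set.mem_insert _ _)

theorem eq_of_mem (C : ClopenPair X) {Z Z' : Set X} (hZ : Z ∈ insert C.E C.P)
    (hZ' : Z' ∈ insert C.E C.P) {x : X} (hx : x ∈ Z) (hx' : x ∈ Z') : Z = Z' :=
  (C.isPartition.2 x).unique ⟨hZ, hx⟩ ⟨hZ', hx'⟩

theorem notMem_E (C : ClopenPair X) {Z : Set X} (hZ : Z ∈ C.P) {x : X} (hx : x ∈ Z) : x ∉ C.E :=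
  fun h => C.notMem_P
    (C.eq_of_mem (Set.mem_insert _ _) (Set.mem_insert_of_mem _ hZ) h hx ▸ hZ)

theorem exists_mem (C : ClopenPair X) {x : X} (hx : x ∉ C.E) : ∃ Z ∈ C.P, x ∈ Z := by
  obtain ⟨Z, ⟨hZ, hxZ⟩, -⟩ := C.isPartition.2 x
  rcases hZ with rfl | hZ
  · exact absurd hxZ hx
  · exact ⟨Z, hZ, hxZ⟩

end ClopenPair

/-- The sets of the family `𝒱` attached to `(E, 𝒫)`: the non-empty sets
`W = E ∩ T⁻¹(Z₁) ∩ ⋯ ∩ T⁻ᵏ⁺¹(Z_{k-1}) ∩ T⁻ᵏ(E)` with `k ≥ 1` and `Zᵢ ∈ 𝒫`. Here `base` is `W` and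
`len` is the length `|W| = k`; since `W` is non-empty, the length is determined by `W`
(see `Tower.ext_base`). -/
structure Tower (T : X ≃ₜ X) (C : ClopenPair X) where
  base : Set X
  len : ℕ
  nonempty : base.Nonempty
  one_le_len : 1 ≤ len
  exists_eq : ∃ Z : ℕ → Set X, (∀ i, 1 ≤ i → i < len → Z i ∈ C.P) ∧
    base = {x | x ∈ C.E ∧ (∀ i : ℕ, 1 ≤ i → i < len → (T ^ (i : ℤ) : X ≃ₜ X) x ∈ Z i) ∧
      (T ^ (len : ℤ) : X ≃ₜ X) x ∈ C.E}

variable {T : X ≃ₜ X} {C C' : ClopenPair X}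

namespace Tower

theorem mem_E (W : Tower T C) {x : X} (hx : x ∈ W.base) : x ∈ C.E := by
  obtain ⟨Z, -, h⟩ := W.exists_eq
  rw [h] at hx
  exact hx.1

theorem zpow_len_mem_E (W : Tower T C) {x : X} (hx : x ∈ W.base) :
    (T ^ (W.len : ℤ) : X ≃ₜ X) x ∈ C.E := by
  obtain ⟨Z, -, h⟩ := W.exists_eq
  rw [h] at hx
  exact hx.2.2

theorem zpow_notMem_E (W : Tower T C) {x : X} (hx : x ∈ W.base) {i : ℤ} (h1 : 1 ≤ i)
    (h2 : i < W.len) : (T ^ i : X ≃ₜ X) x ∉ C.E := by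
  obtain ⟨Z, hZ, h⟩ := W.exists_eq
  rw [h] at hx
  obtain ⟨i, rfl⟩ := Int.eq_ofNat_of_zero_le (by omega : 0 ≤ i)
  exact C.notMem_E (hZ i (by omega) (by omega)) (hx.2.1 i (by omega) (by omega))

/-- The points of a tower have the same itinerary. -/
theorem mem_iff (W : Tower T C) {x x' : X} (hx : x ∈ W.base) (hx' : x' ∈ W.base) {i : ℤ}
    (h0 : 0 ≤ i) (h2 : i < W.len) {Z : Set X} (hZ : Z ∈ C.P) :
    (T ^ i : X ≃ₜ X) x ∈ Z ↔ (T ^ i : X ≃ₜ X) x' ∈ Z := by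
  rcases h0.eq_or_lt with rfl | h1
  · rw [zpow_zero, Homeomorph.one_apply, Homeomorph.one_apply]
    exact ⟨fun h => absurd (W.mem_E hx) (C.notMem_E hZ h),
      fun h => absurd (W.mem_E hx') (C.notMem_E hZ h)⟩
  obtain ⟨Y, hY, h⟩ := W.exists_eq
  rw [h] at hx hx'
  obtain ⟨i, rfl⟩ := Int.eq_ofNat_of_zero_le h0
  have a := hx.2.1 i (by omega) (by omega)
  have a' := hx'.2.1 i (by omega) (by omega)
  have hYi := Set.mem_insert_of_mem C.E (hY i (by omega) (by omega))
  have hZ' := Set.mem_insert_of_mem C.E hZ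
  exact ⟨fun hh => C.eq_of_mem hYi hZ' a hh ▸ a', fun hh => C.eq_of_mem hYi hZ' a' hh ▸ a⟩

theorem base_mono_aux (W V : Tower T C) {x : X} (hW : x ∈ W.base) (hV : x ∈ V.base)
    (hlen : W.len = V.len) : W.base ⊆ V.base := by
  intro z hz
  obtain ⟨Y, hY, h⟩ := V.exists_eq
  have hV' := hV
  rw [h] at hV' ⊢
  refine ⟨W.mem_E hz, fun i h1 h2 => ?_, hlen ▸ W.zpow_len_mem_E hz⟩
  exact (W.mem_iff hW hz (by omega) (by omega) (hY i h1 h2)).1 (hV'.2.1 i h1 h2)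

/-- Two towers with a common base point coincide. -/
theorem eq_of_mem (W V : Tower T C) {x : X} (hW : x ∈ W.base) (hV : x ∈ V.base) : W = V := by
  have hlen : W.len = V.len := by
    rcases lt_trichotomy W.len V.len with h | h | h
    · exact absurd (W.zpow_len_mem_E hW)
        (V.zpow_notMem_E hV (by have := W.one_le_len; omega) (by omega))
    · exact h
    · exact absurd (V.zpow_len_mem_E hV)
        (W.zpow_notMem_E hW (by have := V.one_le_len; omega) (by omega))
  have hbase : W.base = V.base :=
    (W.base_mono_aux V hW hV hlen).antisymm (V.base_mono_aux W hV hW hlen.symm)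
  cases W; cases V
  simp only at hlen hbase
  subst hlen hbase
  rfl

theorem ext_base {W V : Tower T C} (h : W.base = V.base) : W = V := by
  obtain ⟨x, hx⟩ := W.nonempty
  exact W.eq_of_mem V hx (h ▸ hx)

/-- The levels of the towers are pairwise disjoint. -/
theorem eq_of_level (W V : Tower T C) {x y : X} (hx : x ∈ W.base) (hy : y ∈ V.base) {i j : ℤ}
    (hi0 : 0 ≤ i) (hi : i < W.len) (hj0 : 0 ≤ j) (hj : j < V.len)
    (h : (T ^ i : X ≃ₜ X) x = (T ^ j : X ≃ₜ X) y) : i = j ∧ x = y ∧ W = V := by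
  have aux : ∀ {W V : Tower T C} {x y : X} (_ : x ∈ W.base) (_ : y ∈ V.base) {i j : ℤ}
      (_ : 0 ≤ i) (_ : i < W.len) (_ : 0 ≤ j) (_ : j < V.len)
      (_ : (T ^ i : X ≃ₜ X) x = (T ^ j : X ≃ₜ X) y), ¬ i < j := by
    intro W V x y hx hy i j hi0 hi hj0 hj h hij
    have : x = (T ^ (j - i) : X ≃ₜ X) y := by
      have := congrArg (T ^ (-i) : X ≃ₜ X) h
      simp only [← Homeomorph.mul_apply, ← zpow_add] at this
      simpa [sub_eq_neg_add] using this
    exact V.zpow_notMem_E hy (i := j - i) (by omega) (by omega) (this ▸ W.mem_E hx)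
  have hij : i = j := le_antisymm (not_lt.1 (aux hy hx hj0 hj hi0 hi h.symm))
    (not_lt.1 (aux hx hy hi0 hi hj0 hj h))
  subst hij
  have hxy : x = y := (T ^ i : X ≃ₜ X).injective h
  subst hxy
  exact ⟨rfl, rfl, W.eq_of_mem V hx hy⟩

/-- A point of `E` that returns to `E` lies in the base of a tower. -/
theorem exists_of_return {x : X} (hx : x ∈ C.E) {k : ℕ} (hk : 1 ≤ k)
    (hxk : (T ^ (k : ℤ) : X ≃ₜ X) x ∈ C.E) : ∃ W : Tower T C, x ∈ W.base ∧ W.len ≤ k := by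
  classical
  have hex : ∃ k : ℕ, 1 ≤ k ∧ (T ^ (k : ℤ) : X ≃ₜ X) x ∈ C.E := ⟨k, hk, hxk⟩
  have hmin : ∀ i : ℕ, 1 ≤ i → i < Nat.find hex → (T ^ (i : ℤ) : X ≃ₜ X) x ∉ C.E :=
    fun i h1 h2 h => Nat.find_min hex h2 ⟨h1, h⟩
  have hZ : ∀ i : ℕ, ∃ Z : Set X, 1 ≤ i → i < Nat.find hex →
      Z ∈ C.P ∧ (T ^ (i : ℤ) : X ≃ₜ X) x ∈ Z := by
    intro i
    by_cases h : 1 ≤ i ∧ i < Nat.find hex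
    · obtain ⟨Z, hZ⟩ := C.exists_mem (hmin i h.1 h.2)
      exact ⟨Z, fun _ _ => hZ⟩
    · exact ⟨∅, fun h1 h2 => absurd ⟨h1, h2⟩ h⟩
  choose Z hZ using hZ
  have hxmem : x ∈ {x | x ∈ C.E ∧
      (∀ i : ℕ, 1 ≤ i → i < Nat.find hex → (T ^ (i : ℤ) : X ≃ₜ X) x ∈ Z i) ∧
      (T ^ (Nat.find hex : ℤ) : X ≃ₜ X) x ∈ C.E} :=
    ⟨hx, fun i h1 h2 => (hZ i h1 h2).2, (Nat.find_spec hex).2⟩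
  exact ⟨⟨_, Nat.find hex, ⟨x, hxmem⟩, (Nat.find_spec hex).1, Z,
    fun i h1 h2 => (hZ i h1 h2).1, rfl⟩, hxmem, Nat.find_min' hex ⟨hk, hxk⟩⟩

end Tower

variable {K : Type*} [Field K]

variable (T C K) in
/-- The `*`-algebra `𝔑 = ∏_{W ∈ 𝒱} M_{|W|}(K)` attached to `(E, 𝒫)`, with the conjugate transpose
as involution in each factor. -/
abbrev MatrixProd := ∀ W : Tower T C, Matrix (Fin W.len) (Fin W.len) K

/-- The `(i,j)` entry of `a = ∑ fₙ tⁿ` along the orbit of `w`: the value of `f_{i-j}` at `Tⁱ(w)`. -/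
def entry (w : X) (i j : ℤ) (a : CrossedProduct T K) : K := coef a (i - j) ((T ^ i : X ≃ₜ X) w)

theorem entry_mul (w : X) (i j : ℤ) (a b : CrossedProduct T K) :
    entry w i j (a * b) = ∑ᶠ k : ℤ, entry w i k a * entry w k j b := by
  unfold entry
  rw [coef_mul]
  refine finsum_eq_of_bijective (fun k => i - k) (Equiv.subLeft i).bijective fun k => ?_
  rw [← Homeomorph.mul_apply, ← zpow_add]
  rw [show i - (i - k) = k by ring, show i - k - j = i - j - k by ring,
    show i - k = -k + i by ring]

theorem entry_algebraMap (w : X) (i j : ℤ) (c : K) :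
    entry w i j (algebraMap K (CrossedProduct T K) c) = if i = j then c else 0 := by
  unfold entry
  rw [coef_algebraMap]
  simp only [sub_eq_zero]

/-- The `[0, L) × [0, L)` matrix of entries of `a` along the orbit of `w`. -/
def block (w : X) (L : ℕ) (a : CrossedProduct T K) : Matrix (Fin L) (Fin L) K :=
  Matrix.of fun i j => entry w i j a

theorem block_algebraMap (w : X) (L : ℕ) (c : K) :
    block w L (algebraMap K (CrossedProduct T K) c) = algebraMap K _ c := by
  ext i j
  simp only [block, Matrix.of_apply, entry_algebraMap, Matrix.algebraMap_matrix_apply,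
    Algebra.algebraMap_self, RingHom.id_apply, Fin.ext_iff, Nat.cast_inj]

theorem block_add (w : X) (L : ℕ) (a b : CrossedProduct T K) :
    block w L (a + b) = block w L a + block w L b := by
  ext i j
  exact coef_add _ _ _ _

open Classical in
theorem entry_gen (Z : Set X) (hZ : IsClopen Z) (w : X) (i j : ℤ) :
    entry w i j (monom (chi T K Z hZ) 1) =
      if 1 = i - j ∧ (T ^ i : X ≃ₜ X) w ∈ Z then 1 else 0 := by
  unfold entry
  rw [coef_monom, chi_apply]
  by_cases h : 1 = i - j <;> simp [h]

variable [StarRing K]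

variable (T C K) in
/-- The `*`-algebra `𝒜(E, 𝒫)`: the unital `*`-subalgebra of `C_K(X) ⋊_T ℤ` generated by the partial
isometries `χ_Z t`, where `Z ∈ 𝒫`. -/
def approxAlgebra : StarSubalgebra K (CrossedProduct T K) :=
  StarAlgebra.adjoin K
    {a | ∃ (Z : Set X) (hZ : Z ∈ C.P), a = monom (chi T K Z (C.isClopen_P Z hZ)) 1}

theorem entry_star (w : X) (i j : ℤ) (a : CrossedProduct T K) :
    entry w i j (star a) = star (entry w j i a) := by
  unfold entry
  rw [coef_star, ← Homeomorph.mul_apply, ← zpow_add]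
  rw [show -(i - j) = j - i by ring, show j - i + i = j by ring]

/-- The elements whose entries along the orbit of `w` are block diagonal with respect to
`[0, L)` and its complement. -/
def blockAlgebra (T : X ≃ₜ X) (K : Type*) [Field K] [StarRing K] (w : X) (L : ℤ) :
    StarSubalgebra K (CrossedProduct T K) where
  carrier := {a | ∀ i j : ℤ, ¬ ((0 ≤ i ∧ i < L) ↔ (0 ≤ j ∧ j < L)) → entry w i j a = 0}
  mul_mem' {a b} ha hb i j hij := by
    rw [entry_mul]
    refine finsum_eq_zero_of_forall_eq_zero fun k => ?_
    by_cases h : (0 ≤ i ∧ i < L) ↔ (0 ≤ k ∧ k < L)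
    · rw [hb k j (by rwa [← h]), mul_zero]
    · rw [ha i k h, zero_mul]
  add_mem' {a b} ha hb i j hij := by
    have h1 := ha i j hij
    have h2 := hb i j hij
    unfold entry at *
    rw [coef_add, h1, h2, add_zero]
  algebraMap_mem' c i j hij := by
    rw [entry_algebraMap, if_neg]
    rintro rfl
    exact hij Iff.rfl
  star_mem' {a} ha i j hij := by
    rw [entry_star, ha j i (fun h => hij h.symm), star_zero]

theorem block_mul {w : X} {L : ℕ} {a b : CrossedProduct T K} (ha : a ∈ blockAlgebra T K w L) :
    block w L (a * b) = block w L a * block w L b := by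
  ext i j
  rw [Matrix.mul_apply]
  simp only [block, Matrix.of_apply]
  rw [entry_mul]
  have hinj : Function.Injective fun k : Fin L => ((k : ℕ) : ℤ) := fun k l h => by
    apply Fin.ext; simpa using h
  rw [finsum_eq_sum_of_support_subset (s := Finset.univ.map ⟨_, hinj⟩), Finset.sum_map]
  · rfl
  · intro k hk
    simp only [Finset.coe_map, Finset.coe_univ, Set.image_univ, Set.mem_range,
      Function.Embedding.coeFn_mk]
    by_cases h : 0 ≤ k ∧ k < L
    · exact ⟨⟨k.toNat, by omega⟩, by simp [h.1]⟩
    · refine absurd ?_ (left_ne_zero_of_mul hk)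
      exact ha _ _ (fun h' => h (h'.1 ⟨by omega, by have := i.2; omega⟩))

theorem block_star (w : X) (L : ℕ) (a : CrossedProduct T K) :
    block w L (star a) = star (block w L a) := by
  ext i j
  exact entry_star _ _ _ _

theorem approxAlgebra_le_blockAlgebra (W : Tower T C) {w : X} (hw : w ∈ W.base) :
    approxAlgebra T C K ≤ blockAlgebra T K w W.len := by
  refine StarAlgebra.adjoin_le ?_
  rintro _ ⟨Z, hZ, rfl⟩ i j hij
  rw [entry_gen, if_neg]
  rintro ⟨h1, h2⟩
  have hE := C.notMem_E hZ h2
  by_cases h : 0 ≤ i ∧ i < W.len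
  · have : i = 0 := by
      by_contra h0
      exact hij ⟨fun _ => by omega, fun _ => h⟩
    subst this
    exact hE (W.mem_E hw)
  · have : i = W.len := by
      by_contra h0
      exact hij ⟨fun h' => absurd h' h, fun _ => by omega⟩
    subst this
    exact hE (W.zpow_len_mem_E hw)

/-- For `a ∈ 𝒜(E, 𝒫)` the coefficients of `a` are constant on the levels of a tower. -/
theorem block_eq_block (W : Tower T C) {w w' : X} (hw : w ∈ W.base) (hw' : w' ∈ W.base)
    {a : CrossedProduct T K} (ha : a ∈ approxAlgebra T C K) :
    block w W.len a = block w' W.len a := by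
  have hle : ∀ {b}, b ∈ approxAlgebra T C K → b ∈ blockAlgebra T K w W.len :=
    fun h => approxAlgebra_le_blockAlgebra W hw h
  have hle' : ∀ {b}, b ∈ approxAlgebra T C K → b ∈ blockAlgebra T K w' W.len :=
    fun h => approxAlgebra_le_blockAlgebra W hw' h
  induction ha using StarAlgebra.adjoin_induction with
  | mem x hx =>
    obtain ⟨Z, hZ, rfl⟩ := hx
    ext i j
    simp only [block, Matrix.of_apply, entry_gen]
    rw [W.mem_iff hw hw' (by omega) (by have := i.2; omega) hZ]
  | algebraMap c => rw [block_algebraMap, block_algebraMap]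
  | add a b _ _ ha hb => rw [block_add, block_add, ha, hb]
  | mul a b h1 h2 ha hb => rw [block_mul (hle h1), block_mul (hle' h1), ha, hb]
  | star a _ ha => rw [block_star, block_star, ha]

variable (T C K) in
/-- The representation `π : 𝒜(E, 𝒫) → 𝔑`, `π(a) = (h_W a)_W`, where `h_W 𝒜(E, 𝒫)` is identified with
`M_{|W|}(K)` by means of the matrix units `e_{ij}(W) = χ_{Tⁱ(W)} t^{i-j}`. In coordinates: if
`a = ∑ fₙ tⁿ`, then the `(i,j)` entry of `π(a)_W` is the constant value of `f_{i-j}` on the level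
`Tⁱ(W)` (see `towerUnit_mul_eq`). -/
def towerRep : approxAlgebra T C K →⋆ₐ[K] MatrixProd T C K where
  toFun a W := block W.nonempty.some W.len (a : CrossedProduct T K)
  map_one' := by
    funext W
    have := block_algebraMap (T := T) W.nonempty.some W.len (1 : K)
    rwa [map_one, map_one] at this
  map_mul' a b := by
    funext W
    exact block_mul (approxAlgebra_le_blockAlgebra W W.nonempty.some_mem a.2)
  map_zero' := by
    funext W
    have := block_algebraMap (T := T) W.nonempty.some W.len (0 : K)
    rwa [map_zero, map_zero] at this
  map_add' a b := by
    funext W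
    exact block_add _ _ _ _
  commutes' c := by
    funext W
    exact block_algebraMap _ _ _
  map_star' a := by
    funext W
    exact block_star _ _ _

theorem towerRep_apply (a : approxAlgebra T C K) (W : Tower T C) {w : X} (hw : w ∈ W.base)
    (i j : Fin W.len) : towerRep T C K a W i j = entry w i j (a : CrossedProduct T K) := by
  change block W.nonempty.some W.len (a : CrossedProduct T K) i j =
    block w W.len (a : CrossedProduct T K) i j
  rw [block_eq_block W W.nonempty.some_mem hw a.2]

theorem Tower.isClopen_base (W : Tower T C) : IsClopen W.base := by
  obtain ⟨Z, hZ, h⟩ := W.exists_eq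
  have : W.base = C.E ∩ ((⋂ i ∈ Finset.Ico 1 W.len, (T ^ (i : ℤ) : X ≃ₜ X) ⁻¹' Z i) ∩
      (T ^ (W.len : ℤ) : X ≃ₜ X) ⁻¹' C.E) := by
    conv_lhs => rw [h]
    ext x
    simp only [Set.mem_ofPred_eq, Set.mem_inter_iff, Set.mem_iInter, Set.mem_preimage,
      Finset.mem_Ico, and_imp]
  rw [this]
  refine C.isClopen_E.inter (IsClopen.inter ?_ (C.isClopen_E.preimage (Homeomorph.continuous _)))
  refine isClopen_biInter_finset fun i hi => ?_
  rw [Finset.mem_Ico] at hi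
  exact (C.isClopen_P _ (hZ i hi.1 hi.2)).preimage (Homeomorph.continuous _)

variable (K) in
/-- The matrix unit `e_{ij}(W) = (χ_{X∖E} t)^i χ_W (t⁻¹ χ_{X∖E})^j = χ_{Tⁱ(W)} t^{i-j}`. -/
def towerUnit (W : Tower T C) (i j : Fin W.len) : CrossedProduct T K :=
  monom (chi T K ((T ^ (-((i : ℕ) : ℤ)) : X ≃ₜ X) ⁻¹' W.base)
    (W.isClopen_base.preimage (Homeomorph.continuous _))) ((i : ℤ) - (j : ℤ))

/-- `h_W a = ∑_{ij} π(a)_{W,ij} e_{ij}(W)`, where `h_W = ∑ᵢ e_{ii}(W)`. -/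
theorem towerUnit_mul_eq (a : approxAlgebra T C K) (W : Tower T C) :
    (∑ i, towerUnit K W i i) * (a : CrossedProduct T K) =
      ∑ i, ∑ j, towerRep T C K a W i j • towerUnit K W i j := by
  classical
  have hsum : ∀ {ι : Type} (s : Finset ι) (F : ι → CrossedProduct T K) (n : ℤ) (x : X),
      coef (∑ i ∈ s, F i) n x = ∑ i ∈ s, coef (F i) n x := by
    intro ι s F n x
    induction s using Finset.cons_induction with
    | empty => rfl
    | cons i s hi ih => rw [Finset.sum_cons, Finset.sum_cons, coef_add, ih]
  have hunit : ∀ (i j : Fin W.len) (n : ℤ) (x : X), coef (towerUnit K W i j) n x =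
      if (i : ℤ) - j = n ∧ (T ^ (-((i : ℕ) : ℤ)) : X ≃ₜ X) x ∈ W.base then 1 else 0 := by
    intro i j n x
    unfold towerUnit
    rw [coef_monom, chi_apply]
    by_cases h : (i : ℤ) - j = n <;> simp [h]
  rw [Finset.sum_mul]
  refine ext_coef fun n x => ?_
  rw [hsum, hsum]
  refine Finset.sum_congr rfl fun i _ => ?_
  rw [hsum]
  have hl : coef (towerUnit K W i i * (a : CrossedProduct T K)) n x =
      if (T ^ (-((i : ℕ) : ℤ)) : X ≃ₜ X) x ∈ W.base then coef (a : CrossedProduct T K) n x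
      else 0 := by
    rw [coef_mul, finsum_eq_single _ 0]
    · rw [hunit]; simp
    · intro k hk
      rw [hunit, if_neg (fun h => hk (by simpa using h.1.symm)), zero_mul]
  rw [hl]
  simp only [coef_smul, hunit]
  by_cases hx : (T ^ (-((i : ℕ) : ℤ)) : X ≃ₜ X) x ∈ W.base
  · rw [if_pos hx]
    have hxx : (T ^ ((i : ℕ) : ℤ) : X ≃ₜ X) ((T ^ (-((i : ℕ) : ℤ)) : X ≃ₜ X) x) = x := by
      rw [← Homeomorph.mul_apply, ← zpow_add]; simp
    by_cases hj : 0 ≤ (i : ℤ) - n ∧ (i : ℤ) - n < W.len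
    · rw [Finset.sum_eq_single (⟨((i : ℤ) - n).toNat, by omega⟩ : Fin W.len)]
      · rw [if_pos ⟨by simp only; omega, hx⟩, mul_one, towerRep_apply a W hx]
        unfold entry
        rw [hxx]
        congr 1
        simp only
        omega
      · intro j _ hne
        rw [if_neg, mul_zero]
        rintro ⟨h, -⟩
        exact hne (Fin.ext (by simp only; omega))
      · simp
    · have h0 := approxAlgebra_le_blockAlgebra W hx a.2 i (i - n)
        (fun h' => hj (h'.1 ⟨by omega, by have := i.2; omega⟩))
      unfold entry at h0
      rw [hxx, sub_sub_cancel] at h0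
      rw [h0, Finset.sum_eq_zero]
      intro j _
      rw [if_neg, mul_zero]
      rintro ⟨h, -⟩
      have := j.2
      omega
  · rw [if_neg hx, Finset.sum_eq_zero]
    intro j _
    rw [if_neg (fun h => hx h.2), mul_zero]

/-! ### The embeddings `𝔑(E, 𝒫) → 𝔑(E', 𝒫')` for a refinement `(E', 𝒫')` of `(E, 𝒫)` -/

/-- `E' ⊆ E` and the partition `𝒫' ∪ {E'}` of `X` is finer than `𝒫 ∪ {E}`. -/
structure ClopenPair.Refines (C' C : ClopenPair X) : Prop where
  subset_E : C'.E ⊆ C.E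
  refines : ∀ Z' ∈ insert C'.E C'.P, ∃ Z ∈ insert C.E C.P, Z' ⊆ Z

variable (C) in
/-- The blocks of a tower `W'` for the finer pair: the pairs `(s, W)` with `s < |W'|`, `W ∈ 𝒱` and
`Tˢ(W') ⊆ W`. The levels `W', T(W'), …, T^{|W'|-1}(W')` are the disjoint union of the strings
`Tˢ(W'), …, T^{s+|W|-1}(W')` where `(s, W)` runs through the blocks. -/
def Block (W' : Tower T C') : Type _ :=
  {b : Fin W'.len × Tower T C // ∀ x ∈ W'.base, (T ^ ((b.1 : ℕ) : ℤ) : X ≃ₜ X) x ∈ b.2.base}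

namespace Block

/-- The starting point `s` of the block `(s, W)`. -/
def start {W' : Tower T C'} (b : Block C W') : ℕ := b.1.1

/-- The tower `W` of the block `(s, W)`. -/
def tower {W' : Tower T C'} (b : Block C W') : Tower T C := b.1.2

theorem mem_base {W' : Tower T C'} (b : Block C W') {x : X} (hx : x ∈ W'.base) :
    (T ^ (b.start : ℤ) : X ≃ₜ X) x ∈ b.tower.base := b.2 x hx

theorem ext_start {W' : Tower T C'} {b c : Block C W'} (h : b.start = c.start) : b = c := by
  obtain ⟨x, hx⟩ := W'.nonempty
  have h2 : b.tower = c.tower := b.tower.eq_of_mem c.tower (b.mem_base hx) (h ▸ c.mem_base hx)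
  exact Subtype.ext (Prod.ext (Fin.ext h) h2)

instance {W' : Tower T C'} : Finite (Block C W') :=
  Finite.of_injective (fun b : Block C W' => b.1.1) fun _ _ h =>
    ext_start (congrArg (fun i : Fin W'.len => (i : ℕ)) h)

instance {W' : Tower T C'} : Fintype (Block C W') := Fintype.ofFinite _

instance {W' : Tower T C'} : DecidableEq (Block C W') := Classical.decEq _

end Block

theorem zpow_zpow_apply (T : X ≃ₜ X) (a b : ℤ) (x : X) :
    (T ^ a : X ≃ₜ X) ((T ^ b : X ≃ₜ X) x) = (T ^ (a + b) : X ≃ₜ X) x := by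
  rw [← Homeomorph.mul_apply, ← zpow_add]

theorem Tower.mem_iff_of_refines (hC : C'.Refines C) (W' : Tower T C') {x x' : X}
    (hx : x ∈ W'.base) (hx' : x' ∈ W'.base) {i : ℤ} (h0 : 0 ≤ i) (h2 : i ≤ W'.len) {Z : Set X}
    (hZ : Z ∈ insert C.E C.P) : (T ^ i : X ≃ₜ X) x ∈ Z ↔ (T ^ i : X ≃ₜ X) x' ∈ Z := by
  suffices h : ∃ Z' ∈ insert C'.E C'.P, (T ^ i : X ≃ₜ X) x ∈ Z' ∧ (T ^ i : X ≃ₜ X) x' ∈ Z' by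
    obtain ⟨Z', hZ', h1, h2⟩ := h
    obtain ⟨Y, hY, hsub⟩ := hC.refines Z' hZ'
    exact ⟨fun h => C.eq_of_mem hY hZ (hsub h1) h ▸ hsub h2,
      fun h => C.eq_of_mem hY hZ (hsub h2) h ▸ hsub h1⟩
  rcases h0.eq_or_lt with rfl | h1
  · exact ⟨C'.E, Set.mem_insert _ _, by simpa using W'.mem_E hx, by simpa using W'.mem_E hx'⟩
  rcases h2.eq_or_lt with rfl | h2
  · exact ⟨C'.E, Set.mem_insert _ _, W'.zpow_len_mem_E hx, W'.zpow_len_mem_E hx'⟩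
  obtain ⟨Z', hZ', h⟩ := C'.exists_mem (W'.zpow_notMem_E hx (by omega) h2)
  exact ⟨Z', Set.mem_insert_of_mem _ hZ', h, (W'.mem_iff hx hx' h0 h2 hZ').1 h⟩

theorem Block.add_lt (hC : C'.Refines C) {W' : Tower T C'} (b : Block C W')
    (p : Fin b.tower.len) : b.start + p < W'.len := by
  obtain ⟨x, hx⟩ := W'.nonempty
  have hs : b.start < W'.len := b.1.1.2
  by_contra hcon
  have h := hC.subset_E (W'.zpow_len_mem_E hx)
  have hp := p.2
  refine b.tower.zpow_notMem_E (b.mem_base hx) (i := (W'.len : ℤ) - b.start) (by omega)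
    (by omega) ?_
  rw [zpow_zpow_apply]
  simpa using h

theorem Block.exists_eq (hC : C'.Refines C) {W' : Tower T C'} (a : Fin W'.len) :
    ∃ (b : Block C W') (p : Fin b.tower.len), b.start + (p : ℕ) = a := by
  classical
  obtain ⟨x, hx⟩ := W'.nonempty
  have ha := a.2
  -- the last visit of the orbit to `E` before time `a`
  have hex : ∃ p : ℕ, p ≤ a ∧ (T ^ (((a : ℕ) : ℤ) - p) : X ≃ₜ X) x ∈ C.E :=
    ⟨a, le_rfl, by simpa using hC.subset_E (W'.mem_E hx)⟩
  obtain ⟨hpa, hpE⟩ := Nat.find_spec hex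
  have hmin : ∀ q < Nat.find hex, (T ^ (((a : ℕ) : ℤ) - q) : X ≃ₜ X) x ∉ C.E :=
    fun q hq h => Nat.find_min hex hq ⟨by omega, h⟩
  generalize Nat.find hex = p at *
  have hret : (T ^ ((W'.len - (a - p) : ℕ) : ℤ) : X ≃ₜ X)
      ((T ^ (((a : ℕ) : ℤ) - p) : X ≃ₜ X) x) ∈ C.E := by
    rw [zpow_zpow_apply, show ((W'.len - (a - p) : ℕ) : ℤ) + (((a : ℕ) : ℤ) - p) = W'.len by omega]
    exact hC.subset_E (W'.zpow_len_mem_E hx)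
  obtain ⟨W, hW, hlen⟩ := Tower.exists_of_return hpE (by omega) hret
  have hpW : p < W.len := by
    by_contra hcon
    have h := W.zpow_len_mem_E hW
    rw [zpow_zpow_apply] at h
    have h1 := W.one_le_len
    refine hmin (p - W.len) (by omega) ?_
    rwa [show ((a : ℕ) : ℤ) - ((p - W.len : ℕ) : ℤ) = (W.len : ℤ) + (((a : ℕ) : ℤ) - p) by omega]
  refine ⟨⟨(⟨a - p, by omega⟩, W), ?_⟩, ⟨p, hpW⟩, ?_⟩
  · intro z hz
    simp only
    obtain ⟨Y, hY, h⟩ := W.exists_eq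
    have hW' := hW
    rw [h] at hW' ⊢
    rw [show ((a - p : ℕ) : ℤ) = ((a : ℕ) : ℤ) - p by omega]
    refine ⟨(W'.mem_iff_of_refines hC hx hz (by omega) (by omega) (Set.mem_insert _ _)).1 hW'.1,
      fun i h1 h2 => ?_, ?_⟩
    · have := hW'.2.1 i h1 h2
      rw [zpow_zpow_apply] at this ⊢
      exact (W'.mem_iff_of_refines hC hx hz (by omega) (by omega)
        (Set.mem_insert_of_mem _ (hY i h1 h2))).1 this
    · have := hW'.2.2
      rw [zpow_zpow_apply] at this ⊢
      exact (W'.mem_iff_of_refines hC hx hz (by omega) (by omega) (Set.mem_insert _ _)).1 this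
  · change a - p + p = (a : ℕ)
    omega

/-- The bijection `((s, W), p) ↦ s + p` between the disjoint union of the index sets of the blocks
of `W'` and the index set of `W'`. -/
def blockEquiv (hC : C'.Refines C) (W' : Tower T C') :
    (Σ b : Block C W', Fin b.tower.len) ≃ Fin W'.len :=
  Equiv.ofBijective (fun q => ⟨q.1.start + q.2, q.1.add_lt hC q.2⟩) <| by
    constructor
    · rintro ⟨b, p⟩ ⟨c, q⟩ h
      obtain ⟨x, hx⟩ := W'.nonempty
      have h' : b.start + (p : ℕ) = c.start + q := congrArg (fun i : Fin W'.len => (i : ℕ)) h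
      have hp := p.2
      have hq := q.2
      have := b.tower.eq_of_level c.tower (b.mem_base hx) (c.mem_base hx) (i := p) (j := q)
        (by omega) (by omega) (by omega) (by omega) (by
          rw [zpow_zpow_apply, zpow_zpow_apply]
          congr 2
          omega)
      obtain rfl : b = c := Block.ext_start (by omega)
      obtain rfl : p = q := Fin.ext (by omega)
      rfl
    · intro a
      obtain ⟨b, p, h⟩ := Block.exists_eq hC a
      exact ⟨⟨b, p⟩, Fin.ext h⟩

variable (K) in
/-- The embedding `𝔑(E, 𝒫) → 𝔑(E', 𝒫')`: the `W'`-component of the image of `M` is the block diagonal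
matrix with the blocks `M_W`, one for each block `(s, W)` of `W'`, placed at the positions
`s, …, s + |W| - 1`. -/
def refineMap (hC : C'.Refines C) : MatrixProd T C K →⋆ₐ[K] MatrixProd T C' K where
  toFun M W' := Matrix.reindexAlgEquiv K K (blockEquiv hC W')
    (Matrix.blockDiagonal' fun b : Block C W' => M b.tower)
  map_one' := by
    funext W'
    exact (congrArg (Matrix.reindexAlgEquiv K K (blockEquiv hC W')) Matrix.blockDiagonal'_one).trans (map_one _)
  map_mul' M N := by
    funext W'
    exact (congrArg (Matrix.reindexAlgEquiv K K (blockEquiv hC W')) (Matrix.blockDiagonal'_mul _ _)).trans (map_mul _ _ _)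
  map_zero' := by
    funext W'
    exact (congrArg (Matrix.reindexAlgEquiv K K (blockEquiv hC W')) Matrix.blockDiagonal'_zero).trans (map_zero _)
  map_add' M N := by
    funext W'
    exact (congrArg (Matrix.reindexAlgEquiv K K (blockEquiv hC W')) (Matrix.blockDiagonal'_add _ _)).trans (map_add _ _ _)
  commutes' c := by
    funext W'
    have h : (Matrix.blockDiagonal' fun b : Block C W' =>
        (algebraMap K (MatrixProd T C K) c) b.tower) =
        c • (1 : Matrix (Σ b : Block C W', Fin b.tower.len) _ K) := by
      rw [← Matrix.blockDiagonal'_one, ← Matrix.blockDiagonal'_smul]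
      congr 1
      funext b
      rw [Pi.algebraMap_apply, Algebra.algebraMap_eq_smul_one]
      rfl
    rw [Pi.algebraMap_apply, h, map_smul, map_one, Algebra.algebraMap_eq_smul_one]
  map_star' M := by
    funext W'
    have h := Matrix.blockDiagonal'_conjTranspose fun b : Block C W' => M b.tower
    exact (congrArg (Matrix.reindexAlgEquiv K K (blockEquiv hC W')) h.symm).trans rfl

theorem coe_blockEquiv (hC : C'.Refines C) (W' : Tower T C') (b : Block C W')
    (p : Fin b.tower.len) : ((blockEquiv hC W' ⟨b, p⟩ : Fin W'.len) : ℕ) = b.start + p := rfl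

theorem refineMap_apply_same (hC : C'.Refines C) (M : MatrixProd T C K) (W' : Tower T C')
    (b : Block C W') (p q : Fin b.tower.len) :
    refineMap K hC M W' (blockEquiv hC W' ⟨b, p⟩) (blockEquiv hC W' ⟨b, q⟩) = M b.tower p q := by
  change Matrix.blockDiagonal' (fun b : Block C W' => M b.tower) ((blockEquiv hC W').symm _)
    ((blockEquiv hC W').symm _) = _
  rw [Equiv.symm_apply_apply, Equiv.symm_apply_apply, Matrix.blockDiagonal'_apply_eq]

theorem refineMap_apply_ne (hC : C'.Refines C) (M : MatrixProd T C K) (W' : Tower T C')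
    {b c : Block C W'} (hbc : b ≠ c) (p : Fin b.tower.len) (q : Fin c.tower.len) :
    refineMap K hC M W' (blockEquiv hC W' ⟨b, p⟩) (blockEquiv hC W' ⟨c, q⟩) = 0 := by
  change Matrix.blockDiagonal' (fun b : Block C W' => M b.tower) ((blockEquiv hC W').symm _)
    ((blockEquiv hC W').symm _) = _
  rw [Equiv.symm_apply_apply, Equiv.symm_apply_apply, Matrix.blockDiagonal'_apply_ne _ _ _ hbc]

theorem monom_sum {ι : Type*} (s : Finset ι) (f : ι → Coeff T K) (n : ℤ) :
    monom (∑ i ∈ s, f i) n = ∑ i ∈ s, monom (f i) n :=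
  map_sum (SkewMonoidAlgebra.singleAddHom (Multiplicative.ofAdd n)) f s

theorem monom_chi_mem_of_subset {Q : Set (Set X)} (hQ : Q ⊆ C.P) {Y : Set X} (hY : IsClopen Y)
    (h : Y = ⋃₀ Q) : monom (chi T K Y hY) 1 ∈ approxAlgebra T C K := by
  classical
  have hfin : Q.Finite := C.finite_P.subset hQ
  have key : chi T K Y hY = ∑ Z ∈ hfin.toFinset.attach,
      chi T K Z.1 (C.isClopen_P Z.1 (hQ (hfin.mem_toFinset.1 Z.2))) := by
    ext x
    have happ : ∀ (s : Finset hfin.toFinset) (F : hfin.toFinset → Coeff T K),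
        (∑ i ∈ s, F i) x = ∑ i ∈ s, F i x := by
      intro s F
      induction s using Finset.cons_induction with
      | empty => rfl
      | cons i s hi ih => rw [Finset.sum_cons, Finset.sum_cons, Coeff.add_apply, ih]
    rw [happ]
    simp only [chi_apply]
    by_cases hx : x ∈ Y
    · obtain ⟨Z, hZ, hxZ⟩ := Set.mem_sUnion.1 (h ▸ hx)
      rw [if_pos hx, Finset.sum_eq_single ⟨Z, hfin.mem_toFinset.2 hZ⟩, if_pos hxZ]
      · intro V _ hne
        rw [if_neg]
        intro hxV
        exact hne (Subtype.ext (C.eq_of_mem (Set.mem_insert_of_mem _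
          (hQ (hfin.mem_toFinset.1 V.2))) (Set.mem_insert_of_mem _ (hQ hZ)) hxV hxZ))
      · simp
    · rw [if_neg hx, Finset.sum_eq_zero]
      intro Z _
      rw [if_neg]
      intro hxZ
      exact hx (h ▸ Set.mem_sUnion.2 ⟨Z.1, hfin.mem_toFinset.1 Z.2, hxZ⟩)
  rw [key, monom_sum]
  exact sum_mem fun Z _ => StarAlgebra.subset_adjoin _ _ ⟨Z.1, hQ (hfin.mem_toFinset.1 Z.2), rfl⟩

variable (T C K) in
/-- The element `χ_{X∖E} t` of the crossed product. -/
def shiftElt : CrossedProduct T K := monom (chi T K C.Eᶜ C.isClopen_E.compl) 1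

theorem shiftElt_mem : shiftElt T C K ∈ approxAlgebra T C K := by
  refine monom_chi_mem_of_subset subset_rfl _ (Set.ext fun x => ⟨fun hx => ?_, ?_⟩)
  · obtain ⟨Z, hZ, hxZ⟩ := C.exists_mem hx
    exact ⟨Z, hZ, hxZ⟩
  · rintro ⟨Z, hZ, hxZ⟩
    exact C.notMem_E hZ hxZ

theorem approxAlgebra_le (hC : C'.Refines C) : approxAlgebra T C K ≤ approxAlgebra T C' K := by
  refine StarAlgebra.adjoin_le ?_
  rintro _ ⟨Z, hZ, rfl⟩
  refine monom_chi_mem_of_subset (Q := {Z' ∈ C'.P | Z' ⊆ Z}) (fun _ h => h.1) _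
    (Set.ext fun x => ⟨fun hx => ?_, ?_⟩)
  · have hxE : x ∉ C'.E := fun h => C.notMem_E hZ hx (hC.subset_E h)
    obtain ⟨Z', hZ', hxZ'⟩ := C'.exists_mem hxE
    obtain ⟨Y, hY, hsub⟩ := hC.refines Z' (Set.mem_insert_of_mem _ hZ')
    have := C.eq_of_mem hY (Set.mem_insert_of_mem _ hZ) (hsub hxZ') hx
    exact ⟨Z', ⟨hZ', this ▸ hsub⟩, hxZ'⟩
  · rintro ⟨Z', ⟨-, hsub⟩, hxZ'⟩
    exact hsub hxZ'

theorem entry_shift (x : X) (s i j : ℤ) (a : CrossedProduct T K) :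
    entry x i j a = entry ((T ^ s : X ≃ₜ X) x) (i - s) (j - s) a := by
  unfold entry
  rw [zpow_zpow_apply, sub_add_cancel, sub_sub_sub_cancel_right]

theorem refineMap_towerRep_apply (hC : C'.Refines C) (a : approxAlgebra T C K) (W' : Tower T C')
    {x : X} (hx : x ∈ W'.base) (b c : Block C W') (p : Fin b.tower.len) (q : Fin c.tower.len) :
    refineMap K hC (towerRep T C K a) W' (blockEquiv hC W' ⟨b, p⟩) (blockEquiv hC W' ⟨c, q⟩) =
      entry x ((b.start : ℤ) + p) ((c.start : ℤ) + q) (a : CrossedProduct T K) := by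
  have hp := p.2
  have hq := q.2
  rw [entry_shift x b.start, add_sub_cancel_left]
  by_cases hbc : b = c
  · subst hbc
    rw [refineMap_apply_same, towerRep_apply _ _ (b.mem_base hx), add_sub_cancel_left]
  · rw [refineMap_apply_ne _ _ _ hbc]
    refine (approxAlgebra_le_blockAlgebra b.tower (b.mem_base hx) a.2 _ _ fun h => ?_).symm
    obtain ⟨h1, h2⟩ := h.1 ⟨by omega, by omega⟩
    have h3 := b.tower.eq_of_level c.tower (b.mem_base hx) (c.mem_base hx) (j := q) h1 h2
      (by omega) (by omega) (by
        rw [zpow_zpow_apply, zpow_zpow_apply, sub_add_cancel, add_comm])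
    refine hbc (Block.ext_start ?_)
    have h4 := h3.1
    omega

/-- The representations are compatible with the embeddings. -/
theorem refineMap_towerRep (hC : C'.Refines C) {a : CrossedProduct T K}
    (ha : a ∈ approxAlgebra T C K) (ha' : a ∈ approxAlgebra T C' K) :
    refineMap K hC (towerRep T C K ⟨a, ha⟩) = towerRep T C' K ⟨a, ha'⟩ := by
  funext W'
  obtain ⟨x, hx⟩ := W'.nonempty
  have key : ∀ i j : Σ b : Block C W', Fin b.tower.len,
      refineMap K hC (towerRep T C K ⟨a, ha⟩) W' (blockEquiv hC W' i) (blockEquiv hC W' j) =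
      entry x ((blockEquiv hC W' i : ℕ) : ℤ) ((blockEquiv hC W' j : ℕ) : ℤ) a := by
    rintro ⟨b, p⟩ ⟨c, q⟩
    rw [refineMap_towerRep_apply hC ⟨a, ha⟩ W' hx, coe_blockEquiv, coe_blockEquiv, Nat.cast_add,
      Nat.cast_add]
  refine Matrix.ext fun i j => ?_
  have h := key ((blockEquiv hC W').symm i) ((blockEquiv hC W').symm j)
  rw [Equiv.apply_symm_apply, Equiv.apply_symm_apply] at h
  rw [h, towerRep_apply ⟨a, ha'⟩ W' hx]

/-! ### The approximating sequence -/

/-- A sequence `(Eₙ, 𝒫ₙ)` of pairs as above such that `(Eₙ)` is decreasing with intersection a single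
point `y`, the partition `𝒫ₙ₊₁ ∪ {Eₙ₊₁}` is finer than `𝒫ₙ ∪ {Eₙ}`, and the sets in
`⋃ₙ (𝒫ₙ ∪ {Eₙ})` generate the topology of `X`. (The sequence is indexed from `0`.) -/
structure ApproxSeq (X : Type*) [t : TopologicalSpace X] where
  pair : ℕ → ClopenPair X
  y : X
  iInter_E : ⋂ n, (pair n).E = {y}
  refines : ∀ n, (pair (n + 1)).Refines (pair n)
  generates : t = TopologicalSpace.generateFrom (⋃ n, insert (pair n).E (pair n).P)

variable (T K)

/-- The algebra `𝒜ₙ = 𝒜(Eₙ, 𝒫ₙ)`. -/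
def algA (D : ApproxSeq X) (n : ℕ) : StarSubalgebra K (CrossedProduct T K) :=
  approxAlgebra T (D.pair n) K

/-- The algebra `𝔑ₙ = ∏_{W ∈ 𝒱ₙ} M_{|W|}(K)`. -/
abbrev frakR (D : ApproxSeq X) (n : ℕ) := MatrixProd T (D.pair n) K

/-- The representation `πₙ : 𝒜ₙ → 𝔑ₙ`. -/
def piN (D : ApproxSeq X) (n : ℕ) : algA T K D n →⋆ₐ[K] frakR T K D n :=
  towerRep T (D.pair n) K

theorem algA_le_succ (D : ApproxSeq X) (n : ℕ) : algA T K D n ≤ algA T K D (n + 1) :=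
  approxAlgebra_le (D.refines n)

theorem algA_mono (D : ApproxSeq X) : Monotone (algA T K D) :=
  monotone_nat_of_le_succ (algA_le_succ T K D)

/-- The embedding `jₙ : 𝔑ₙ → 𝔑ₙ₊₁`. -/
def jSucc (D : ApproxSeq X) (n : ℕ) : frakR T K D n →⋆ₐ[K] frakR T K D (n + 1) :=
  refineMap K (D.refines n)

/-- The composition `𝔑ₘ → 𝔑ₘ₊₁ → ⋯ → 𝔑ₙ` of the embeddings `jₘ, …, jₙ₋₁`. -/
def jMap (D : ApproxSeq X) (m n : ℕ) (h : m ≤ n) : frakR T K D m →⋆ₐ[K] frakR T K D n :=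
  Nat.leRec (motive := fun n _ => frakR T K D m →⋆ₐ[K] frakR T K D n) (StarAlgHom.id K _)
    (fun k _ g => (jSucc T K D k).comp g) h

theorem jMap_self (D : ApproxSeq X) (m : ℕ) : jMap T K D m m le_rfl = StarAlgHom.id K _ :=
  Nat.leRec_self _ _

theorem jMap_succ (D : ApproxSeq X) (m n : ℕ) (h : m ≤ n) :
    jMap T K D m (n + 1) (h.trans n.le_succ) = (jSucc T K D n).comp (jMap T K D m n h) :=
  Nat.leRec_succ _ _ h

instance (D : ApproxSeq X) : DirectedSystem (frakR T K D) (jMap T K D · · ·) where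
  map_self m x := by rw [jMap_self]; rfl
  map_map k j i hij hjk x := by
    induction k, hjk using Nat.le_induction with
    | base => rw [jMap_self]; rfl
    | succ k hjk ih =>
      rw [jMap_succ T K D j k hjk, jMap_succ T K D i k (hij.trans hjk), StarAlgHom.comp_apply,
        ih, StarAlgHom.comp_apply]

/-- The `*`-algebra `𝔑_∞`: the inductive limit of the system `(𝔑ₙ, jₙ)`. -/
def frakRInf (D : ApproxSeq X) : Type _ := DirectLimit (frakR T K D) (jMap T K D)

instance (D : ApproxSeq X) : Ring (frakRInf T K D) :=
  inferInstanceAs (Ring (DirectLimit (frakR T K D) (jMap T K D)))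

instance (D : ApproxSeq X) : StarRing (frakRInf T K D) :=
  inferInstanceAs (StarRing (DirectLimit (frakR T K D) (jMap T K D)))

instance (D : ApproxSeq X) : Algebra K (frakRInf T K D) :=
  inferInstanceAs (Algebra K (DirectLimit (frakR T K D) (jMap T K D)))

instance (D : ApproxSeq X) : StarModule K (frakRInf T K D) :=
  inferInstanceAs (StarModule K (DirectLimit (frakR T K D) (jMap T K D)))

/-- The canonical map `𝔑ₙ → 𝔑_∞`. -/
def toInf (D : ApproxSeq X) (n : ℕ) : frakR T K D n →⋆ₐ[K] frakRInf T K D where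
  toFun M := (⟦⟨n, M⟩⟧ : DirectLimit (frakR T K D) (jMap T K D))
  map_one' := (DirectLimit.one_def n).symm
  map_mul' M N := (DirectLimit.mul_def n M N).symm
  map_zero' := (DirectLimit.zero_def n).symm
  map_add' M N := (DirectLimit.add_def n M N).symm
  commutes' c := by
    rw [Algebra.algebraMap_eq_smul_one, Algebra.algebraMap_eq_smul_one]
    exact (DirectLimit.smul_def n 1 c).symm.trans (congrArg _ (DirectLimit.one_def n).symm)
  map_star' M := rfl

theorem toInf_jMap (D : ApproxSeq X) {m n : ℕ} (h : m ≤ n) (M : frakR T K D m) :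
    toInf T K D n (jMap T K D m n h M) = toInf T K D m M :=
  DirectLimit.mk_apply (f := jMap T K D) m n M h

theorem exists_toInf (D : ApproxSeq X) (x : frakRInf T K D) : ∃ n M, x = toInf T K D n M :=
  DirectLimit.exists_eq_mk (jMap T K D) x

theorem exists_toInf₂ (D : ApproxSeq X) (x y : frakRInf T K D) :
    ∃ n M N, x = toInf T K D n M ∧ y = toInf T K D n N :=
  DirectLimit.exists_eq_mk₂ (jMap T K D) x y

theorem jSucc_piN (D : ApproxSeq X) {n : ℕ} {a : CrossedProduct T K} (h : a ∈ algA T K D n)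
    (h' : a ∈ algA T K D (n + 1)) :
    jSucc T K D n (piN T K D n ⟨a, h⟩) = piN T K D (n + 1) ⟨a, h'⟩ :=
  refineMap_towerRep (D.refines n) h h'

theorem jMap_piN (D : ApproxSeq X) {m n : ℕ} (h : m ≤ n) {a : CrossedProduct T K}
    (hm : a ∈ algA T K D m) (hn : a ∈ algA T K D n) :
    jMap T K D m n h (piN T K D m ⟨a, hm⟩) = piN T K D n ⟨a, hn⟩ := by
  induction n, h using Nat.le_induction with
  | base => rw [jMap_self]; rfl
  | succ n h ih =>
    rw [jMap_succ T K D m n h, StarAlgHom.comp_apply, ih (algA_mono T K D h hm)]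
    exact jSucc_piN T K D _ _

/-- The algebra `𝒜_∞ = ⋃ₙ 𝒜ₙ`. -/
def algAInf (D : ApproxSeq X) : StarSubalgebra K (CrossedProduct T K) where
  carrier := ⋃ n, (algA T K D n : Set (CrossedProduct T K))
  mul_mem' {a b} ha hb := by
    obtain ⟨m, hm⟩ := Set.mem_iUnion.1 ha
    obtain ⟨n, hn⟩ := Set.mem_iUnion.1 hb
    exact Set.mem_iUnion.2 ⟨max m n, mul_mem (algA_mono T K D (le_max_left m n) hm)
      (algA_mono T K D (le_max_right m n) hn)⟩
  add_mem' {a b} ha hb := by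
    obtain ⟨m, hm⟩ := Set.mem_iUnion.1 ha
    obtain ⟨n, hn⟩ := Set.mem_iUnion.1 hb
    exact Set.mem_iUnion.2 ⟨max m n, add_mem (algA_mono T K D (le_max_left m n) hm)
      (algA_mono T K D (le_max_right m n) hn)⟩
  algebraMap_mem' c := Set.mem_iUnion.2 ⟨0, algebraMap_mem (algA T K D 0) c⟩
  star_mem' {a} ha := by
    obtain ⟨m, hm⟩ := Set.mem_iUnion.1 ha
    exact Set.mem_iUnion.2 ⟨m, star_mem hm⟩

theorem mem_algAInf {D : ApproxSeq X} {a : CrossedProduct T K} :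
    a ∈ algAInf T K D ↔ ∃ n, a ∈ algA T K D n := Set.mem_iUnion

theorem algA_le_algAInf (D : ApproxSeq X) (n : ℕ) : algA T K D n ≤ algAInf T K D :=
  fun _ h => (mem_algAInf T K).2 ⟨n, h⟩

/-- The underlying function of `π_∞`. -/
def piInfFun (D : ApproxSeq X) (a : algAInf T K D) : frakRInf T K D :=
  toInf T K D ((mem_algAInf T K).1 a.2).choose
    (piN T K D _ ⟨a, ((mem_algAInf T K).1 a.2).choose_spec⟩)

theorem piInfFun_eq (D : ApproxSeq X) (a : algAInf T K D) {n : ℕ}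
    (hn : (a : CrossedProduct T K) ∈ algA T K D n) :
    piInfFun T K D a = toInf T K D n (piN T K D n ⟨a, hn⟩) := by
  have key : ∀ {m n : ℕ} (h : m ≤ n) (hm : (a : CrossedProduct T K) ∈ algA T K D m)
      (hn : (a : CrossedProduct T K) ∈ algA T K D n),
      toInf T K D m (piN T K D m ⟨a, hm⟩) = toInf T K D n (piN T K D n ⟨a, hn⟩) := by
    intro m n h hm hn
    rw [← toInf_jMap T K D h, jMap_piN T K D h hm hn]
  rcases le_total ((mem_algAInf T K).1 a.2).choose n with h | h
  · exact key h _ _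
  · exact (key h _ _).symm

/-- The map `π_∞ : 𝒜_∞ → 𝔑_∞` induced by the maps `πₙ`. -/
def piInf (D : ApproxSeq X) : algAInf T K D →⋆ₐ[K] frakRInf T K D where
  toFun := piInfFun T K D
  map_one' := by
    rw [piInfFun_eq T K D 1 (n := 0) (one_mem _)]
    exact (congrArg _ (map_one (piN T K D 0))).trans (map_one _)
  map_mul' a b := by
    obtain ⟨m, hm⟩ := (mem_algAInf T K).1 a.2
    obtain ⟨n, hn⟩ := (mem_algAInf T K).1 b.2
    have hm' := algA_mono T K D (le_max_left m n) hm
    have hn' := algA_mono T K D (le_max_right m n) hn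
    rw [piInfFun_eq T K D a hm', piInfFun_eq T K D b hn', ← map_mul, ← map_mul,
      piInfFun_eq T K D (a * b) (mul_mem hm' hn')]
    rfl
  map_zero' := by
    rw [piInfFun_eq T K D 0 (n := 0) (zero_mem _)]
    exact (congrArg _ (map_zero (piN T K D 0))).trans (map_zero _)
  map_add' a b := by
    obtain ⟨m, hm⟩ := (mem_algAInf T K).1 a.2
    obtain ⟨n, hn⟩ := (mem_algAInf T K).1 b.2
    have hm' := algA_mono T K D (le_max_left m n) hm
    have hn' := algA_mono T K D (le_max_right m n) hn
    rw [piInfFun_eq T K D a hm', piInfFun_eq T K D b hn', ← map_add, ← map_add,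
      piInfFun_eq T K D (a + b) (add_mem hm' hn')]
    rfl
  commutes' c := by
    rw [piInfFun_eq T K D _ (n := 0) (algebraMap_mem (algA T K D 0) c)]
    exact (congrArg _ (AlgHomClass.commutes (piN T K D 0) c)).trans
      (AlgHomClass.commutes (toInf T K D 0) c)
  map_star' a := by
    obtain ⟨m, hm⟩ := (mem_algAInf T K).1 a.2
    rw [piInfFun_eq T K D a hm, piInfFun_eq T K D (star a) (star_mem hm), ← map_star, ← map_star]
    rfl

theorem piInf_apply (D : ApproxSeq X) (a : algAInf T K D) {n : ℕ}
    (hn : (a : CrossedProduct T K) ∈ algA T K D n) :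
    piInf T K D a = toInf T K D n (piN T K D n ⟨a, hn⟩) := piInfFun_eq T K D a hn

/-! ### The rank functions and the rank completion -/

variable [MeasurableSpace X]

/-- The rank function `rkₙ(M) = ∑_{W ∈ 𝒱ₙ} μ(W) Rk(M_W)` on `𝔑ₙ`. The sum of non-negative terms is
taken in `[0, ∞]`. -/
def rkN (D : ApproxSeq X) (μ : Measure X) (n : ℕ) (M : frakR T K D n) : ℝ≥0∞ :=
  ∑' W : Tower T (D.pair n), μ W.base * ((M W).rank : ℝ≥0∞)

section rkN

variable (D : ApproxSeq X) (μ : Measure X) (n : ℕ)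

theorem rkN_zero : rkN T K D μ n 0 = 0 := by
  simp [rkN, Matrix.rank_zero]

theorem rkN_add_le (M N : frakR T K D n) :
    rkN T K D μ n (M + N) ≤ rkN T K D μ n M + rkN T K D μ n N := by
  unfold rkN
  rw [← ENNReal.tsum_add]
  refine ENNReal.tsum_le_tsum fun W => ?_
  rw [← mul_add, ← Nat.cast_add]
  gcongr
  exact rank_add_le_aux (M W) (N W)

theorem rkN_mul_le_left (M N : frakR T K D n) : rkN T K D μ n (M * N) ≤ rkN T K D μ n M := by
  refine ENNReal.tsum_le_tsum fun W => ?_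
  gcongr
  exact Matrix.rank_mul_le_left (M W) (N W)

theorem rkN_mul_le_right (M N : frakR T K D n) : rkN T K D μ n (M * N) ≤ rkN T K D μ n N := by
  refine ENNReal.tsum_le_tsum fun W => ?_
  gcongr
  exact Matrix.rank_mul_le_right (M W) (N W)

theorem rkN_star_le (M : frakR T K D n) : rkN T K D μ n (star M) ≤ rkN T K D μ n M := by
  refine ENNReal.tsum_le_tsum fun W => ?_
  gcongr
  exact rank_star_le_aux (M W)

end rkN

/-- The sequence `l ↦ rk_l(M)`, where `M ∈ 𝔑ₙ` is regarded as an element of `𝔑_l` for `l ≥ n`. -/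
def rkSeq (D : ApproxSeq X) (μ : Measure X) (n : ℕ) (M : frakR T K D n) (l : ℕ) : ℝ≥0∞ :=
  if h : n ≤ l then rkN T K D μ l (jMap T K D n l h M) else 0

/-- The rank function `rk_∞` on `𝔑_∞` given by the functions `rkₙ`. When `μ` is as in the main
result, the `rkₙ` are compatible with the embeddings `jₙ`, so that `l ↦ rk_l(M)` is constant for
`l ≥ n` and `rk_∞` restricts to `rkₙ` on `𝔑ₙ`; writing the common value as an upper limit makes the
definition meaningful for every measure. -/
def rkInf (D : ApproxSeq X) (μ : Measure X) (x : frakRInf T K D) : ℝ≥0∞ :=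
  DirectLimit.lift (jMap T K D) (fun n M => limsup (rkSeq T K D μ n M) atTop)
    (fun m n h M => limsup_congr <| by
      filter_upwards [eventually_ge_atTop n] with l hl
      rw [rkSeq, rkSeq, dif_pos (h.trans hl), dif_pos hl]
      congr 1
      exact (DirectedSystem.map_map' (f := jMap T K D) h hl M).symm) x

section rkInf

variable (D : ApproxSeq X) (μ : Measure X)

theorem rkInf_toInf (n : ℕ) (M : frakR T K D n) :
    rkInf T K D μ (toInf T K D n M) = limsup (rkSeq T K D μ n M) atTop := rfl

theorem rkInf_le_of_le {n : ℕ} {M N : frakR T K D n}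
    (h : ∀ l h, rkN T K D μ l (jMap T K D n l h M) ≤ rkN T K D μ l (jMap T K D n l h N)) :
    rkInf T K D μ (toInf T K D n M) ≤ rkInf T K D μ (toInf T K D n N) := by
  rw [rkInf_toInf, rkInf_toInf]
  refine limsup_le_limsup ?_
  filter_upwards [eventually_ge_atTop n] with l hl
  rw [rkSeq, rkSeq, dif_pos hl, dif_pos hl]
  exact h l hl

theorem rkInf_zero : rkInf T K D μ 0 = 0 := by
  rw [← map_zero (toInf T K D 0), rkInf_toInf]
  have h : rkSeq T K D μ 0 0 = fun _ => 0 := by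
    funext l
    rw [rkSeq, dif_pos (Nat.zero_le l), map_zero, rkN_zero]
  rw [h, limsup_const]

theorem rkInf_add_le (x y : frakRInf T K D) :
    rkInf T K D μ (x + y) ≤ rkInf T K D μ x + rkInf T K D μ y := by
  obtain ⟨n, M, N, rfl, rfl⟩ := exists_toInf₂ T K D x y
  rw [← map_add, rkInf_toInf, rkInf_toInf, rkInf_toInf]
  refine le_trans (limsup_le_limsup ?_) (limsup_add_le_aux _ _)
  filter_upwards [eventually_ge_atTop n] with l hl
  rw [rkSeq, rkSeq, rkSeq, dif_pos hl, dif_pos hl, dif_pos hl, map_add]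
  exact rkN_add_le T K D μ l _ _

theorem rkInf_mul_le_left (x y : frakRInf T K D) : rkInf T K D μ (x * y) ≤ rkInf T K D μ x := by
  obtain ⟨n, M, N, rfl, rfl⟩ := exists_toInf₂ T K D x y
  rw [← map_mul]
  refine rkInf_le_of_le T K D μ fun l h => ?_
  rw [map_mul]
  exact rkN_mul_le_left T K D μ l _ _

theorem rkInf_mul_le_right (x y : frakRInf T K D) : rkInf T K D μ (x * y) ≤ rkInf T K D μ y := by
  obtain ⟨n, M, N, rfl, rfl⟩ := exists_toInf₂ T K D x y
  rw [← map_mul]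
  refine rkInf_le_of_le T K D μ fun l h => ?_
  rw [map_mul]
  exact rkN_mul_le_right T K D μ l _ _

theorem rkInf_star_le (x : frakRInf T K D) : rkInf T K D μ (star x) ≤ rkInf T K D μ x := by
  obtain ⟨n, M, rfl⟩ := exists_toInf T K D x
  rw [← map_star]
  refine rkInf_le_of_le T K D μ fun l h => ?_
  rw [map_star]
  exact rkN_star_le T K D μ l _

theorem rkInf_neg (x : frakRInf T K D) : rkInf T K D μ (-x) = rkInf T K D μ x := by
  have h : ∀ x : frakRInf T K D, rkInf T K D μ (-x) ≤ rkInf T K D μ x := fun x => by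
    have := rkInf_mul_le_right T K D μ (-1) x
    rwa [neg_one_mul] at this
  refine le_antisymm (h x) ?_
  have := h (-x)
  rwa [neg_neg] at this

end rkInf

/-- The ring `𝔑_∞` regarded as a pseudometric space with the rank distance
`d(x, y) = rk_∞(x - y)`. -/
def rankRing (D : ApproxSeq X) (_μ : Measure X) : Type _ := frakRInf T K D

section rankRing

variable (D : ApproxSeq X) (μ : Measure X)

instance : Ring (rankRing T K D μ) := inferInstanceAs (Ring (frakRInf T K D))

instance : StarRing (rankRing T K D μ) := inferInstanceAs (StarRing (frakRInf T K D))

instance : Algebra K (rankRing T K D μ) := inferInstanceAs (Algebra K (frakRInf T K D))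

instance : StarModule K (rankRing T K D μ) := inferInstanceAs (StarModule K (frakRInf T K D))

/-- The rank function `rk_∞` as a function on `rankRing`. -/
def rkR (x : rankRing T K D μ) : ℝ≥0∞ := rkInf T K D μ x

instance : PseudoEMetricSpace (rankRing T K D μ) where
  edist x y := rkR T K D μ (x - y)
  edist_self x := by rw [sub_self]; exact rkInf_zero T K D μ
  edist_comm x y := by rw [← neg_sub]; exact rkInf_neg T K D μ (y - x)
  edist_triangle x y z := by
    rw [← sub_add_sub_cancel x y z]
    exact rkInf_add_le T K D μ (x - y) (y - z)

theorem edist_def (x y : rankRing T K D μ) : edist x y = rkR T K D μ (x - y) := rfl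

instance : IsUniformAddGroup (rankRing T K D μ) := by
  refine IsUniformAddGroup.mk' ?_ ?_
  · rw [EMetric.uniformContinuous_iff]
    intro ε hε
    refine ⟨ε / 2, ENNReal.half_pos hε.ne', fun {a b} h => ?_⟩
    rw [Prod.edist_eq, max_lt_iff] at h
    rw [edist_def, add_sub_add_comm]
    refine (rkInf_add_le T K D μ _ _).trans_lt ?_
    rw [← ENNReal.add_halves ε]
    exact ENNReal.add_lt_add h.1 h.2
  · rw [EMetric.uniformContinuous_iff]
    intro ε hε
    refine ⟨ε, hε, fun {a b} h => ?_⟩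
    rw [edist_def, neg_sub_neg, ← edist_def, edist_comm]
    exact h

instance : ContinuousMul (rankRing T K D μ) where
  continuous_mul := by
    rw [continuous_iff_continuousAt]
    rintro ⟨a, b⟩
    rw [ContinuousAt, EMetric.tendsto_nhds]
    intro ε hε
    filter_upwards [Metric.eball_mem_nhds (a, b) (ENNReal.half_pos hε.ne')] with p hp
    rw [Metric.mem_eball, Prod.edist_eq, max_lt_iff] at hp
    rw [edist_def, show p.1 * p.2 - a * b = (p.1 - a) * p.2 + a * (p.2 - b) by noncomm_ring]
    refine (rkInf_add_le T K D μ _ _).trans_lt ?_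
    rw [← ENNReal.add_halves ε]
    exact ENNReal.add_lt_add ((rkInf_mul_le_left T K D μ _ _).trans_lt hp.1)
      ((rkInf_mul_le_right T K D μ _ _).trans_lt hp.2)

instance : IsTopologicalRing (rankRing T K D μ) where

instance : UniformContinuousConstSMul K (rankRing T K D μ) where
  uniformContinuous_const_smul c := by
    rw [EMetric.uniformContinuous_iff]
    intro ε hε
    refine ⟨ε, hε, fun {a b} h => ?_⟩
    rw [edist_def, ← smul_sub, Algebra.smul_def]
    exact (rkInf_mul_le_right T K D μ _ _).trans_lt h

theorem uniformContinuous_star : UniformContinuous (star : rankRing T K D μ → rankRing T K D μ) := by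
  rw [EMetric.uniformContinuous_iff]
  intro ε hε
  refine ⟨ε, hε, fun {a b} h => ?_⟩
  rw [edist_def, ← star_sub]
  exact (rkInf_star_le T K D μ _).trans_lt h

/-- The rank completion `𝔑_rk` of `𝔑_∞`: the (Hausdorff) completion for the rank distance. -/
abbrev frakRrk : Type _ := UniformSpace.Completion (rankRing T K D μ)

/-- The involution of `𝔑_rk`: the continuous extension of the involution of `𝔑_∞`. -/
instance : StarRing (frakRrk T K D μ) where
  star := UniformSpace.Completion.map star
  star_involutive x := by
    induction x using UniformSpace.Completion.induction_on with
    | hp =>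
      exact isClosed_eq (UniformSpace.Completion.continuous_map.comp
        UniformSpace.Completion.continuous_map) continuous_id
    | ih a =>
      rw [UniformSpace.Completion.map_coe (uniformContinuous_star T K D μ),
        UniformSpace.Completion.map_coe (uniformContinuous_star T K D μ), star_star]
  star_mul x y := by
    induction x, y using UniformSpace.Completion.induction_on₂ with
    | hp =>
      exact isClosed_eq (UniformSpace.Completion.continuous_map.comp continuous_mul)
        (Continuous.mul (UniformSpace.Completion.continuous_map.comp continuous_snd)
          (UniformSpace.Completion.continuous_map.comp continuous_fst))
    | ih a b =>
      rw [← UniformSpace.Completion.coe_mul,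
        UniformSpace.Completion.map_coe (uniformContinuous_star T K D μ),
        UniformSpace.Completion.map_coe (uniformContinuous_star T K D μ),
        UniformSpace.Completion.map_coe (uniformContinuous_star T K D μ), star_mul,
        UniformSpace.Completion.coe_mul]
  star_add x y := by
    induction x, y using UniformSpace.Completion.induction_on₂ with
    | hp =>
      exact isClosed_eq (UniformSpace.Completion.continuous_map.comp continuous_add)
        (Continuous.add (UniformSpace.Completion.continuous_map.comp continuous_fst)
          (UniformSpace.Completion.continuous_map.comp continuous_snd))
    | ih a b =>
      rw [← UniformSpace.Completion.coe_add,
        UniformSpace.Completion.map_coe (uniformContinuous_star T K D μ),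
        UniformSpace.Completion.map_coe (uniformContinuous_star T K D μ),
        UniformSpace.Completion.map_coe (uniformContinuous_star T K D μ), star_add,
        UniformSpace.Completion.coe_add]

/-- The canonical map `𝔑_∞ → 𝔑_rk`. -/
def toRk : frakRInf T K D →⋆ₐ[K] frakRrk T K D μ where
  toFun x := ((show rankRing T K D μ from x : rankRing T K D μ) : frakRrk T K D μ)
  map_one' := UniformSpace.Completion.coe_one (rankRing T K D μ)
  map_mul' x y := UniformSpace.Completion.coe_mul (α := rankRing T K D μ) x y
  map_zero' := UniformSpace.Completion.coe_zero (α := rankRing T K D μ)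
  map_add' x y := UniformSpace.Completion.coe_add (α := rankRing T K D μ) x y
  commutes' _ := rfl
  map_star' x := (UniformSpace.Completion.map_coe (uniformContinuous_star T K D μ) x).symm

end rankRing

/-! ### The `*`-regular closures -/

/-- `ℛₙ`, the `*`-regular closure of (the image under `πₙ` of) `𝒜ₙ` in `𝔑ₙ`. -/
def regN (D : ApproxSeq X) (n : ℕ) : Subring (frakR T K D n) :=
  starRegularClosure (Set.range (piN T K D n))

/-- `ℛ_∞`, the `*`-regular closure of (the image under `π_∞` of) `𝒜_∞` in `𝔑_∞`. -/
def regInf (D : ApproxSeq X) : Subring (frakRInf T K D) :=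
  starRegularClosure (Set.range (piInf T K D))

/-- `φ : 𝒜 → 𝔑_rk` is the canonical homomorphism: a homomorphism of unital `*`-algebras that extends
`𝒜_∞ → 𝔑_∞ → 𝔑_rk` and maps `t` to `lim_n πₙ(χ_{X∖Eₙ} t)`. -/
def IsCanonical (D : ApproxSeq X) (μ : Measure X)
    (φ : CrossedProduct T K →⋆ₐ[K] frakRrk T K D μ) : Prop :=
  (∀ a : algAInf T K D, φ a = toRk T K D μ (piInf T K D a)) ∧
    Tendsto (fun n => toRk T K D μ (toInf T K D n
        (piN T K D n ⟨shiftElt T (D.pair n) K, shiftElt_mem⟩)))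
      atTop (𝓝 (φ (monom 1 1)))

/-- `ℛ_𝒜`, the `*`-regular closure in `𝔑_rk` of the image of `𝒜` under `φ`. -/
def regA (D : ApproxSeq X) (μ : Measure X)
    (φ : CrossedProduct T K →⋆ₐ[K] frakRrk T K D μ) : Subring (frakRrk T K D μ) :=
  starRegularClosure (Set.range φ)

end Approximation

end RegClosure

end

noncomputable section

namespace RegClosure

/-! ### Relative inverses and `*`-regular rings -/

section StarRegular

/-! The middle row of the diagram rests on the relative (Moore–Penrose) inverse. In a `*`-regular
ring every element has one, it is unique, and its four defining equations are preserved by every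
`*`-homomorphism. So the preimage of a `*`-regular subring under a `*`-homomorphism between
`*`-regular rings is again `*`-regular, which makes `*`-regular closures functorial
(`map_mem_starRegularClosure`). Since the union of an increasing chain of `*`-regular subrings is
`*`-regular, the closure in the limit is the union of the closures (`iUnion_regN`).

For the bottom row, matrices over a field with positive definite involution form a `*`-regular ring.
Products inherit this, and so does the inductive limit, because relative inverses can be taken at a
finite stage. For the completion, the identity `IsRelInverse.sub_eq` writes the difference of two
relative inverses as a sum of three products, each with a factor `b - a` or its adjoint. Hence
relative inversion is Lipschitz for the rank distance, extends to the completion, and keeps its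
defining equations there.

Injectivity comes from dynamics. By ergodicity and fullness, almost every orbit visits `E` in the
past and in the future, so almost every point lies on a level of a tower (`ae_exists_level`). Sets
of full measure are dense and coefficients are locally constant, so an element is determined by its
entries along the towers. The rank of a characteristic function is the measure of its set
(`rkN_chi`). A nonzero element of `𝔑ₙ` can be compressed by matrix units to the image of some `χ_W`,
so its rank is at least `μ(W) > 0` (`rkInf_pos`); thus the rank distance separates the points of
`𝔑_∞`.

For the canonical map, all of `C_K(X)` lies in `𝒜_∞`, so only `t` has to be constructed. Singletons
are null, hence `μ(Eₙ) → 0`, and the partial isometries `χ_{X∖Eₙ} t` form a Cauchy sequence whose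
initial and final projections tend to `1`. The limit is a unitary `u` that implements `T` on
`C_K(X)`, and the universal property of the crossed product yields `φ(∑ fₙ tⁿ) = ∑ fₙ uⁿ`. It is
injective because near any point off the orbit of `y`, which is a null set, each `a ∈ 𝒜` can be cut
down by some `χ_Z` to an element of `𝒜_∞` (`exists_chi_mul_mem_algAInf`). -/

theorem IsStarRegularRing.isStarRegularSubring_top {R : Type*} [Ring R] [StarRing R]
    (hR : IsStarRegularRing R) : IsStarRegularSubring (⊤ : Subring R) :=
  ⟨fun _ _ => trivial, fun x _ => (hR.1 x).imp fun _ hy => ⟨trivial, hy⟩, fun x _ => hR.2 x⟩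

/-- `y` is the relative (Moore–Penrose) inverse of `x`. -/
def IsRelInverse {R : Type*} [Ring R] [StarRing R] (x y : R) : Prop :=
  x * y * x = x ∧ y * x * y = y ∧ star (x * y) = x * y ∧ star (y * x) = y * x

theorem IsStarRegularRing.exists_isRelInverse {R : Type*} [Ring R] [StarRing R]
    (hR : IsStarRegularRing R) (x : R) : ∃ y, IsRelInverse x y := by
  obtain ⟨y, -, hy⟩ := hR.isStarRegularSubring_top.exists_relInverse (Subring.mem_top x)
  exact ⟨y, hy⟩

/-- A `*`-homomorphism maps relative inverses to relative inverses. -/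
theorem IsRelInverse.map {R S F : Type*} [Ring R] [StarRing R] [Ring S] [StarRing S]
    [FunLike F R S] [RingHomClass F R S] [StarHomClass F R S] (f : F) {x y : R}
    (h : IsRelInverse x y) : IsRelInverse (f x) (f y) := by
  obtain ⟨h1, h2, h3, h4⟩ := h
  refine ⟨?_, ?_, ?_, ?_⟩
  · rw [← map_mul, ← map_mul, h1]
  · rw [← map_mul, ← map_mul, h2]
  · rw [← map_mul, ← map_star, h3]
  · rw [← map_mul, ← map_star, h4]

/-- A ring in which every element has a relative inverse is `*`-regular. -/
theorem isStarRegularRing_of_isRelInverse {R : Type*} [Ring R] [StarRing R]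
    (h : ∀ x : R, ∃ y, IsRelInverse x y) : IsStarRegularRing R := by
  refine ⟨fun x => (h x).imp fun _ hy => hy.1, fun x hx => ?_⟩
  obtain ⟨y, h1, -, h3, -⟩ := h x
  -- The computation is `x = x y x = (x y)^* x = y^* (x^* x) = 0`.
  rw [← h1, ← h3, star_mul, mul_assoc, hx, mul_zero]

theorem isStarRegularSubring_starRegularClosure {R : Type*} [Ring R] [StarRing R]
    (hR : IsStarRegularRing R) (S : Set R) : IsStarRegularSubring (starRegularClosure S) :=
  (isLeast_starRegularClosure hR S).1.2

theorem subset_starRegularClosure {R : Type*} [Ring R] [StarRing R] (S : Set R) :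
    S ⊆ starRegularClosure S :=
  fun _ hx => Subring.mem_sInf.2 fun _ hB => hB.1 hx

theorem starRegularClosure_le {R : Type*} [Ring R] [StarRing R] {S : Set R} {B : Subring R}
    (hS : S ⊆ B) (hB : IsStarRegularSubring B) : starRegularClosure S ≤ B :=
  sInf_le ⟨hS, hB⟩

/-- A `*`-homomorphism between `*`-regular rings maps `*`-regular closures into `*`-regular
closures. -/
theorem map_mem_starRegularClosure {R S F : Type*} [Ring R] [StarRing R] [Ring S] [StarRing S]
    [FunLike F R S] [RingHomClass F R S] [StarHomClass F R S] (hR : IsStarRegularRing R)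
    (hS : IsStarRegularRing S) (f : F) {A : Set R} {B : Set S}
    (hAB : ∀ a ∈ A, f a ∈ starRegularClosure B) {r : R} (hr : r ∈ starRegularClosure A) :
    f r ∈ starRegularClosure B := by
  have hB := isStarRegularSubring_starRegularClosure hS B
  -- By minimality of the closure of `A`, it is enough that the preimage of the closure of `B` is
  -- `*`-regular.
  suffices h : IsStarRegularSubring ((starRegularClosure B).comap (f : R →+* S)) from
    starRegularClosure_le (B := (starRegularClosure B).comap (f : R →+* S)) hAB h hr
  refine ⟨fun x hx => ?_, fun x hx => ?_, fun x _ => hR.2 x⟩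
  · have := hB.1 _ hx
    rw [Subring.mem_comap]
    simpa [map_star] using this
  · obtain ⟨y, hy⟩ := hR.exists_isRelInverse x
    obtain ⟨z, hzB, hz⟩ := hB.exists_relInverse hx
    refine ⟨y, ?_, hy.1⟩
    -- The image of the relative inverse `y` of `x` is a relative inverse of `f x`. The closure of
    -- `B` contains one as well, and uniqueness identifies them. An arbitrary quasi-inverse of `x`
    -- would not do.
    have : f y = z := relInverse_unique (hy.map f) hz
    rw [Subring.mem_comap]
    simpa [this] using hzB

/-- The difference of two relative inverses. -/
theorem IsRelInverse.sub_eq {R : Type*} [Ring R] [StarRing R] {a b a' b' : R}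
    (ha : IsRelInverse a a') (hb : IsRelInverse b b') :
    b' - a' = -(b' * (b - a) * a') + b' * star b' * star (b - a) * (1 - a * a') +
      (1 - b' * b) * star (b - a) * star a' * a' := by
  obtain ⟨a1, a2, a3, a4⟩ := ha
  obtain ⟨b1, b2, b3, b4⟩ := hb
  -- Expanding gives `b' - a' = -b'(b - a)a' + b'(1 - a a') - (1 - b' b)a'`. The identities
  -- `e1`–`e4` insert the factor `(b - a)^*` into the last two terms.
  have e1 : star a * (1 - a * a') = 0 := by
    rw [mul_sub, mul_one, ← a3, ← star_mul, a1, sub_self]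
  have e2 : b' * star b' * star b = b' := by
    rw [mul_assoc, ← star_mul, b3, ← mul_assoc, b2]
  have e3 : (1 - b' * b) * star b = 0 := by
    rw [sub_mul, one_mul, ← b4, ← star_mul, ← mul_assoc, b1, sub_self]
  have e4 : star a * star a' * a' = a' := by
    rw [← star_mul, a4, a2]
  have h2 : b' * star b' * star (b - a) * (1 - a * a') = b' * (1 - a * a') := by
    rw [star_sub, mul_sub _ (star b), sub_mul _ _ (1 - a * a'), e2, mul_assoc _ (star a), e1, mul_zero,
      sub_zero]
  have h3 : (1 - b' * b) * star (b - a) * star a' * a' = -((1 - b' * b) * a') := by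
    rw [star_sub, mul_sub, e3, zero_sub, neg_mul, neg_mul, mul_assoc, mul_assoc, ← mul_assoc (star a),
      e4]
  rw [h2, h3]
  noncomm_ring

theorem isStarRegularRing_pi {ι : Type*} {R : ι → Type*} [∀ i, Ring (R i)] [∀ i, StarRing (R i)]
    (h : ∀ i, IsStarRegularRing (R i)) : IsStarRegularRing (∀ i, R i) := by
  refine ⟨fun x => ?_, fun x hx => ?_⟩
  · choose y hy using fun i => (h i).1 (x i)
    exact ⟨y, funext hy⟩
  · exact funext fun i => (h i).2 _ (congrFun hx i)

/-- Regularity holds over any field: a matrix is equivalent to an idempotent normal form, and the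
product of the two invertible factors is a quasi-inverse. Properness is where positive definiteness
enters, through the diagonal entries of `M^* M`. -/
theorem isStarRegularRing_matrix {K : Type*} [Field K] [StarRing K]
    (hK : IsPositiveDefiniteInvolution K) (n : ℕ) :
    IsStarRegularRing (Matrix (Fin n) (Fin n) K) := by
  refine ⟨fun M => ?_, fun M hM => ?_⟩
  · obtain ⟨V, U, e, hV, hU, h⟩ := Matrix.exists_rank_normal_form M
    obtain ⟨V', hV'⟩ := hV.exists_left_inv
    obtain ⟨U', hU'⟩ := hU.exists_right_inv
    have hN : (V * M * U) * (V * M * U) = V * M * U := by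
      rw [h, Matrix.submatrix_mul_equiv, Matrix.fromBlocks_multiply]
      simp
    refine ⟨U * V, ?_⟩
    calc M * (U * V) * M = (V' * V) * M * (U * V) * M * (U * U') := by
          rw [hV', hU', one_mul, mul_one]
      _ = V' * ((V * M * U) * (V * M * U)) * U' := by simp only [mul_assoc]
      _ = (V' * V) * M * (U * U') := by rw [hN]; simp only [mul_assoc]
      _ = M := by rw [hV', hU', one_mul, mul_one]
  · ext i j
    -- The `(j, j)` entry of `M^* M` is the sum of the `star (M i j) * M i j` along column `j`.
    refine hK n (fun i => M i j) ?_ i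
    have := congrFun (congrFun hM j) j
    simpa [Matrix.mul_apply, Matrix.star_apply] using this

end StarRegular

/-! ### Regularity of `𝔑ₙ` and `𝔑_∞`, and their regular closures -/

section Approximation

variable {X : Type*} [TopologicalSpace X] (T : X ≃ₜ X) (K : Type*) [Field K] [StarRing K]

theorem isStarRegularRing_frakR (hK : IsPositiveDefiniteInvolution K) (D : ApproxSeq X) (n : ℕ) :
    IsStarRegularRing (frakR T K D n) :=
  isStarRegularRing_pi fun _ => isStarRegularRing_matrix hK _

/-- An element comes from some `𝔑ₙ`, where it has a relative inverse; the equations are carried to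
the limit by `toInf`. -/
theorem isStarRegularRing_frakRInf (hK : IsPositiveDefiniteInvolution K) (D : ApproxSeq X) :
    IsStarRegularRing (frakRInf T K D) := by
  refine isStarRegularRing_of_isRelInverse fun x => ?_
  obtain ⟨n, M, rfl⟩ := exists_toInf T K D x
  obtain ⟨N, hN⟩ := (isStarRegularRing_frakR T K hK D n).exists_isRelInverse M
  exact ⟨_, hN.map (toInf T K D n)⟩

theorem toInf_mem_regInf (hK : IsPositiveDefiniteInvolution K) (D : ApproxSeq X) (n : ℕ)
    {r : frakR T K D n} (hr : r ∈ regN T K D n) : toInf T K D n r ∈ regInf T K D := by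
  refine map_mem_starRegularClosure (isStarRegularRing_frakR T K hK D n)
    (isStarRegularRing_frakRInf T K hK D) (toInf T K D n) ?_ hr
  rintro _ ⟨a, rfl⟩
  exact subset_starRegularClosure _ ⟨⟨a, algA_le_algAInf T K D n a.2⟩, piInf_apply T K D _ a.2⟩

theorem jMap_mem_regN (hK : IsPositiveDefiniteInvolution K) (D : ApproxSeq X) {m n : ℕ} (h : m ≤ n)
    {r : frakR T K D m} (hr : r ∈ regN T K D m) : jMap T K D m n h r ∈ regN T K D n := by
  refine map_mem_starRegularClosure (isStarRegularRing_frakR T K hK D m)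
    (isStarRegularRing_frakR T K hK D n) (jMap T K D m n h) ?_ hr
  rintro _ ⟨a, rfl⟩
  exact subset_starRegularClosure _ ⟨⟨a, algA_mono T K D h a.2⟩, (jMap_piN T K D h a.2 _).symm⟩

theorem jSucc_mem_regN (hK : IsPositiveDefiniteInvolution K) (D : ApproxSeq X) (n : ℕ)
    {r : frakR T K D n} (hr : r ∈ regN T K D n) : jSucc T K D n r ∈ regN T K D (n + 1) := by
  refine map_mem_starRegularClosure (isStarRegularRing_frakR T K hK D n)
    (isStarRegularRing_frakR T K hK D (n + 1)) (jSucc T K D n) ?_ hr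
  rintro _ ⟨a, rfl⟩
  exact subset_starRegularClosure _
    ⟨⟨a, algA_le_succ T K D n a.2⟩, (jSucc_piN T K D a.2 _).symm⟩

/-- The `*`-regular closure in the limit is the union of the `*`-regular closures. -/
theorem iUnion_regN (hK : IsPositiveDefiniteInvolution K) (D : ApproxSeq X) :
    (⋃ n, toInf T K D n '' (regN T K D n : Set (frakR T K D n))) =
      (regInf T K D : Set (frakRInf T K D)) := by
  have hmono : Monotone fun n => (regN T K D n).map (toInf T K D n : _ →+* frakRInf T K D) := by
    rintro m n h _ ⟨r, hr, rfl⟩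
    exact ⟨jMap T K D m n h r, jMap_mem_regN T K hK D h hr, toInf_jMap T K D h r⟩
  have hmem : ∀ x, x ∈ ⨆ n, (regN T K D n).map (toInf T K D n : _ →+* frakRInf T K D) ↔
      ∃ n, ∃ r ∈ regN T K D n, toInf T K D n r = x := by
    intro x
    rw [Subring.mem_iSup_of_directed hmono.directed_le]
    exact Iff.rfl
  -- The supremum of the chain is its union, so the adjoint and a quasi-inverse of an element can be
  -- found at the stage where the element lives.
  have hreg : IsStarRegularSubring
      (⨆ n, (regN T K D n).map (toInf T K D n : _ →+* frakRInf T K D)) := by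
    refine ⟨fun x hx => ?_, fun x hx => ?_,
      fun x _ => (isStarRegularRing_frakRInf T K hK D).2 x⟩
    · obtain ⟨n, r, hr, rfl⟩ := (hmem x).1 hx
      exact (hmem _).2 ⟨n, star r, (isStarRegularSubring_starRegularClosure
        (isStarRegularRing_frakR T K hK D n) _).1 r hr, map_star _ _⟩
    · obtain ⟨n, r, hr, rfl⟩ := (hmem x).1 hx
      obtain ⟨s, hs, h⟩ := (isStarRegularSubring_starRegularClosure
        (isStarRegularRing_frakR T K hK D n) _).2.1 r hr
      exact ⟨_, (hmem _).2 ⟨n, s, hs, rfl⟩, by rw [← map_mul, ← map_mul, h]⟩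
  refine Set.Subset.antisymm ?_ fun x hx => ?_
  · refine Set.iUnion_subset fun n => ?_
    rintro _ ⟨r, hr, rfl⟩
    exact toInf_mem_regInf T K hK D n hr
  · have hle := starRegularClosure_le (S := Set.range (piInf T K D)) ?_ hreg
    · obtain ⟨n, r, hr, h⟩ := (hmem x).1 (hle hx)
      exact Set.mem_iUnion.2 ⟨n, r, hr, h⟩
    · rintro _ ⟨a, rfl⟩
      obtain ⟨n, hn⟩ := (mem_algAInf T K).1 a.2
      exact (hmem _).2 ⟨n, _, subset_starRegularClosure _ ⟨⟨a, hn⟩, rfl⟩,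
        (piInf_apply T K D a hn).symm⟩

/-! ### Relative inversion in the rank metric, and regularity of the completion -/

variable [MeasurableSpace X]

theorem rkR_add_le (D : ApproxSeq X) (μ : Measure X) (x y : rankRing T K D μ) :
    rkR T K D μ (x + y) ≤ rkR T K D μ x + rkR T K D μ y := rkInf_add_le T K D μ x y

theorem rkR_mul_le_left (D : ApproxSeq X) (μ : Measure X) (x y : rankRing T K D μ) :
    rkR T K D μ (x * y) ≤ rkR T K D μ x := rkInf_mul_le_left T K D μ x y

theorem rkR_mul_le_right (D : ApproxSeq X) (μ : Measure X) (x y : rankRing T K D μ) :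
    rkR T K D μ (x * y) ≤ rkR T K D μ y := rkInf_mul_le_right T K D μ x y

/-- Relative inversion is Lipschitz for the rank distance. -/
theorem IsRelInverse.edist_le {D : ApproxSeq X} {μ : Measure X} {a b a' b' : rankRing T K D μ}
    (ha : IsRelInverse a a') (hb : IsRelInverse b b') : edist b' a' ≤ 3 * edist b a := by
  have hs : rkR T K D μ (star (b - a)) ≤ rkR T K D μ (b - a) := rkInf_star_le T K D μ _
  rw [edist_def, edist_def, ha.sub_eq hb]
  refine (rkR_add_le T K D μ _ _).trans ?_
  -- The constant is the number of terms in `IsRelInverse.sub_eq`. Each is a product with a factor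
  -- `b - a` or `star (b - a)`, and neither multiplication nor the involution increases the rank.
  rw [show (3 : ℝ≥0∞) * rkR T K D μ (b - a) = rkR T K D μ (b - a) + rkR T K D μ (b - a) +
    rkR T K D μ (b - a) by ring]
  refine add_le_add ((rkR_add_le T K D μ _ _).trans (add_le_add ?_ ?_)) ?_
  · rw [← neg_mul]
    refine (rkR_mul_le_left T K D μ _ _).trans ?_
    rw [← neg_mul]
    exact rkR_mul_le_right T K D μ _ _
  · exact (rkR_mul_le_left T K D μ _ _).trans ((rkR_mul_le_right T K D μ _ _).trans hs)
  · refine (rkR_mul_le_left T K D μ _ _).trans ((rkR_mul_le_left T K D μ _ _).trans ?_)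
    exact (rkR_mul_le_right T K D μ _ _).trans hs

theorem continuous_star_frakRrk (D : ApproxSeq X) (μ : Measure X) :
    Continuous (star : frakRrk T K D μ → frakRrk T K D μ) :=
  UniformSpace.Completion.continuous_map

/-- Relative inversion on `𝔑_∞` is Lipschitz and so extends continuously to the completion. The four
defining equations are closed conditions that hold on the dense image of `𝔑_∞`. -/
theorem isStarRegularRing_frakRrk (hK : IsPositiveDefiniteInvolution K) (D : ApproxSeq X)
    (μ : Measure X) : IsStarRegularRing (frakRrk T K D μ) := by
  have hR : IsStarRegularRing (rankRing T K D μ) := isStarRegularRing_frakRInf T K hK D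
  choose g hg using fun x : rankRing T K D μ => hR.exists_isRelInverse x
  have hgu : UniformContinuous g := by
    have : LipschitzWith 3 g := fun b a => (hg a).edist_le T K (hg b)
    exact this.uniformContinuous
  have hgc : Continuous (UniformSpace.Completion.map g) := UniformSpace.Completion.continuous_map
  have hst := continuous_star_frakRrk T K D μ
  have hcoe : ∀ x : rankRing T K D μ, star (x : frakRrk T K D μ) = ((star x : rankRing T K D μ) :
      frakRrk T K D μ) := fun x => UniformSpace.Completion.map_coe (uniformContinuous_star T K D μ) x
  refine isStarRegularRing_of_isRelInverse fun x => ⟨UniformSpace.Completion.map g x, ?_⟩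
  induction x using UniformSpace.Completion.induction_on with
  | hp =>
    refine IsClosed.inter (isClosed_eq ?_ ?_) (IsClosed.inter (isClosed_eq ?_ ?_)
      (IsClosed.inter (isClosed_eq ?_ ?_) (isClosed_eq ?_ ?_))) <;> fun_prop
  | ih a =>
    rw [UniformSpace.Completion.map_coe hgu]
    obtain ⟨h1, h2, h3, h4⟩ := hg a
    refine ⟨?_, ?_, ?_, ?_⟩ <;>
      simp only [← UniformSpace.Completion.coe_mul, hcoe, h1, h2, h3, h4]

end Approximation

/-! ### Towers, ergodicity and the measure of the sets `Eₙ` -/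

section Dynamics

variable {X : Type*} [TopologicalSpace X] {T : X ≃ₜ X}

theorem zpow_natCast_apply (T : X ≃ₜ X) (n : ℕ) (x : X) :
    (T ^ (n : ℤ) : X ≃ₜ X) x = T^[n] x := by
  induction n generalizing x with
  | zero => simp
  | succ n ih =>
    rw [Function.iterate_succ_apply, ← ih, Nat.cast_succ, zpow_add, zpow_one,
      Homeomorph.mul_apply]

theorem zpow_one_apply (T : X ≃ₜ X) (x : X) : (T ^ (1 : ℤ) : X ≃ₜ X) x = T x := by
  rw [zpow_one]

/-- A point whose orbit visits `E` in the past and in the future lies on a level of a tower. -/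
theorem Tower.exists_level {C : ClopenPair X} {x : X} {m k : ℕ}
    (hm : (T ^ (-(m : ℤ)) : X ≃ₜ X) x ∈ C.E) (hk : 1 ≤ k) (hxk : (T ^ (k : ℤ) : X ≃ₜ X) x ∈ C.E) :
    ∃ (W : Tower T C) (i : Fin W.len), (T ^ (-((i : ℕ) : ℤ)) : X ≃ₜ X) x ∈ W.base := by
  classical
  -- `Nat.find hex` is the time elapsed since the last visit to `E`. The tower over that visit is
  -- longer than this time; otherwise its return to `E` would be a more recent visit.
  have hex : ∃ m : ℕ, (T ^ (-(m : ℤ)) : X ≃ₜ X) x ∈ C.E := ⟨m, hm⟩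
  obtain ⟨W, hW, -⟩ := Tower.exists_of_return (C := C) (k := Nat.find hex + k)
    (Nat.find_spec hex) (by omega) (by
      rw [zpow_zpow_apply]
      convert! hxk using 3
      push_cast
      ring)
  refine ⟨W, ⟨Nat.find hex, ?_⟩, hW⟩
  by_contra hcon
  have h1 := W.one_le_len
  refine Nat.find_min hex (m := Nat.find hex - W.len) (by omega) ?_
  have h := W.zpow_len_mem_E hW
  rw [zpow_zpow_apply] at h
  convert! h using 3
  omega

/-- The bases are pairwise disjoint nonempty open sets. Countability is needed for the additivity of
`μ` over the levels of all towers. -/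
theorem countable_tower (T : X ≃ₜ X) (C : ClopenPair X) [TopologicalSpace.SeparableSpace X] :
    Countable (Tower T C) := by
  refine Pairwise.countable_of_isOpen_disjoint (s := fun W : Tower T C => W.base) ?_
    (fun W => W.isClopen_base.isOpen) (fun W => W.nonempty)
  intro W V hne
  exact Set.disjoint_left.2 fun x hx hx' => hne (W.eq_of_mem V hx hx')

theorem ApproxSeq.E_antitone (D : ApproxSeq X) : Antitone fun n => (D.pair n).E :=
  antitone_nat_of_succ_le fun n => (D.refines n).subset_E

theorem ApproxSeq.exists_notMem_E (D : ApproxSeq X) {x : X} (hx : x ≠ D.y) :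
    ∃ n, ∀ m, n ≤ m → x ∉ (D.pair m).E := by
  have : x ∉ ⋂ n, (D.pair n).E := by rwa [D.iInter_E]
  rw [Set.mem_iInter, not_forall] at this
  obtain ⟨n, hn⟩ := this
  exact ⟨n, fun m hm h => hn (D.E_antitone hm h)⟩

variable [MeasurableSpace X] {μ : Measure X}

theorem Tower.measure_base_pos [μ.IsOpenPosMeasure] {C : ClopenPair X} (W : Tower T C) : 0 < μ W.base :=
  W.isClopen_base.isOpen.measure_pos μ W.nonempty

variable [BorelSpace X]

/-- Since `T` is a measurable equivalence, no measurability of `Y` is required. Negative powers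
follow by pulling back once more by the opposite power. -/
theorem measure_zpow_preimage (hμ : Ergodic T μ) (j : ℤ) (Y : Set X) :
    μ ((T ^ j : X ≃ₜ X) ⁻¹' Y) = μ Y := by
  have hnat : ∀ (n : ℕ) (Y : Set X), μ ((T ^ (n : ℤ) : X ≃ₜ X) ⁻¹' Y) = μ Y := by
    intro n Y
    have : ⇑(T ^ (n : ℤ) : X ≃ₜ X) = T^[n] := funext (zpow_natCast_apply T n)
    have hT : MeasurePreserving (T.toMeasurableEquiv)  μ μ := hμ.toMeasurePreserving
    rw [this]
    induction n with
    | zero => rfl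
    | succ n ih =>
      rw [Function.iterate_succ, Set.preimage_comp]
      exact (hT.measure_preimage_equiv _).trans (ih (funext (zpow_natCast_apply T n)))
  obtain ⟨n, rfl | rfl⟩ := j.eq_nat_or_neg
  · exact hnat n Y
  · rw [← hnat n]
    congr 1
    ext x
    simp only [Set.mem_preimage, zpow_zpow_apply]
    simp

variable [IsProbabilityMeasure μ] [μ.IsOpenPosMeasure]

/-- Almost every point lies on a level of a tower. -/
theorem ae_exists_level (hμ : Ergodic T μ) (C : ClopenPair X) :
    ∀ᵐ x ∂μ, ∃ (W : Tower T C) (i : Fin W.len), (T ^ (-((i : ℕ) : ℤ)) : X ≃ₜ X) x ∈ W.base := by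
  have hpos : μ C.E ≠ 0 := (C.isClopen_E.isOpen.measure_pos μ C.nonempty_E).ne'
  -- In the ergodic dichotomy the null alternative is excluded as soon as `U` contains `E`, which is
  -- open and nonempty and therefore has positive measure.
  have full : ∀ U : Set X, C.E ⊆ U → (U =ᵐ[μ] (∅ : Set X) ∨ U =ᵐ[μ] Set.univ) →
      ∀ᵐ x ∂μ, x ∈ U := by
    intro U hU h
    rcases h with h | h
    · exact absurd (measure_mono_null hU (ae_eq_empty.1 h)) hpos
    · exact eventuallyEq_univ.1 h
  have hmeas : ∀ j : ℤ, MeasurableSet ((T ^ j : X ≃ₜ X) ⁻¹' C.E) := fun j =>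
    (C.isClopen_E.preimage (Homeomorph.continuous _)).isOpen.measurableSet
  -- The points with a visit at some time `-m` form a set `U` with `U ⊆ T⁻¹(U)`. For visits at times
  -- `m ≥ 0`, below, the inclusion is reversed.
  have h1 : ∀ᵐ x ∂μ, x ∈ ⋃ m : ℕ, (T ^ (-(m : ℤ)) : X ≃ₜ X) ⁻¹' C.E := by
    refine full _ (Set.subset_iUnion_of_subset 0 fun x hx => by simpa using hx) ?_
    refine hμ.ae_empty_or_univ_of_ae_le_preimage
      (MeasurableSet.iUnion fun m => hmeas _).nullMeasurableSet (Eventually.of_forall ?_)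
    intro x hx
    obtain ⟨m, hm⟩ := Set.mem_iUnion.1 hx
    refine Set.mem_iUnion.2 ⟨m + 1, ?_⟩
    change (T ^ (-((m + 1 : ℕ) : ℤ)) : X ≃ₜ X) (T x) ∈ C.E
    change (T ^ (-(m : ℤ)) : X ≃ₜ X) x ∈ C.E at hm
    rw [← zpow_one_apply T x, zpow_zpow_apply]
    convert! hm using 3
    push_cast
    ring
  have h2 : ∀ᵐ x ∂μ, x ∈ ⋃ m : ℕ, (T ^ (m : ℤ) : X ≃ₜ X) ⁻¹' C.E := by
    refine full _ (Set.subset_iUnion_of_subset 0 fun x hx => by simpa using hx) ?_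
    refine hμ.ae_empty_or_univ_of_preimage_ae_le
      (MeasurableSet.iUnion fun m => hmeas _).nullMeasurableSet (Eventually.of_forall ?_)
    intro x hx
    obtain ⟨m, hm⟩ := Set.mem_iUnion.1 hx
    refine Set.mem_iUnion.2 ⟨m + 1, ?_⟩
    change (T ^ ((m + 1 : ℕ) : ℤ) : X ≃ₜ X) x ∈ C.E
    change (T ^ (m : ℤ) : X ≃ₜ X) (T x) ∈ C.E at hm
    rw [← zpow_one_apply T x, zpow_zpow_apply] at hm
    exact_mod_cast hm
  -- Applying the statement on future visits to `T x` instead of `x` makes the visiting time at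
  -- least `1`, as towers require.
  have h3 := hμ.toMeasurePreserving.quasiMeasurePreserving.ae h2
  filter_upwards [h1, h3] with x hx1 hx2
  obtain ⟨m, hm⟩ := Set.mem_iUnion.1 hx1
  obtain ⟨k, hk⟩ := Set.mem_iUnion.1 hx2
  change (T ^ (k : ℤ) : X ≃ₜ X) (T x) ∈ C.E at hk
  rw [← zpow_one_apply T x, zpow_zpow_apply] at hk
  exact Tower.exists_level hm (k := k + 1) (by omega) (by exact_mod_cast hk)

/-- An atom is recurrent by Poincaré, hence a periodic point. Its finite orbit is invariant and not
null, so it has full measure by ergodicity. The complement is then open and null, hence empty,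
contradicting that `X` is infinite. -/
theorem measure_singleton_eq_zero [T1Space X] [Infinite X] (hμ : Ergodic T μ) (y : X) :
    μ {y} = 0 := by
  by_contra hy
  obtain ⟨x, hx, m, hm0, hm⟩ := hμ.toMeasurePreserving.exists_mem_iterate_mem
    (measurableSet_singleton y).nullMeasurableSet hy
  rw [Set.mem_singleton_iff] at hx hm
  subst hx
  have hfin : Set.Finite ((fun k => T^[k] x) '' (Set.Iio m)) := (Set.finite_Iio m).image _
  set F := (fun k => T^[k] x) '' (Set.Iio m) with hF
  have hxF : x ∈ F := ⟨0, Nat.pos_of_ne_zero hm0, rfl⟩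
  have hinv : F ⊆ T ⁻¹' F := by
    rintro _ ⟨k, hk, rfl⟩
    change T (T^[k] x) ∈ F
    rw [← Function.iterate_succ_apply' T k x]
    rcases (Nat.succ_le_of_lt hk).eq_or_lt with h | h
    · rw [h, hm]; exact hxF
    · exact ⟨k + 1, h, rfl⟩
  rcases hμ.ae_empty_or_univ_of_ae_le_preimage hfin.isClosed.measurableSet.nullMeasurableSet
    (Eventually.of_forall hinv) with h | h
  · exact hy (measure_mono_null (Set.singleton_subset_iff.2 hxF) (ae_eq_empty.1 h))
  · have h0 : μ Fᶜ = 0 := ae_eq_univ.1 h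
    have h1 : Fᶜ = ∅ := hfin.isClosed.isOpen_compl.measure_eq_zero_iff μ |>.1 h0
    rw [Set.compl_empty_iff] at h1
    exact Set.infinite_univ (h1 ▸ hfin)

/-- Continuity from above: the sets decrease to `{y}`, which is null. -/
theorem ApproxSeq.tendsto_measure_E [T1Space X] [Infinite X] (hμ : Ergodic T μ) (D : ApproxSeq X) :
    Tendsto (fun n => μ (D.pair n).E) atTop (𝓝 0) := by
  rw [← measure_singleton_eq_zero hμ D.y, ← D.iInter_E]
  exact tendsto_measure_iInter_atTop
    (fun n => (D.pair n).isClopen_E.isOpen.measurableSet.nullMeasurableSet) D.E_antitone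
    ⟨0, measure_ne_top _ _⟩

/-- Almost every point lies outside of the orbit of `y`. -/
theorem ae_forall_zpow_ne [T1Space X] [Infinite X] (hμ : Ergodic T μ) (y : X) :
    ∀ᵐ x ∂μ, ∀ j : ℤ, (T ^ j : X ≃ₜ X) x ≠ y := by
  rw [ae_all_iff]
  intro j
  have h : μ ((T ^ j : X ≃ₜ X) ⁻¹' {y}) = 0 :=
    (measure_zpow_preimage hμ j _).trans (measure_singleton_eq_zero hμ y)
  exact measure_eq_zero_iff_ae_notMem.1 h

end Dynamics

/-! ### Monomials, and characteristic functions in `𝒜ₙ` and `𝒜_∞` -/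

section CharacteristicFunctions

variable {X : Type*} [TopologicalSpace X] {T : X ≃ₜ X} {K : Type*} [Field K]

theorem coef_zero (n : ℤ) (x : X) : coef (0 : CrossedProduct T K) n x = 0 := by
  simpa using coef_algebraMap (T := T) (0 : K) n x

theorem coef_monom_mul (f : Coeff T K) (m : ℤ) (b : CrossedProduct T K) (n : ℤ) (x : X) :
    coef (monom f m * b) n x = f x * coef b (n - m) ((T ^ (-m) : X ≃ₜ X) x) := by
  rw [coef_mul, finsum_eq_single _ m, coef_monom, if_pos rfl]
  intro k hk
  rw [coef_monom, if_neg (Ne.symm hk), zero_mul]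

theorem monom_mul_monom (f g : Coeff T K) (m n : ℤ) :
    monom f m * monom g n = monom (f * (Multiplicative.ofAdd m • g)) (m + n) := by
  refine ext_coef fun k x => ?_
  rw [coef_monom_mul, coef_monom, coef_monom]
  by_cases h : m + n = k
  · rw [if_pos h, if_pos (by omega)]; rfl
  · rw [if_neg h, if_neg (by omega), mul_zero]

theorem chi_mul_chi {Y Z : Set X} (hY : IsClopen Y) (hZ : IsClopen Z) :
    chi T K Y hY * chi T K Z hZ = chi T K (Y ∩ Z) (hY.inter hZ) := by
  classical
  ext x
  simp only [Coeff.mul_apply, chi_apply, Set.mem_inter_iff]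
  by_cases h1 : x ∈ Y <;> by_cases h2 : x ∈ Z <;> simp [h1, h2]

theorem smul_chi (n : ℤ) {Y : Set X} (hY : IsClopen Y) :
    Multiplicative.ofAdd n • chi T K Y hY =
      chi T K ((T ^ (-n) : X ≃ₜ X) ⁻¹' Y) (hY.preimage (Homeomorph.continuous _)) := by
  classical
  ext x
  rw [Coeff.zsmul_apply, chi_apply, chi_apply]
  rfl

theorem monom_zero_one : (monom 1 0 : CrossedProduct T K) = 1 := rfl

theorem chi_congr {Y Z : Set X} (hY : IsClopen Y) (hZ : IsClopen Z) (h : Y = Z) :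
    chi T K Y hY = chi T K Z hZ := by subst h; rfl

theorem chi_univ : chi T K Set.univ isClopen_univ = 1 := by
  classical
  ext x
  simp [chi_apply]

theorem chi_compl {Y : Set X} (hY : IsClopen Y) : chi T K Yᶜ hY.compl = 1 - chi T K Y hY := by
  classical
  rw [eq_sub_iff_add_eq]
  ext x
  rw [Coeff.add_apply, chi_apply, chi_apply, Coeff.one_apply]
  by_cases h : x ∈ Y <;> simp [h]

theorem monom_sub (f g : Coeff T K) (n : ℤ) : monom (f - g) n = monom f n - monom g n :=
  map_sub (SkewMonoidAlgebra.singleAddHom (Multiplicative.ofAdd n)) f g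

theorem Coeff.isClopen_fiber {K : Type*} (f : Coeff T K) (c : K) : IsClopen (f ⁻¹' {c}) :=
  IsLocallyConstant.isClopen_fiber (LocallyConstant.isLocallyConstant (Y := K) f) c

theorem monom_smul (c : K) (f : Coeff T K) (n : ℤ) : monom (c • f) n = c • monom f n := by
  refine ext_coef fun k x => ?_
  rw [coef_smul, coef_monom, coef_monom]
  split_ifs <;> simp

open Classical in
theorem entry_chi {Z : Set X} (hZ : IsClopen Z) (w : X) (i j : ℤ) :
    entry w i j (monom (chi T K Z hZ) 0) =
      if i = j ∧ (T ^ i : X ≃ₜ X) w ∈ Z then 1 else 0 := by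
  unfold entry
  rw [coef_monom, chi_apply]
  by_cases h : i = j
  · simp [h]
  · rw [if_neg (by omega), if_neg (fun h' => h h'.1)]

/-- By compactness a locally constant function has only finitely many values. -/
theorem coeff_eq_sum_chi [CompactSpace X] (f : Coeff T K) : ∃ (s : Finset K),
    f = ∑ c ∈ s, c • chi T K (f ⁻¹' {c}) (f.isClopen_fiber c) := by
  classical
  have hfin : (Set.range f).Finite := LocallyConstant.range_finite (Y := K) f
  refine ⟨hfin.toFinset, ?_⟩
  ext x
  have happ : ∀ (s : Finset K) (F : K → Coeff T K), (∑ i ∈ s, F i) x = ∑ i ∈ s, F i x := by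
    intro s F
    induction s using Finset.cons_induction with
    | empty => rfl
    | cons i s hi ih => rw [Finset.sum_cons, Finset.sum_cons, Coeff.add_apply, ih]
  rw [happ, Finset.sum_eq_single (f x)]
  · rw [Coeff.smul_apply, chi_apply, if_pos (show x ∈ f ⁻¹' {f x} from rfl), mul_one]
  · intro c _ hc
    rw [Coeff.smul_apply, chi_apply, if_neg (show x ∉ f ⁻¹' {c} from fun h => hc (Eq.symm h)), mul_zero]
  · intro h
    exact absurd (hfin.mem_toFinset.2 ⟨x, rfl⟩) h

/-- An element of the crossed product whose coefficients vanish almost everywhere is zero. -/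
theorem eq_zero_of_ae_coef [MeasurableSpace X] {μ : Measure X} [μ.IsOpenPosMeasure]
    (a : CrossedProduct T K) (h : ∀ᵐ x ∂μ, ∀ n, coef a n x = 0) :
    a = 0 := by
  refine ext_coef fun n x => ?_
  rw [coef_zero]
  by_contra hx
  -- The fibre of the locally constant coefficient over a nonzero value would be a nonempty open
  -- set, so it would meet the dense set on which the coefficients vanish.
  have hopen : IsOpen ((a.coeff (Multiplicative.ofAdd n)) ⁻¹' {coef a n x}) :=
    (Coeff.isClopen_fiber _ _).isOpen
  obtain ⟨z, hz, hz'⟩ := (Measure.dense_of_ae h).exists_mem_open hopen ⟨x, rfl⟩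
  refine hx ?_
  rw [← hz n]
  exact Eq.symm hz'

variable [StarRing K]

theorem star_monom (f : Coeff T K) (n : ℤ) :
    star (monom f n) = monom (Multiplicative.ofAdd (-n) • star f) (-n) := by
  refine ext_coef fun k x => ?_
  rw [coef_star, coef_monom, coef_monom]
  by_cases h : -n = k
  · subst h
    rw [neg_neg, if_pos rfl, if_pos rfl, Coeff.zsmul_apply, toAdd_ofAdd, neg_neg, Coeff.star_apply]
  · rw [if_neg h, if_neg (by omega), star_zero]

theorem star_chi {Y : Set X} (hY : IsClopen Y) : star (chi T K Y hY) = chi T K Y hY := by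
  classical
  ext x
  rw [Coeff.star_apply, chi_apply]
  split_ifs <;> simp

/-- The characteristic function of `Y` exists and lies in `S`. -/
def HasChi (S : StarSubalgebra K (CrossedProduct T K)) (Y : Set X) : Prop :=
  ∃ h : IsClopen Y, monom (chi T K Y h) 0 ∈ S

namespace HasChi

variable {S S' : StarSubalgebra K (CrossedProduct T K)} {Y Z : Set X}

theorem mono (h : S ≤ S') (hY : HasChi S Y) : HasChi S' Y := ⟨hY.1, h hY.2⟩

theorem mem (hY : HasChi S Y) (h : IsClopen Y) : monom (chi T K Y h) 0 ∈ S := hY.2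

protected theorem univ : HasChi S Set.univ := by
  refine ⟨isClopen_univ, ?_⟩
  rw [chi_univ, monom_zero_one]
  exact one_mem S

protected theorem compl (hY : HasChi S Y) : HasChi S Yᶜ := by
  refine ⟨hY.1.compl, ?_⟩
  rw [chi_compl hY.1, monom_sub, monom_zero_one]
  exact sub_mem (one_mem S) hY.2

theorem inter (hY : HasChi S Y) (hZ : HasChi S Z) : HasChi S (Y ∩ Z) := by
  refine ⟨hY.1.inter hZ.1, ?_⟩
  have := mul_mem hY.2 hZ.2
  rwa [monom_mul_monom, ofAdd_zero, one_smul, chi_mul_chi, zero_add] at this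

theorem union (hY : HasChi S Y) (hZ : HasChi S Z) : HasChi S (Y ∪ Z) := by
  have := (hY.compl.inter hZ.compl).compl
  rwa [← Set.compl_union, compl_compl] at this

protected theorem empty : HasChi S ∅ := by
  have := (HasChi.univ (S := S)).compl
  rwa [Set.compl_univ] at this

end HasChi

variable {C : ClopenPair X}

theorem monom_chi_one_mul_star {Y : Set X} (hY : IsClopen Y) :
    monom (chi T K Y hY) 1 * star (monom (chi T K Y hY) 1) = monom (chi T K Y hY) 0 := by
  rw [star_monom, monom_mul_monom, star_chi, ← mul_smul, ← ofAdd_add]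
  simp only [add_neg_cancel, ofAdd_zero, one_smul]
  rw [chi_mul_chi, chi_congr _ hY (Set.inter_self Y)]

theorem star_mul_monom_chi_one {Y : Set X} (hY : IsClopen Y) :
    star (monom (chi T K Y hY) 1) * monom (chi T K Y hY) 1 =
      monom (chi T K ((T ^ (1 : ℤ) : X ≃ₜ X) ⁻¹' Y) (hY.preimage (Homeomorph.continuous _))) 0 := by
  rw [star_monom, monom_mul_monom, star_chi, smul_chi, chi_mul_chi]
  simp only [neg_add_cancel]
  congr 1
  exact chi_congr _ _ (by simp)

/-- `χ_Z` is the final projection of the generator `χ_Z t`. -/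
theorem hasChi_of_mem_P {Z : Set X} (hZ : Z ∈ C.P) : HasChi (approxAlgebra T C K) Z := by
  refine ⟨C.isClopen_P Z hZ, ?_⟩
  have h : monom (chi T K Z (C.isClopen_P Z hZ)) 1 ∈ approxAlgebra T C K :=
    StarAlgebra.subset_adjoin _ _ ⟨Z, hZ, rfl⟩
  rw [← monom_chi_one_mul_star]
  exact mul_mem h (star_mem h)

theorem hasChi_E : HasChi (approxAlgebra T C K) C.E := by
  have h : HasChi (approxAlgebra T C K) C.Eᶜ := by
    refine ⟨C.isClopen_E.compl, ?_⟩
    rw [← monom_chi_one_mul_star]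
    exact mul_mem shiftElt_mem (star_mem shiftElt_mem)
  have := h.compl
  rwa [compl_compl] at this

/-- `χ_{T⁻¹(Y)}` is the initial projection of `χ_Y t`. The assumption `Y ⊆ X ∖ E` puts this element
into the algebra, since then `χ_Y t = χ_Y (χ_{X∖E} t)`. -/
theorem hasChi_preimage_of_subset {Y : Set X} (hY : HasChi (approxAlgebra T C K) Y)
    (hYE : Y ⊆ C.Eᶜ) : HasChi (approxAlgebra T C K) ((T ^ (1 : ℤ) : X ≃ₜ X) ⁻¹' Y) := by
  refine ⟨hY.1.preimage (Homeomorph.continuous _), ?_⟩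
  have h := mul_mem hY.2 (shiftElt_mem (T := T) (C := C) (K := K))
  rw [shiftElt, monom_mul_monom, ofAdd_zero, one_smul, chi_mul_chi, zero_add,
    chi_congr (hY.1.inter C.isClopen_E.compl) hY.1 (Set.inter_eq_left.2 hYE)] at h
  rw [← star_mul_monom_chi_one hY.1]
  exact mul_mem (star_mem h) h

/-- The set `E` itself is not covered by `hasChi_preimage_of_subset`, but its complement is. -/
theorem hasChi_preimage_E :
    HasChi (approxAlgebra T C K) ((T ^ (1 : ℤ) : X ≃ₜ X) ⁻¹' C.E) := by
  have := (hasChi_preimage_of_subset (T := T) (K := K) (hasChi_E (C := C)).compl subset_rfl).compl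
  rwa [← Set.preimage_compl, compl_compl] at this

/-- The characteristic functions of the bases of the towers lie in `𝒜(E, 𝒫)`. -/
theorem Tower.hasChi_base (W : Tower T C) : HasChi (approxAlgebra T C K) W.base := by
  obtain ⟨Z, hZ, h⟩ := W.exists_eq
  have h1 := W.one_le_len
  -- Write the base as `E ∩ T⁻¹(Z₁ ∩ T⁻¹(Z₂ ∩ ⋯ ∩ T⁻¹(E)))` and work from the inside outwards, with
  -- `d = |W| - j` counting the layers already built. Every set pulled back lies in some `Z_j` and
  -- so misses `E`, except for the innermost one, which is `E`.
  have key : ∀ d j : ℕ, 1 ≤ j → j + d = W.len → HasChi (approxAlgebra T C K)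
      ((T ^ (1 : ℤ) : X ≃ₜ X) ⁻¹' {x | (∀ i : ℕ, j ≤ i → i < W.len →
        (T ^ ((i : ℤ) - j) : X ≃ₜ X) x ∈ Z i) ∧ (T ^ (d : ℤ) : X ≃ₜ X) x ∈ C.E}) := by
    intro d
    induction d with
    | zero =>
      intro j hj hjd
      convert! hasChi_preimage_E (T := T) (C := C) (K := K) using 3
      ext x
      refine ⟨fun hx => by simpa using hx.2, fun hx => ⟨fun i h1 h2 => by omega, by simpa using hx⟩⟩
    | succ d ih =>
      intro j hj hjd
      have hZj := hZ j hj (by omega)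
      refine hasChi_preimage_of_subset ?_ ?_
      · convert! (hasChi_of_mem_P (T := T) (K := K) hZj).inter (ih (j + 1) (by omega) (by omega))
          using 1
        ext x
        simp only [Set.mem_ofPred_eq, Set.mem_inter_iff, Set.mem_preimage, zpow_zpow_apply]
        constructor
        · rintro ⟨ha, hb⟩
          refine ⟨by simpa using ha j le_rfl (by omega), fun i h1 h2 => ?_, ?_⟩
          · have := ha i (by omega) h2
            rwa [show (i : ℤ) - ((j + 1 : ℕ) : ℤ) + 1 = i - j by push_cast; ring]
          · exact_mod_cast hb
        · rintro ⟨ha, hb, hc⟩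
          refine ⟨fun i h1 h2 => ?_, by exact_mod_cast hc⟩
          rcases h1.eq_or_lt with rfl | h1
          · simpa using ha
          · have := hb i h1 h2
            rwa [show (i : ℤ) - ((j + 1 : ℕ) : ℤ) + 1 = i - j by push_cast; ring] at this
      · intro x hx
        exact C.notMem_E hZj (by simpa using hx.1 j le_rfl (by omega))
  have := (hasChi_E (T := T) (C := C) (K := K)).inter (key (W.len - 1) 1 le_rfl (by omega))
  convert! this using 1
  rw [h]
  ext x
  simp only [Set.mem_ofPred_eq, Set.mem_inter_iff, Set.mem_preimage, zpow_zpow_apply]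
  rw [show ((W.len - 1 : ℕ) : ℤ) + 1 = W.len by omega]
  simp

/-- All characteristic functions of clopen sets lie in `𝒜_∞`. -/
theorem hasChi_algAInf [CompactSpace X] (D : ApproxSeq X) {Y : Set X} (hY : IsClopen Y) :
    HasChi (algAInf T K D) Y := by
  have hb := TopologicalSpace.isTopologicalBasis_of_subbasis D.generates
  -- Finite intersections of the generating sets form a basis. A clopen set is compact and open,
  -- hence a finite union of basic sets, and the sets whose characteristic functions lie in `𝒜_∞`
  -- are closed under both operations.
  have hbasis : ∀ U ∈ (fun f : Set (Set X) => ⋂₀ f) ''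
      {f | f.Finite ∧ f ⊆ ⋃ n, insert (D.pair n).E (D.pair n).P}, HasChi (algAInf T K D) U := by
    rintro _ ⟨f, ⟨hf, hsub⟩, rfl⟩
    induction f, hf using Set.Finite.induction_on with
    | empty => simpa using HasChi.univ
    | insert _ _ ih =>
      rw [Set.insert_subset_iff] at hsub
      simp only [Set.sInter_insert]
      refine HasChi.inter ?_ (ih hsub.2)
      obtain ⟨n, hn⟩ := Set.mem_iUnion.1 hsub.1
      refine HasChi.mono (algA_le_algAInf T K D n) ?_
      rcases hn with rfl | hn
      · exact hasChi_E
      · exact hasChi_of_mem_P hn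
  have hb' : TopologicalSpace.IsTopologicalBasis (Set.range (fun U : ((fun f : Set (Set X) =>
      ⋂₀ f) '' {f | f.Finite ∧ f ⊆ ⋃ n, insert (D.pair n).E (D.pair n).P}) => (U : Set X))) := by
    rwa [Subtype.range_coe]
  obtain ⟨s, hs, rfl⟩ := eq_finite_iUnion_of_isTopologicalBasis_of_isCompact_open _ hb' Y
    hY.isClosed.isCompact hY.isOpen
  induction s, hs using Set.Finite.induction_on with
  | empty => simpa using HasChi.empty
  | @insert U s _ _ ih =>
    rw [Set.biUnion_insert]
    refine HasChi.union (hbasis _ U.2) (ih ?_)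
    exact (‹s.Finite›.isClopen_biUnion fun V _ => (hbasis _ V.2).1)

/-- `C_K(X) ⊆ 𝒜_∞`. -/
theorem monom_zero_mem_algAInf [CompactSpace X] (D : ApproxSeq X) (f : Coeff T K) :
    monom f 0 ∈ algAInf T K D := by
  obtain ⟨s, hs⟩ := coeff_eq_sum_chi f
  rw [hs, monom_sum]
  refine sum_mem fun c _ => ?_
  rw [monom_smul]
  exact SMulMemClass.smul_mem c ((hasChi_algAInf D (f.isClopen_fiber c)).mem _)

end CharacteristicFunctions

/-! ### Injectivity of the representations and faithfulness of the rank -/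

section Injectivity

variable {X : Type*} [TopologicalSpace X] (T : X ≃ₜ X) (K : Type*) [Field K] [StarRing K]

theorem toInf_jSucc (D : ApproxSeq X) (n : ℕ) (M : frakR T K D n) :
    toInf T K D (n + 1) (jSucc T K D n M) = toInf T K D n M := by
  rw [← toInf_jMap T K D n.le_succ M]
  congr 1
  rw [jMap_succ T K D n n le_rfl, jMap_self]
  rfl

theorem piN_chi (D : ApproxSeq X) (n : ℕ) {Z : Set X} (hZ : IsClopen Z)
    (h : monom (chi T K Z hZ) 0 ∈ algA T K D n) (W : Tower T (D.pair n)) {w : X}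
    (hw : w ∈ W.base) [DecidablePred (· ∈ Z)] :
    piN T K D n ⟨monom (chi T K Z hZ) 0, h⟩ W =
      Matrix.diagonal fun i : Fin W.len => if (T ^ ((i : ℕ) : ℤ) : X ≃ₜ X) w ∈ Z then 1 else 0 := by
  ext i j
  refine (towerRep_apply _ W hw i j).trans ?_
  simp only [entry_chi, Nat.cast_inj, ← Fin.ext_iff, Matrix.diagonal_apply]
  by_cases hij : i = j
  · subst hij
    by_cases hz : (T ^ ((i : ℕ) : ℤ) : X ≃ₜ X) w ∈ Z <;> simp [hz, -zpow_natCast]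
  · simp [hij]

variable {T K} [MeasurableSpace X] [BorelSpace X] {μ : Measure X} [IsProbabilityMeasure μ]
  [μ.IsOpenPosMeasure]

/-- At a point `x` on level `i` of a tower `W`, the coefficient of `tⁿ` is the entry of `a` at `(i,
i - n)` along the orbit of the base point. Inside the block this is a matrix entry of the
representation; outside it vanishes because `a` is block diagonal. Almost every `x` is of this kind.
-/
theorem towerRep_injective (hμ : Ergodic T μ) (C : ClopenPair X) :
    Function.Injective (towerRep T C K) := by
  rw [injective_iff_map_eq_zero]
  intro a ha
  refine Subtype.ext (eq_zero_of_ae_coef (μ := μ) _ ?_)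
  filter_upwards [ae_exists_level hμ C] with x hx n
  obtain ⟨W, i, hw⟩ := hx
  have he : coef (a : CrossedProduct T K) n x =
      entry ((T ^ (-((i : ℕ) : ℤ)) : X ≃ₜ X) x) i (i - n) (a : CrossedProduct T K) := by
    unfold entry
    rw [zpow_zpow_apply, sub_sub_cancel]
    simp
  rw [he]
  have hi := i.2
  by_cases hj : 0 ≤ (i : ℤ) - n ∧ (i : ℤ) - n < W.len
  · obtain ⟨j, hj'⟩ := Int.eq_ofNat_of_zero_le hj.1
    have := towerRep_apply a W hw i ⟨j, by omega⟩
    rw [ha] at this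
    rw [hj']
    exact this.symm
  · exact approxAlgebra_le_blockAlgebra W hw a.2 _ _ fun h => hj (h.1 ⟨by omega, by omega⟩)

/-- Every tower of a pair is a block of a tower of a finer pair. -/
theorem Tower.exists_block (hμ : Ergodic T μ) {C C' : ClopenPair X} (hC : C'.Refines C)
    (W : Tower T C) : ∃ (W' : Tower T C') (b : Block C W'), b.tower = W := by
  -- The levels of the finer towers cover a dense set, so one of them meets the open set `W`. The
  -- block `b` containing level `i` must be a copy of `W` that starts there, because the levels of
  -- the coarser towers are disjoint.
  obtain ⟨x, ⟨W', i, hi⟩, hxW⟩ := (Measure.dense_of_ae (ae_exists_level hμ C')).exists_mem_open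
    W.isClopen_base.isOpen W.nonempty
  obtain ⟨b, p, hbp⟩ := Block.exists_eq hC i
  have h1 := b.mem_base hi
  have h2 := W.one_le_len
  have hp := p.2
  refine ⟨W', b, (b.tower.eq_of_level W h1 hxW (i := p) (j := 0) (by omega) (by omega) le_rfl
    (by omega) ?_).2.2⟩
  rw [zpow_zpow_apply, zpow_zpow_apply, show (p : ℤ) + b.start + -((i : ℕ) : ℤ) = 0 by omega]

/-- Each component `M_W` reappears as a diagonal block, since every tower `W` occurs as a block of
some finer tower. -/
theorem refineMap_injective (hμ : Ergodic T μ) {C C' : ClopenPair X} (hC : C'.Refines C) :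
    Function.Injective (refineMap (T := T) K hC) := by
  rw [injective_iff_map_eq_zero]
  intro M hM
  funext W
  obtain ⟨W', b, rfl⟩ := W.exists_block hμ hC
  ext p q
  rw [← refineMap_apply_same hC M W' b, hM]
  rfl

variable (T K)

theorem jMap_injective (hμ : Ergodic T μ) (D : ApproxSeq X) {m n : ℕ} (h : m ≤ n) :
    Function.Injective (jMap T K D m n h) := by
  induction n, h using Nat.le_induction with
  | base => rw [jMap_self]; exact fun _ _ h => h
  | succ n h ih =>
    rw [jMap_succ T K D m n h]
    exact (refineMap_injective hμ (D.refines n)).comp ih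

theorem toInf_injective (hμ : Ergodic T μ) (D : ApproxSeq X) (n : ℕ) :
    Function.Injective (toInf T K D n) :=
  DirectLimit.mk_injective (jMap T K D) (fun _ _ h => jMap_injective T K hμ D h) n

theorem piInf_injective (hμ : Ergodic T μ) (D : ApproxSeq X) :
    Function.Injective (piInf T K D) := by
  rw [injective_iff_map_eq_zero]
  intro a ha
  obtain ⟨n, hn⟩ := (mem_algAInf T K).1 a.2
  rw [piInf_apply T K D a hn] at ha
  have h1 := (map_eq_zero_iff _ (toInf_injective T K hμ D n)).1 ha
  have h2 := (map_eq_zero_iff _ (towerRep_injective hμ (D.pair n))).1 h1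
  exact Subtype.ext (Subtype.ext_iff.1 h2 :)

/-- The rank of the characteristic function of `Z` is the measure of `Z`. -/
theorem rkN_chi [TopologicalSpace.SeparableSpace X] (hμ : Ergodic T μ) (D : ApproxSeq X) (n : ℕ)
    {Z : Set X} (hZ : IsClopen Z) (h : monom (chi T K Z hZ) 0 ∈ algA T K D n) :
    rkN T K D μ n (piN T K D n ⟨monom (chi T K Z hZ) 0, h⟩) = μ Z := by
  classical
  have := countable_tower T (D.pair n)
  -- The levels `Tⁱ(W)` partition `X` up to a null set; `F` is the induced partition of `Z`.
  let F : (Σ W : Tower T (D.pair n), Fin W.len) → Set X := fun q =>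
    (T ^ (-((q.2 : ℕ) : ℤ)) : X ≃ₜ X) ⁻¹' q.1.base ∩ Z
  have hF : μ Z = μ (⋃ q, F q) := by
    refine measure_congr ?_
    filter_upwards [ae_exists_level hμ (D.pair n)] with x hx
    obtain ⟨W, i, hi⟩ := hx
    refine propext ⟨fun hxZ => Set.mem_iUnion.2 ⟨⟨W, i⟩, hi, hxZ⟩, fun hxU => ?_⟩
    obtain ⟨q, hq⟩ := Set.mem_iUnion.1 hxU
    exact hq.2
  have hdisj : Pairwise (Function.onFun Disjoint F) := by
    rintro ⟨W, i⟩ ⟨V, j⟩ hne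
    refine Set.disjoint_left.2 fun x hx hx' => hne ?_
    have hi := i.2
    have hj := j.2
    obtain ⟨h1, -, h3⟩ := W.eq_of_level V hx.1 hx'.1 (i := i) (j := j) (by omega) (by omega)
      (by omega) (by omega) (by
        rw [zpow_zpow_apply, zpow_zpow_apply]
        simp)
    subst h3
    obtain rfl : i = j := Fin.ext (by omega)
    rfl
  have hmeas : ∀ q, MeasurableSet (F q) := fun q =>
    ((q.1.isClopen_base.preimage (Homeomorph.continuous _)).inter hZ).isOpen.measurableSet
  rw [hF, measure_iUnion hdisj hmeas, ENNReal.tsum_sigma', rkN]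
  refine tsum_congr fun W => ?_
  obtain ⟨w, hw⟩ := W.nonempty
  -- The rank of a diagonal matrix counts its nonzero entries, so the two sides can be compared
  -- level by level.
  rw [piN_chi T K D n hZ h W hw, Matrix.rank_diagonal, tsum_fintype, Fintype.card_subtype,
    Finset.card_filter, Nat.cast_sum, Finset.mul_sum]
  refine Finset.sum_congr rfl fun i _ => ?_
  -- As `χ_Z ∈ 𝒜ₙ`, its matrix at `W` does not depend on the base point, so each level is contained
  -- in `Z` or disjoint from it.
  have hconst : ∀ x ∈ W.base, ((T ^ ((i : ℕ) : ℤ) : X ≃ₜ X) x ∈ Z ↔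
      (T ^ ((i : ℕ) : ℤ) : X ≃ₜ X) w ∈ Z) := by
    intro x hx
    have := congrFun (congrFun ((piN_chi T K D n hZ h W hx).symm.trans
      (piN_chi T K D n hZ h W hw)) i) i
    rw [Matrix.diagonal_apply_eq, Matrix.diagonal_apply_eq] at this
    by_cases h1 : (T ^ ((i : ℕ) : ℤ) : X ≃ₜ X) x ∈ Z <;>
      by_cases h2 : (T ^ ((i : ℕ) : ℤ) : X ≃ₜ X) w ∈ Z <;> simp [h1, h2, -zpow_natCast] at this ⊢
  have hx : ∀ x, (T ^ ((i : ℕ) : ℤ) : X ≃ₜ X) ((T ^ (-((i : ℕ) : ℤ)) : X ≃ₜ X) x) = x := by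
    intro x
    rw [zpow_zpow_apply]
    simp
  by_cases hwZ : (T ^ ((i : ℕ) : ℤ) : X ≃ₜ X) w ∈ Z
  · have : F ⟨W, i⟩ = (T ^ (-((i : ℕ) : ℤ)) : X ≃ₜ X) ⁻¹' W.base := by
      refine Set.inter_eq_left.2 fun x hxW => ?_
      have := (hconst _ hxW).2 hwZ
      rwa [hx] at this
    rw [this, measure_zpow_preimage hμ]
    simp [hwZ, -zpow_natCast]
  · have : F ⟨W, i⟩ = ∅ := by
      refine Set.eq_empty_of_forall_notMem fun x hxF => hwZ ?_
      refine (hconst _ hxF.1).1 ?_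
      rw [hx]
      exact hxF.2
    rw [this]
    simp [hwZ, -zpow_natCast]

/-- The element lies in `𝒜_l` for all large `l`, and every such `rk_l` equals `μ(Z)`; the upper
limit is that of an eventually constant sequence. -/
theorem rkInf_chi [TopologicalSpace.SeparableSpace X] (hμ : Ergodic T μ) (D : ApproxSeq X)
    {Z : Set X} (hZ : IsClopen Z) (h : monom (chi T K Z hZ) 0 ∈ algAInf T K D) :
    rkInf T K D μ (piInf T K D ⟨monom (chi T K Z hZ) 0, h⟩) = μ Z := by
  obtain ⟨n, hn⟩ := (mem_algAInf T K).1 h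
  rw [piInf_apply T K D _ hn, rkInf_toInf, limsup_congr (v := fun _ => μ Z), limsup_const]
  filter_upwards [eventually_ge_atTop n] with l hl
  rw [rkSeq, dif_pos hl, jMap_piN T K D hl hn (algA_mono T K D hl hn)]
  exact rkN_chi T K hμ D l hZ _

/-- A nonzero entry `(i, j)` of `M_W` can be moved to the corner: `e_{0i} M e_{j0}`, suitably
scaled, is the image of `χ_W`. Multiplication does not increase the rank, so the rank of `M` is at
least `μ(W)`. -/
theorem rkInf_pos [TopologicalSpace.SeparableSpace X] (hμ : Ergodic T μ) (D : ApproxSeq X)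
    {x : frakRInf T K D} (hx : x ≠ 0) : 0 < rkInf T K D μ x := by
  classical
  obtain ⟨n, M, rfl⟩ := exists_toInf T K D x
  have hM : M ≠ 0 := by
    rintro rfl
    exact hx (map_zero _)
  obtain ⟨W, hW⟩ := Function.ne_iff.1 hM
  have : ∃ i j, M W i j ≠ 0 := by
    by_contra! hcon
    exact hW (Matrix.ext hcon)
  obtain ⟨i, j, hij⟩ := this
  have h0 : 0 < W.len := W.one_le_len
  obtain ⟨hcl, hmem⟩ := W.hasChi_base (K := K)
  change _ ∈ algA T K D n at hmem
  -- The image of `χ_W` is the single matrix unit `e_{00}` in the component `W`, because among all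
  -- levels of all towers only level `0` of `W` meets `W`.
  have key : piN T K D n ⟨monom (chi T K W.base hcl) 0, hmem⟩ =
      (Pi.single W (Matrix.single ⟨0, h0⟩ i (M W i j)⁻¹) : frakR T K D n) * M *
        (Pi.single W (Matrix.single j ⟨0, h0⟩ 1) : frakR T K D n) := by
    funext V
    obtain ⟨v, hv⟩ := V.nonempty
    rw [piN_chi T K D n hcl hmem V hv]
    by_cases hVW : V = W
    · subst hVW
      have hz : ∀ k : Fin V.len, (T ^ ((k : ℕ) : ℤ) : X ≃ₜ X) v ∈ V.base ↔ k = ⟨0, h0⟩ := by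
        intro k
        constructor
        · intro hk
          by_contra hne
          have hk0 : (k : ℕ) ≠ 0 := fun h => hne (Fin.ext h)
          have hk2 := k.2
          exact V.zpow_notMem_E hv (i := (k : ℕ)) (by omega) (by omega) (V.mem_E hk)
        · rintro rfl
          simpa using hv
      have hr : (Pi.single V (Matrix.single ⟨0, h0⟩ i (M V i j)⁻¹) * M *
          Pi.single V (Matrix.single j ⟨0, h0⟩ 1) : frakR T K D n) V =
          Matrix.single ⟨0, h0⟩ ⟨0, h0⟩ 1 := by
        rw [Pi.mul_apply, Pi.mul_apply, Pi.single_eq_same, Pi.single_eq_same,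
          Matrix.single_mul_mul_single, inv_mul_cancel₀ hij, one_mul]
      rw [hr]
      ext k l
      simp only [Matrix.diagonal_apply, hz, Matrix.single_apply]
      by_cases h1 : k = l
      · subst h1
        by_cases h2 : k = ⟨0, h0⟩ <;> simp [h2, eq_comm]
      · rw [if_neg h1, if_neg]
        rintro ⟨rfl, rfl⟩
        exact h1 rfl
    · have hr : (Pi.single W (Matrix.single ⟨0, h0⟩ i (M W i j)⁻¹) * M *
          Pi.single W (Matrix.single j ⟨0, h0⟩ 1) : frakR T K D n) V = 0 := by
        rw [Pi.mul_apply, Pi.single_eq_of_ne hVW, mul_zero]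
      rw [hr]
      ext k l
      have hz : (T ^ ((k : ℕ) : ℤ) : X ≃ₜ X) v ∉ W.base := by
        intro hk
        have hk2 := k.2
        exact hVW (V.eq_of_level W hv hk (i := k) (j := 0) (by omega) (by omega) le_rfl
          (by omega) (by simp)).2.2
      simp [Matrix.diagonal_apply, hz, -zpow_natCast]
  have h2 := rkInf_chi T K hμ D hcl (algA_le_algAInf T K D n hmem)
  rw [piInf_apply T K D _ hmem, key, map_mul, map_mul] at h2
  calc 0 < μ W.base := W.measure_base_pos
    _ = _ := h2.symm
    _ ≤ _ := (rkInf_mul_le_left T K D μ _ _).trans (rkInf_mul_le_right T K D μ _ _)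

/-- The completion identifies only points at distance `0`, and `rkInf_pos` shows that distinct
points have positive distance. -/
theorem toRk_injective [TopologicalSpace.SeparableSpace X] (hμ : Ergodic T μ) (D : ApproxSeq X) :
    Function.Injective (toRk T K D μ) := by
  rw [injective_iff_map_eq_zero]
  intro x hx
  by_contra hne
  have h0 : toRk T K D μ x = toRk T K D μ 0 := by rw [hx, map_zero]
  have h1 : edist (show rankRing T K D μ from x) (0 : rankRing T K D μ) = 0 :=
    EMetric.inseparable_iff.1
      ((UniformSpace.Completion.isUniformInducing_coe _).isInducing.inseparable_iff.1 (.of_eq h0))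
  rw [edist_def, sub_zero] at h1
  exact (rkInf_pos T K hμ D hne).ne' h1

end Injectivity

/-! ### The canonical homomorphism: construction, uniqueness and injectivity -/

section Canonical

variable {X : Type*} [TopologicalSpace X] {T : X ≃ₜ X} {K : Type*} [Field K]

theorem monom_induction {p : CrossedProduct T K → Prop} (a : CrossedProduct T K) (h0 : p 0)
    (hm : ∀ f n, p (monom f n)) (hadd : ∀ a b, p a → p b → p (a + b)) : p a :=
  SkewMonoidAlgebra.induction_on a h0 (fun g f => hm f g.toAdd) (fun {a b} => hadd a b)

theorem monom_mul_monom_zero (f g : Coeff T K) (n : ℤ) :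
    monom f 0 * monom g n = monom (f * g) n := by
  rw [monom_mul_monom, ofAdd_zero, one_smul, zero_add]

theorem monom_one_mul_monom_one (m n : ℤ) :
    (monom 1 m * monom 1 n : CrossedProduct T K) = monom 1 (m + n) := by
  rw [monom_mul_monom, smul_one, one_mul]

theorem monom_add (f g : Coeff T K) (n : ℤ) : monom (f + g) n = monom f n + monom g n :=
  map_add (SkewMonoidAlgebra.singleAddHom (Multiplicative.ofAdd n)) f g

theorem monom_zero (n : ℤ) : (monom 0 n : CrossedProduct T K) = 0 :=
  map_zero (SkewMonoidAlgebra.singleAddHom (Multiplicative.ofAdd n))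

variable (T K) [StarRing K]

theorem shiftElt_mem_algAInf (D : ApproxSeq X) (n : ℕ) :
    shiftElt T (D.pair n) K ∈ algAInf T K D :=
  algA_le_algAInf T K D n shiftElt_mem

variable {T K}

/-- Away from the orbit of `y`, the elements of `𝒜` are locally in `𝒜_∞`. -/
theorem exists_chi_mul_mem_algAInf [CompactSpace X] (D : ApproxSeq X) (a : CrossedProduct T K) {x : X}
    (hx : ∀ j : ℤ, (T ^ j : X ≃ₜ X) x ≠ D.y) :
    ∃ (Z : Set X) (hZ : IsClopen Z), x ∈ Z ∧ monom (chi T K Z hZ) 0 * a ∈ algAInf T K D := by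
  -- This is the product rule `χ_Z tᵏ · χ_Y tˢ = χ_{Z ∩ Tᵏ(Y)} t^{k+s}`.
  have step : ∀ {k s : ℤ} {Y Z : Set X} (hY : IsClopen Y) (hZ : IsClopen Z),
      monom (chi T K Z hZ) k ∈ algAInf T K D → monom (chi T K Y hY) s ∈ algAInf T K D → x ∈ Z →
      (T ^ (-k) : X ≃ₜ X) x ∈ Y →
      ∃ (Z : Set X) (hZ : IsClopen Z), x ∈ Z ∧ monom (chi T K Z hZ) (k + s) ∈ algAInf T K D := by
    intro k s Y Z hY hZ h1 h2 h3 h4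
    refine ⟨_, hZ.inter (hY.preimage (Homeomorph.continuous _)), ⟨h3, h4⟩, ?_⟩
    rw [← chi_mul_chi hZ (hY.preimage (Homeomorph.continuous _)), ← smul_chi k hY, ← monom_mul_monom]
    exact mul_mem h1 h2
  -- The power is built one factor `χ_{X∖E_m} t`, or its adjoint, at a time. Each factor requires
  -- one orbit point of `x` to avoid `E_m`; that point is not `y`, so a large `m` works.
  have hpow : ∀ n : ℤ, ∃ (Z : Set X) (hZ : IsClopen Z), x ∈ Z ∧
      monom (chi T K Z hZ) n ∈ algAInf T K D := by
    intro n
    induction n with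
    | zero => exact ⟨Set.univ, isClopen_univ, trivial, monom_zero_mem_algAInf D _⟩
    | succ n ih =>
      obtain ⟨Z, hZ, hxZ, hmem⟩ := ih
      obtain ⟨m, hm⟩ := D.exists_notMem_E (hx (-(n : ℤ)))
      exact step (D.pair m).isClopen_E.compl hZ hmem (shiftElt_mem_algAInf T K D m) hxZ
        (hm m le_rfl)
    | pred n ih =>
      obtain ⟨Z, hZ, hxZ, hmem⟩ := ih
      obtain ⟨m, hm⟩ := D.exists_notMem_E (hx (1 + n))
      have h := star_mem (shiftElt_mem_algAInf T K D m)
      rw [shiftElt, star_monom, star_chi, smul_chi] at h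
      refine step _ hZ hmem h hxZ ?_
      rw [Set.mem_preimage, zpow_zpow_apply, neg_neg, neg_neg]
      exact hm m le_rfl
  induction a using monom_induction with
  | h0 => exact ⟨Set.univ, isClopen_univ, trivial, by rw [mul_zero]; exact zero_mem _⟩
  | hm f n =>
    obtain ⟨Z, hZ, hxZ, hmem⟩ := hpow n
    refine ⟨Z, hZ, hxZ, ?_⟩
    rw [monom_mul_monom_zero, mul_comm, ← monom_mul_monom_zero]
    exact mul_mem (monom_zero_mem_algAInf D f) hmem
  | hadd a b ha hb =>
    obtain ⟨Y, hY, hxY, ha⟩ := ha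
    obtain ⟨Z, hZ, hxZ, hb⟩ := hb
    refine ⟨Y ∩ Z, hY.inter hZ, ⟨hxY, hxZ⟩, ?_⟩
    rw [mul_add]
    refine add_mem ?_ ?_
    · rw [← chi_mul_chi hY hZ, mul_comm, ← monom_mul_monom_zero, mul_assoc]
      exact mul_mem (monom_zero_mem_algAInf D _) ha
    · rw [← chi_mul_chi hY hZ, ← monom_mul_monom_zero, mul_assoc]
      exact mul_mem (monom_zero_mem_algAInf D _) hb

variable (T K) [MeasurableSpace X]

/-- The composition `𝒜_∞ → 𝔑_∞ → 𝔑_rk`. -/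
def piRk (D : ApproxSeq X) (μ : Measure X) : algAInf T K D →⋆ₐ[K] frakRrk T K D μ :=
  (toRk T K D μ).comp (piInf T K D)

/-- The images in `𝔑_rk` of the elements `χ_{X∖Eₙ} t`. -/
def shiftRk (D : ApproxSeq X) (μ : Measure X) (n : ℕ) : frakRrk T K D μ :=
  piRk T K D μ ⟨shiftElt T (D.pair n) K, shiftElt_mem_algAInf T K D n⟩

theorem toRk_piN_shiftElt (D : ApproxSeq X) (μ : Measure X) (n : ℕ) :
    toRk T K D μ (toInf T K D n (piN T K D n ⟨shiftElt T (D.pair n) K, shiftElt_mem⟩)) =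
      shiftRk T K D μ n :=
  congrArg (toRk T K D μ)
    (piInf_apply T K D ⟨_, shiftElt_mem_algAInf T K D n⟩ (n := n) shiftElt_mem).symm

/-- Convergence to `0` in the rank distance passes to the completion by continuity of the canonical
map. -/
theorem tendsto_toRk (D : ApproxSeq X) (μ : Measure X) {x : ℕ → frakRInf T K D}
    (h : Tendsto (fun n => rkInf T K D μ (x n)) atTop (𝓝 0)) :
    Tendsto (fun n => toRk T K D μ (x n)) atTop (𝓝 0) := by
  let v : ℕ → rankRing T K D μ := x
  have h1 : Tendsto v atTop (𝓝 0) := by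
    rw [tendsto_iff_edist_tendsto_0]
    refine h.congr fun n => ?_
    rw [edist_def, sub_zero]
    rfl
  have h2 := ((UniformSpace.Completion.continuous_coe (rankRing T K D μ)).tendsto 0).comp h1
  rwa [UniformSpace.Completion.coe_zero] at h2

/-- The embedding `C_K(X) → 𝔑_rk`. -/
def coeffRk [CompactSpace X] (D : ApproxSeq X) (μ : Measure X) :
    Coeff T K →+* frakRrk T K D μ where
  toFun f := piRk T K D μ ⟨monom f 0, monom_zero_mem_algAInf D f⟩
  map_one' := map_one (piRk T K D μ)
  map_mul' f g := by
    rw [← map_mul]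
    exact congrArg _ (Subtype.ext (monom_mul_monom_zero f g 0).symm)
  map_zero' := by
    refine Eq.trans (congrArg _ (Subtype.ext (monom_zero 0))) (map_zero (piRk T K D μ))
  map_add' f g := by
    rw [← map_add]
    exact congrArg _ (Subtype.ext (monom_add f g 0))

theorem coeffRk_apply [CompactSpace X] (D : ApproxSeq X) (μ : Measure X) (f : Coeff T K) :
    coeffRk T K D μ f = piRk T K D μ ⟨monom f 0, monom_zero_mem_algAInf D f⟩ := rfl

theorem star_coeffRk [CompactSpace X] (D : ApproxSeq X) (μ : Measure X) (f : Coeff T K) :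
    star (coeffRk T K D μ f) = coeffRk T K D μ (star f) := by
  rw [coeffRk_apply, coeffRk_apply, ← map_star]
  refine congrArg _ (Subtype.ext ?_)
  change star (monom f 0) = monom (star f) 0
  rw [star_monom]
  simp

/-- The relation `t f = (f ∘ T⁻¹) t` holds exactly at every stage, as `χ_{X∖Eₙ}` commutes with
`C_K(X)`. It therefore survives in the limit. -/
theorem shiftRk_mul_coeffRk [CompactSpace X] (D : ApproxSeq X) (μ : Measure X) (n : ℕ)
    (f : Coeff T K) : shiftRk T K D μ n * coeffRk T K D μ f =
      coeffRk T K D μ (Multiplicative.ofAdd (1 : ℤ) • f) * shiftRk T K D μ n := by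
  rw [coeffRk_apply, coeffRk_apply, shiftRk, ← map_mul, ← map_mul]
  refine congrArg _ (Subtype.ext ?_)
  change shiftElt T (D.pair n) K * monom f 0 = monom _ 0 * shiftElt T (D.pair n) K
  rw [shiftElt, monom_mul_monom, monom_mul_monom_zero, mul_comm, add_zero]

/-- The defect from being an isometry is `χ_{T⁻¹(Eₙ)}`; in `shiftRk_mul_star_shiftRk` the defect of
the adjoint is `χ_{Eₙ}`. Both have rank `μ(Eₙ)`, so the limit is unitary. -/
theorem star_shiftRk_mul_shiftRk [CompactSpace X] (D : ApproxSeq X) (μ : Measure X) (n : ℕ)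
    (h : IsClopen ((T ^ (1 : ℤ) : X ≃ₜ X) ⁻¹' (D.pair n).E)) :
    star (shiftRk T K D μ n) * shiftRk T K D μ n =
      1 - coeffRk T K D μ (chi T K ((T ^ (1 : ℤ) : X ≃ₜ X) ⁻¹' (D.pair n).E) h) := by
  rw [← map_one (coeffRk T K D μ), ← map_sub, ← chi_compl h, coeffRk_apply, shiftRk, ← map_star,
    ← map_mul]
  exact congrArg _ (Subtype.ext (star_mul_monom_chi_one (D.pair n).isClopen_E.compl))

theorem shiftRk_mul_star_shiftRk [CompactSpace X] (D : ApproxSeq X) (μ : Measure X) (n : ℕ) :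
    shiftRk T K D μ n * star (shiftRk T K D μ n) =
      1 - coeffRk T K D μ (chi T K (D.pair n).E (D.pair n).isClopen_E) := by
  rw [← map_one (coeffRk T K D μ), ← map_sub, ← chi_compl, coeffRk_apply, shiftRk, ← map_star,
    ← map_mul]
  exact congrArg _ (Subtype.ext (monom_chi_one_mul_star (D.pair n).isClopen_E.compl))

variable {T K} {μ : Measure X}

theorem toRk_mem_regA (hK : IsPositiveDefiniteInvolution K) {D : ApproxSeq X}
    {φ : CrossedProduct T K →⋆ₐ[K] frakRrk T K D μ} (hφ : IsCanonical T K D μ φ)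
    {r : frakRInf T K D} (hr : r ∈ regInf T K D) : toRk T K D μ r ∈ regA T K D μ φ := by
  refine map_mem_starRegularClosure (isStarRegularRing_frakRInf T K hK D)
    (isStarRegularRing_frakRrk T K hK D μ) (toRk T K D μ) ?_ hr
  rintro _ ⟨a, rfl⟩
  exact subset_starRegularClosure _ ⟨a, hφ.1 a⟩

variable [CompactSpace X]

/-- This covariance relation is what the universal property of the crossed product asks for. For `n
= 1` it is a limit of the relations at finite stages, for `n = -1` it follows by conjugation with
`u⁻¹`, and the rest is induction. -/
theorem zpow_mul_coeffRk {D : ApproxSeq X} {u : unitary (frakRrk T K D μ)}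
    (hu : Tendsto (shiftRk T K D μ) atTop (𝓝 u)) (n : ℤ) (f : Coeff T K) :
    ((u ^ n : unitary (frakRrk T K D μ)) : frakRrk T K D μ) * coeffRk T K D μ f =
      coeffRk T K D μ (Multiplicative.ofAdd n • f) * (u ^ n : unitary (frakRrk T K D μ)) := by
  have h1 : ∀ f, (u : frakRrk T K D μ) * coeffRk T K D μ f =
      coeffRk T K D μ (Multiplicative.ofAdd (1 : ℤ) • f) * u := fun f =>
    tendsto_nhds_unique (hu.mul_const _)
      ((hu.const_mul _).congr fun n => (shiftRk_mul_coeffRk T K D μ n f).symm)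
  have h2 : ∀ f, ((u⁻¹ : unitary (frakRrk T K D μ)) : frakRrk T K D μ) * coeffRk T K D μ f =
      coeffRk T K D μ (Multiplicative.ofAdd (-1 : ℤ) • f) *
        (u⁻¹ : unitary (frakRrk T K D μ)) := by
    intro f
    have h := h1 (Multiplicative.ofAdd (-1 : ℤ) • f)
    rw [← mul_smul, ← ofAdd_add, add_neg_cancel, ofAdd_zero, one_smul] at h
    have e1 : ((u⁻¹ : unitary (frakRrk T K D μ)) : frakRrk T K D μ) * u = 1 := by
      rw [← Submonoid.coe_mul, inv_mul_cancel, Submonoid.coe_one]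
    have e2 : (u : frakRrk T K D μ) * (u⁻¹ : unitary (frakRrk T K D μ)) = 1 := by
      rw [← Submonoid.coe_mul, mul_inv_cancel, Submonoid.coe_one]
    calc _ = ((u⁻¹ : unitary (frakRrk T K D μ)) : frakRrk T K D μ) *
          (coeffRk T K D μ f * u) * (u⁻¹ : unitary (frakRrk T K D μ)) := by
          rw [mul_assoc, mul_assoc, e2, mul_one]
      _ = _ := by rw [← h, ← mul_assoc, e1, one_mul]
  induction n generalizing f with
  | zero => simp
  | succ n ih =>
    rw [zpow_add, zpow_one, Submonoid.coe_mul, mul_assoc, h1, ← mul_assoc, ih, mul_assoc,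
      ← mul_smul, ← ofAdd_add]
  | pred n ih =>
    rw [sub_eq_add_neg, zpow_add, zpow_neg_one, Submonoid.coe_mul, mul_assoc, h2, ← mul_assoc, ih,
      mul_assoc, ← mul_smul, ← ofAdd_add]

/-- The homomorphism `𝒜 → 𝔑_rk` that maps `∑ fₙ tⁿ` to `∑ fₙ uⁿ`, for a limit `u` of the elements
`πₙ(χ_{X∖Eₙ} t)`. -/
def canonicalRingHom (D : ApproxSeq X) (u : unitary (frakRrk T K D μ))
    (hu : Tendsto (shiftRk T K D μ) atTop (𝓝 u)) : CrossedProduct T K →+* frakRrk T K D μ :=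
  SkewMonoidAlgebra.liftNCRingHom (coeffRk T K D μ)
    ((unitary (frakRrk T K D μ)).subtype.comp (zpowersHom _ u))
    (fun {f n} => (zpow_mul_coeffRk hu n.toAdd f).symm)

theorem canonicalRingHom_monom (D : ApproxSeq X) (u : unitary (frakRrk T K D μ))
    (hu : Tendsto (shiftRk T K D μ) atTop (𝓝 u)) (f : Coeff T K) (n : ℤ) :
    canonicalRingHom D u hu (monom f n) =
      coeffRk T K D μ f * (u ^ n : unitary (frakRrk T K D μ)) :=
  SkewMonoidAlgebra.liftNC_single _ _ _ _

/-- The canonical homomorphism as a `*`-homomorphism. -/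
def canonicalHom (D : ApproxSeq X) (u : unitary (frakRrk T K D μ))
    (hu : Tendsto (shiftRk T K D μ) atTop (𝓝 u)) : CrossedProduct T K →⋆ₐ[K] frakRrk T K D μ where
  __ := canonicalRingHom D u hu
  commutes' c := by
    have h : algebraMap K (CrossedProduct T K) c = monom (algebraMap K _ c) 0 := rfl
    change canonicalRingHom D u hu _ = _
    rw [h, canonicalRingHom_monom, zpow_zero, Submonoid.coe_one, mul_one]
    exact AlgHomClass.commutes (piRk T K D μ) c
  map_star' a := by
    change canonicalRingHom D u hu _ = star (canonicalRingHom D u hu _)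
    induction a using monom_induction with
    | h0 => rw [star_zero, map_zero, star_zero]
    | hm f n =>
      -- By covariance, `(f uⁿ)^* = u⁻ⁿ f^* = (f^* ∘ Tⁿ) u⁻ⁿ`; the final `rfl` uses that inversion
      -- in the unitary group is the involution.
      rw [star_monom, canonicalRingHom_monom, canonicalRingHom_monom, star_mul, star_coeffRk,
        ← zpow_mul_coeffRk hu, zpow_neg]
      rfl
    | hadd a b ha hb => rw [star_add, map_add, map_add, star_add, ha, hb]

theorem canonicalHom_monom (D : ApproxSeq X) (u : unitary (frakRrk T K D μ))
    (hu : Tendsto (shiftRk T K D μ) atTop (𝓝 u)) (f : Coeff T K) (n : ℤ) :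
    canonicalHom D u hu (monom f n) = coeffRk T K D μ f * (u ^ n : unitary (frakRrk T K D μ)) :=
  canonicalRingHom_monom D u hu f n

/-- Agreement with `π_∞` need only be checked on the generators `χ_Z t`, by induction on the algebra
generated. -/
theorem isCanonical_canonicalHom (D : ApproxSeq X) (u : unitary (frakRrk T K D μ))
    (hu : Tendsto (shiftRk T K D μ) atTop (𝓝 u)) : IsCanonical T K D μ (canonicalHom D u hu) := by
  refine ⟨fun a => ?_, ?_⟩
  · obtain ⟨n, hn⟩ := (mem_algAInf T K).1 a.2
    suffices h : ∃ h : (a : CrossedProduct T K) ∈ algAInf T K D,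
        canonicalHom D u hu a = piRk T K D μ ⟨a, h⟩ from h.2
    generalize (a : CrossedProduct T K) = b at hn
    unfold algA approxAlgebra at hn
    induction hn using StarAlgebra.adjoin_induction with
    | mem b hb =>
      obtain ⟨Z, hZ, rfl⟩ := hb
      have hmem : monom (chi T K Z ((D.pair n).isClopen_P Z hZ)) 1 ∈ algAInf T K D :=
        algA_le_algAInf T K D n (StarAlgebra.subset_adjoin _ _ ⟨Z, hZ, rfl⟩)
      refine ⟨hmem, ?_⟩
      rw [canonicalHom_monom, zpow_one]
      -- For `m ≥ n` the set `Z` misses `E_m`, so `χ_Z · χ_{X∖E_m} t = χ_Z t`: the sequence with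
      -- limit `χ_Z u` is eventually constant.
      refine tendsto_nhds_unique (hu.const_mul _) (tendsto_const_nhds.congr' ?_)
      filter_upwards [eventually_ge_atTop n] with m hm
      rw [coeffRk_apply, shiftRk, ← map_mul]
      refine congrArg _ (Subtype.ext ?_)
      change _ = monom _ 0 * shiftElt T (D.pair m) K
      rw [shiftElt, monom_mul_monom_zero, chi_mul_chi]
      have hsub : Z ⊆ (D.pair m).Eᶜ := fun x hx hxE =>
        (D.pair n).notMem_E hZ hx (D.E_antitone hm hxE)
      rw [chi_congr (((D.pair n).isClopen_P Z hZ).inter (D.pair m).isClopen_E.compl)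
        ((D.pair n).isClopen_P Z hZ) (Set.inter_eq_left.2 hsub)]
    | algebraMap c =>
      exact ⟨algebraMap_mem _ c, (AlgHomClass.commutes _ c).trans
        (AlgHomClass.commutes (piRk T K D μ) c).symm⟩
    | add a b _ _ ha hb =>
      refine ⟨add_mem ha.1 hb.1, ?_⟩
      rw [map_add, ha.2, hb.2, ← map_add]
      rfl
    | mul a b _ _ ha hb =>
      refine ⟨mul_mem ha.1 hb.1, ?_⟩
      rw [map_mul, ha.2, hb.2, ← map_mul]
      rfl
    | star a _ ha =>
      refine ⟨star_mem ha.1, ?_⟩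
      rw [map_star, ha.2, ← map_star]
      rfl
  · simp only [toRk_piN_shiftElt]
    rw [canonicalHom_monom, map_one, one_mul, zpow_one]
    exact hu

/-- There is at most one canonical homomorphism. -/
theorem IsCanonical.eq {D : ApproxSeq X} {φ ψ : CrossedProduct T K →⋆ₐ[K] frakRrk T K D μ}
    (hφ : IsCanonical T K D μ φ) (hψ : IsCanonical T K D μ ψ) : ψ = φ := by
  have h0 : ∀ f, ψ (monom f 0) = φ (monom f 0) := fun f =>
    (hψ.1 ⟨_, monom_zero_mem_algAInf D f⟩).trans (hφ.1 ⟨_, monom_zero_mem_algAInf D f⟩).symm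
  -- The value at `t` is prescribed only as a limit; it is unique because the completion is
  -- Hausdorff.
  have h1 : ψ (monom 1 1) = φ (monom 1 1) := tendsto_nhds_unique hψ.2 hφ.2
  have hnat : ∀ n : ℕ, ψ (monom 1 n) = φ (monom 1 n) := by
    intro n
    induction n with
    | zero => exact h0 1
    | succ n ih =>
      rw [Nat.cast_succ, ← monom_one_mul_monom_one, map_mul, map_mul, ih, h1]
  have hint : ∀ n : ℤ, ψ (monom 1 n) = φ (monom 1 n) := by
    intro n
    obtain ⟨n, rfl | rfl⟩ := n.eq_nat_or_neg
    · exact hnat n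
    · have : (monom 1 (-(n : ℤ)) : CrossedProduct T K) = star (monom 1 n) := by
        rw [star_monom, star_one, smul_one]
      rw [this, map_star, map_star, hnat]
  ext a
  induction a using monom_induction with
  | h0 => rw [map_zero, map_zero]
  | hm f n =>
    rw [← mul_one f, ← monom_mul_monom_zero, map_mul, map_mul, h0, hint]
  | hadd a b ha hb => rw [map_add, map_add, ha, hb]

variable (T K) [BorelSpace X] [IsProbabilityMeasure μ] [μ.IsOpenPosMeasure]
  [TopologicalSpace.SeparableSpace X]

theorem tendsto_coeffRk_chi (hμ : Ergodic T μ) (D : ApproxSeq X) {Z : ℕ → Set X}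
    (hZ : ∀ n, IsClopen (Z n)) (h : Tendsto (fun n => μ (Z n)) atTop (𝓝 0)) :
    Tendsto (fun n => coeffRk T K D μ (chi T K (Z n) (hZ n))) atTop (𝓝 0) := by
  refine tendsto_toRk T K D μ (x := fun n => piInf T K D ⟨monom (chi T K (Z n) (hZ n)) 0, _⟩) ?_
  simpa only [rkInf_chi T K hμ D] using h

variable [T1Space X] [Infinite X]

theorem cauchySeq_shiftRk (hμ : Ergodic T μ) (D : ApproxSeq X) :
    CauchySeq (shiftRk T K D μ) := by
  let v : ℕ → rankRing T K D μ := fun n =>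
    piInf T K D ⟨shiftElt T (D.pair n) K, shiftElt_mem_algAInf T K D n⟩
  have hle : ∀ {m n : ℕ}, m ≤ n → edist (v n) (v m) ≤ μ (D.pair m).E := by
    intro m n h
    have hE := (D.pair m).isClopen_E
    have hmem := monom_zero_mem_algAInf D (chi T K (D.pair m).E hE)
    -- As `Eₙ ⊆ E_m`, the difference `χ_{X∖Eₙ} - χ_{X∖E_m}` equals `χ_{E_m} χ_{X∖Eₙ}`, so the rank
    -- of `v n - v m` is at most that of `χ_{E_m}`.
    have : v n - v m = (piInf T K D ⟨_, hmem⟩ : frakRInf T K D) *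
        piInf T K D ⟨shiftElt T (D.pair n) K, shiftElt_mem_algAInf T K D n⟩ := by
      refine (map_sub (piInf T K D) _ _).symm.trans ?_
      rw [← map_mul]
      refine congrArg _ (Subtype.ext ?_)
      change shiftElt T (D.pair n) K - shiftElt T (D.pair m) K =
        monom (chi T K (D.pair m).E hE) 0 * shiftElt T (D.pair n) K
      rw [shiftElt, shiftElt, monom_mul_monom_zero, ← monom_sub]
      congr 1
      have := D.E_antitone h
      have e : chi T K (D.pair m).Eᶜ hE.compl = chi T K (D.pair m).Eᶜ hE.compl *
          chi T K (D.pair n).Eᶜ (D.pair n).isClopen_E.compl := by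
        rw [chi_mul_chi]
        exact chi_congr _ _ (Set.inter_eq_left.2 (Set.compl_subset_compl.2 this)).symm
      rw [e, chi_compl hE]
      ring
    rw [edist_def, this, ← rkInf_chi T K hμ D hE hmem]
    exact rkInf_mul_le_left T K D μ _ _
  have hv : CauchySeq v := by
    rw [EMetric.cauchySeq_iff_le_tendsto_0]
    -- The two summands come from comparing both terms with `v N`.
    refine ⟨fun N => μ (D.pair N).E + μ (D.pair N).E, fun n m N hn hm => ?_, ?_⟩
    · refine (edist_triangle _ (v N) _).trans (add_le_add (hle hn) ?_)
      rw [edist_comm]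
      exact hle hm
    · simpa using (D.tendsto_measure_E hμ).add (D.tendsto_measure_E hμ)
  exact hv.map (UniformSpace.Completion.uniformContinuous_coe _)

/-- The limit of `πₙ(χ_{X∖Eₙ} t)` exists and is unitary. -/
theorem exists_tendsto_shiftRk (hμ : Ergodic T μ) (D : ApproxSeq X) :
    ∃ u : unitary (frakRrk T K D μ), Tendsto (shiftRk T K D μ) atTop (𝓝 u) := by
  obtain ⟨u, hu⟩ := cauchySeq_tendsto_of_complete (cauchySeq_shiftRk T K hμ D)
  have hsu := ((continuous_star_frakRrk T K D μ).tendsto u).comp hu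
  have hc : ∀ n, IsClopen ((T ^ (1 : ℤ) : X ≃ₜ X) ⁻¹' (D.pair n).E) := fun n =>
    (D.pair n).isClopen_E.preimage (Homeomorph.continuous _)
  have h1 : star u * u = 1 := by
    have h := (tendsto_coeffRk_chi T K hμ D hc (by
      simpa only [measure_zpow_preimage hμ] using D.tendsto_measure_E hμ)).const_sub 1
    rw [sub_zero] at h
    exact tendsto_nhds_unique (hsu.mul hu)
      (h.congr fun n => (star_shiftRk_mul_shiftRk T K D μ n (hc n)).symm)
  have h2 : u * star u = 1 := by
    have h := (tendsto_coeffRk_chi T K hμ D (fun n => (D.pair n).isClopen_E)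
      (D.tendsto_measure_E hμ)).const_sub 1
    rw [sub_zero] at h
    exact tendsto_nhds_unique (hu.mul hsu)
      (h.congr fun n => (shiftRk_mul_star_shiftRk T K D μ n).symm)
  exact ⟨⟨u, Unitary.mem_iff.2 ⟨h1, h2⟩⟩, hu⟩

variable {T K}

/-- If `φ a = 0`, then also `φ (χ_Z a) = 0` for each clopen `Z`. Around a point `x` off the orbit of
`y` some `χ_Z a` lies in `𝒜_∞`, where `φ` is injective, so the coefficients of `a` vanish at `x`.
Such points have full measure. -/
theorem IsCanonical.injective (hμ : Ergodic T μ) {D : ApproxSeq X}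
    {φ : CrossedProduct T K →⋆ₐ[K] frakRrk T K D μ} (hφ : IsCanonical T K D μ φ) :
    Function.Injective φ := by
  rw [injective_iff_map_eq_zero]
  intro a ha
  refine eq_zero_of_ae_coef (μ := μ) a ?_
  filter_upwards [ae_forall_zpow_ne hμ D.y] with x hx n
  obtain ⟨Z, hZ, hxZ, hmem⟩ := exists_chi_mul_mem_algAInf D a hx
  have h0 : toRk T K D μ (piInf T K D ⟨_, hmem⟩) = 0 := by
    rw [← hφ.1 ⟨_, hmem⟩, map_mul, ha, mul_zero]
  have h1 := (map_eq_zero_iff _ (toRk_injective T K hμ D)).1 h0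
  have h2 : monom (chi T K Z hZ) 0 * a = 0 :=
    (Subtype.ext_iff.1 ((map_eq_zero_iff _ (piInf_injective T K hμ D)).1 h1) :)
  have h3 := coef_monom_mul (chi T K Z hZ) 0 a n x
  rw [h2, coef_zero, chi_apply, if_pos hxZ, one_mul, sub_zero, neg_zero, zpow_zero,
    Homeomorph.one_apply] at h3
  exact h3.symm

end Canonical

end RegClosure

end

/-! ### The diagram -/

open RegClosure in
theorem mainTheorem6 {X : Type*} [TopologicalSpace X] [CompactSpace X]
    [TopologicalSpace.MetrizableSpace X] [TotallyDisconnectedSpace X] [Infinite X]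
    [MeasurableSpace X] [BorelSpace X]
    (T : X ≃ₜ X) (μ : Measure X) [IsProbabilityMeasure μ] [μ.IsOpenPosMeasure] (hμ : Ergodic T μ)
    {K : Type*} [Field K] [StarRing K] (hK : IsPositiveDefiniteInvolution K) (D : ApproxSeq X) :
    -- the algebras in the bottom row are `*`-regular
    ((∀ n, IsStarRegularRing (frakR T K D n)) ∧ IsStarRegularRing (frakRInf T K D) ∧
      IsStarRegularRing (frakRrk T K D μ)) ∧
    -- the top row is a chain of inclusions
    ((∀ n, algA T K D n ≤ algA T K D (n + 1)) ∧
      (algAInf T K D : Set (CrossedProduct T K)) = ⋃ n, (algA T K D n : Set _)) ∧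
    -- the maps between the top and the bottom row, and in the bottom row, are injective
    ((∀ n, Function.Injective (piN T K D n)) ∧ Function.Injective (piInf T K D) ∧
      (∀ n, Function.Injective (jSucc T K D n)) ∧ (∀ n, Function.Injective (toInf T K D n)) ∧
      Function.Injective (toRk T K D μ)) ∧
    -- they form a commutative diagram
    ((∀ n a (h : a ∈ algA T K D n),
        jSucc T K D n (piN T K D n ⟨a, h⟩) = piN T K D (n + 1) ⟨a, algA_le_succ T K D n h⟩) ∧
      (∀ n M, toInf T K D (n + 1) (jSucc T K D n M) = toInf T K D n M) ∧
      (∀ n a (h : a ∈ algA T K D n),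
        toInf T K D n (piN T K D n ⟨a, h⟩) = piInf T K D ⟨a, algA_le_algAInf T K D n h⟩)) ∧
    -- the middle row: `𝒜ₙ ⊆ ℛₙ ⊆ ℛₙ₊₁`, `𝒜_∞ ⊆ ℛ_∞`, and `⋃ₙ ℛₙ = ℛ_∞`
    ((∀ n a, piN T K D n a ∈ regN T K D n) ∧ (∀ a, piInf T K D a ∈ regInf T K D) ∧
      (∀ n, ∀ r ∈ regN T K D n, jSucc T K D n r ∈ regN T K D (n + 1)) ∧
      (⋃ n, toInf T K D n '' (regN T K D n : Set (frakR T K D n))) =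
        (regInf T K D : Set (frakRInf T K D))) ∧
    -- the right end: the canonical embedding `φ` of `𝒜`, and `𝒜 ⊆ ℛ_𝒜`, `ℛ_∞ ⊆ ℛ_𝒜`
    ∃ φ : CrossedProduct T K →⋆ₐ[K] frakRrk T K D μ,
      IsCanonical T K D μ φ ∧ (∀ ψ, IsCanonical T K D μ ψ → ψ = φ) ∧ Function.Injective φ ∧
      (∀ a, φ a ∈ regA T K D μ φ) ∧ (∀ r ∈ regInf T K D, toRk T K D μ r ∈ regA T K D μ φ) := by
  -- A compact metric space is separable; this supplies the countability of the families of towers.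
  let _ := TopologicalSpace.metrizableSpaceMetric X
  have hsep : TopologicalSpace.SeparableSpace X := inferInstance
  obtain ⟨u, hu⟩ := exists_tendsto_shiftRk T K hμ D
  have hφ := isCanonical_canonicalHom D u hu
  exact ⟨⟨fun n => isStarRegularRing_frakR T K hK D n, isStarRegularRing_frakRInf T K hK D,
      isStarRegularRing_frakRrk T K hK D μ⟩,
    ⟨algA_le_succ T K D, rfl⟩,
    ⟨fun n => towerRep_injective hμ (D.pair n), piInf_injective T K hμ D,
      fun n => refineMap_injective hμ (D.refines n), fun n => toInf_injective T K hμ D n,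
      toRk_injective T K hμ D⟩,
    ⟨fun n a h => jSucc_piN T K D h _, fun n M => toInf_jSucc T K D n M,
      fun n a h => (piInf_apply T K D ⟨a, algA_le_algAInf T K D n h⟩ h).symm⟩,
    ⟨fun n a => subset_starRegularClosure _ ⟨a, rfl⟩,
      fun a => subset_starRegularClosure _ ⟨a, rfl⟩,
      fun n r hr => jSucc_mem_regN T K hK D n hr, iUnion_regN T K hK D⟩,
    canonicalHom D u hu, hφ, fun ψ hψ => hφ.eq hψ, hφ.injective hμ,
    fun a => subset_starRegularClosure _ ⟨a, rfl⟩, fun r hr => toRk_mem_regA hK hφ hr⟩
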